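/- **Setting.** Let $\alpha_1,\alpha_2$ be the simple roots of $\mathfrak{sl}_3$, $A=\begin{pmatrix}2&-1\\-1&2\end{pmatrix}$ its Cartan matrix, $\alpha_3=\alpha_1+\alpha_2=\rho$, $\mathfrak h^*$ the dual of the Cartan subalgebra with the form $\langle\alpha_i,\alpha_j\rangle=A_{ij}$ $(i,j\in\{1,2\})$, and $L$ a lattice between the root lattice and the weight lattice. Put $\mathrm i^z=e^{\pi \mathrm i z/2}$. Let $U$ be the unrolled restricted quantum group of $\mathfrak{sl}_3$ at a fourth root of unity, i.e. the complex algebra with generators $X_{\pm j},H_j$ $(j=1,2)$, $K_\gamma$ $(\gamma\in L)$ and relations $$K_0=1,\quad K_\gamma K_\delta=K_{\gamma+\delta},\quad K_\gamma X_{\pm j}K_{-\gamma}=\mathrm i^{\pm\langle\gamma,\alpha_j\rangle}X_{\pm j},\quad [X_j,X_{-k}]=\delta_{jk}\tfrac{K_{\alpha_j}-K_{-\alpha_j}}{2\mathrm i},\quad X_{\pm j}^2=0,$$ $$(X_{\pm1}X_{\pm2})^2=(X_{\pm2}X_{\pm1})^2,\quad [H_j,X_{\pm k}]=\pm A_{jk}X_{\pm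 k},\quad [H_j,H_k]=[H_j,K_\gamma]=0.$$ $U$-modules are tensored over $\mathbb C$ through the coproduct $\Delta(K_\gamma)=K_\gamma\otimes K_\gamma$, $\Delta(X_j)=X_j\otimes K_{\alpha_j}+1\otimes X_j$, $\Delta(X_{-j})=X_{-j}\otimes1+K_{-\alpha_j}\otimes X_{-j}$, $\Delta(H_j)=H_j\otimes1+1\otimes H_j$. Let $\mathscr C$ be the category of finite-dimensional $U$-modules $V$ that are the direct sum of the weight spaces $V(\lambda)=\{v: H_jv=\lambda(H_j)v\}$ and on which $K_\gamma$ acts on $V(\lambda)$ as $\mathrm i^{\langle\gamma,\lambda\rangle}$. For $\lambda\in\mathfrak h^*$ let $M_\lambda$ be the Verma module, i.e. the universal module generated by a vector $m$ with $X_1m=X_2m=0$, $H_jm=\lambda(H_j)m$, $K_\gamma m=\mathrm i^{\langle\gamma,\lambda\rangle}m$; let $L_\lambda$ be its unique irreducible quotient and $P_\lambda$ the projective cover of $L_\lambda$ in $\mathscr C$. A superscript $(d)$ on one of the direct summands below asserts that it has dimension $d$. Put $\lambda_j=\langle\lambda+\rho,\alpha_j\rangle$, $j=1,2,3$. The weight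 $\lambda$ is *atypical of degree $n$* if exactly $n$ of $\lambda_1,\lambda_2,\lambda_3$ lie in $2\mathbb Z+1$, and *typical* if none does. **Proposition.** Let $\lambda,\mu\in\mathfrak h^*$. 1. Let $\lambda$ and $\mu$ be atypical of degree $1$. * If $\lambda_i,\mu_j\in2\mathbb Z+1$ with $\{i,j,k\}=\{1,2,3\}$ and $\lambda+\mu$ is typical, then $L_\lambda\otimes L_\mu\cong P^{(8)}_{\lambda+\mu}\oplus P^{(8)}_{\lambda+\mu-\alpha_k}$. * If $\lambda_i,\mu_i\in2\mathbb Z+1$ with $\{i,j\}=\{1,2\}$ and $\lambda+\mu$ is atypical of degree $1$, then $L_\lambda\otimes L_\mu\cong L^{(4)}_{\lambda+\mu}\oplus P^{(8)}_{\lambda+\mu-\alpha_j}\oplus L^{(4)}_{\lambda+\mu-\alpha_j-\alpha_3}$. * If $\lambda_3,\mu_3\in2\mathbb Z+1$ and $\lambda+\mu-\alpha_1$, $\lambda+\mu-\alpha_2$ are atypical of degree $1$ (equivalently, $(\lambda+\mu)_1,(\lambda+\mu)_2\notin\mathbb Z$), then $L_\lambda\otimes L_\mu\cong P^{(8)}_{\lambda+\mu}\oplus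 L^{(4)}_{\lambda+\mu-\alpha_1}\oplus L^{(4)}_{\lambda+\mu-\alpha_2}$. 2. Let $\lambda$ be atypical of degree $2$ with $\lambda_3\in2\mathbb Z+1$ and $\mu$ atypical of degree $1$. * If $\lambda_i,\mu_j\in2\mathbb Z+1$ with $i\in\{1,2\}$ and $\{i,j,k\}=\{1,2,3\}$, then $L_\lambda\otimes L_\mu\cong P^{(8)}_{\lambda+\mu}\oplus L^{(4)}_{\lambda+\mu-\alpha_k}$. * If $\lambda_i,\mu_i\in2\mathbb Z+1$ with $\{i,j\}=\{1,2\}$, then $L_\lambda\otimes L_\mu\cong L^{(4)}_{\lambda+\mu}\oplus P^{(8)}_{\lambda+\mu-\alpha_j}$. 3. Let $\lambda,\mu$ be atypical of degree $2$ with $\lambda_i,\lambda_3,\mu_j,\mu_3\in2\mathbb Z+1$, where $\{i,j\}=\{1,2\}$. Then $L_\lambda\otimes L_\mu\cong P^{(8)}_{\lambda+\mu}\oplus L^{(1)}_{\lambda+\mu-\alpha_3}$. -/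

import Mathlib

open scoped TensorProduct

noncomputable section

namespace UnrolledSL3

/-! ### Weights of `sl₃` -/

/-- The Cartan matrix of `sl₃`. -/
def cartan : Matrix (Fin 2) (Fin 2) ℤ := !![2, -1; -1, 2]

/-- The dual `𝔥*` of the Cartan subalgebra.  A weight `lam` is recorded by its values
`lam j = lam(H_j)` on the two simple coroots, which form a basis of `𝔥`. -/
abbrev Weight : Type := Fin 2 → ℂ

/-- The simple roots: `α_k(H_j) = A_{j,k}`. -/
def simpleRoot (k : Fin 2) : Weight := fun j => (cartan j k : ℂ)

/-- The positive roots `α₁, α₂, α₃ = α₁ + α₂` (indexed by `0, 1, 2`). -/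
def root : Fin 3 → Weight := ![simpleRoot 0, simpleRoot 1, simpleRoot 0 + simpleRoot 1]

/-- The bilinear form on `𝔥*` dual to the normalised Killing form; in the basis of fundamental
weights its Gram matrix is the inverse of the Cartan matrix. -/
def form (lam mu : Weight) : ℂ :=
  (2 * lam 0 * mu 0 + lam 0 * mu 1 + lam 1 * mu 0 + 2 * lam 1 * mu 1) / 3

theorem form_simpleRoot (lam : Weight) (j : Fin 2) : form lam (simpleRoot j) = lam j := by
  fin_cases j <;> simp [form, simpleRoot, cartan] <;> ring

theorem form_simpleRoot_simpleRoot (j k : Fin 2) :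
    form (simpleRoot j) (simpleRoot k) = (cartan j k : ℂ) := by
  fin_cases j <;> fin_cases k <;> simp [form_simpleRoot] <;> simp [simpleRoot, cartan]

theorem form_neg (lam mu : Weight) : form (-lam) mu = -form lam mu := by
  simp only [form, Pi.neg_apply]; ring

/-- The Weyl vector. -/
def rho : Weight := fun _ => 1

/-- The index `lam_j = ⟨lam + ρ, α_j⟩`. -/
def index (lam : Weight) (j : Fin 3) : ℂ := form (lam + rho) (root j)

/-- `z ∈ 2ℤ + 1`. -/
def IsOddInt (z : ℂ) : Prop := ∃ m : ℤ, z = 2 * m + 1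

/-- All three indices are typical, i.e. not in `2ℤ + 1`. -/
def IsTypical (lam : Weight) : Prop := ∀ j : Fin 3, ¬ IsOddInt (index lam j)

/-- Exactly `n` of the three indices lie in `2ℤ + 1`. -/
def IsAtypicalOfDegree (n : ℕ) (lam : Weight) : Prop :=
  {j : Fin 3 | IsOddInt (index lam j)}.ncard = n

/-- The root lattice `Q`. -/
def rootLattice : AddSubgroup Weight := AddSubgroup.closure (Set.range simpleRoot)

/-- The weight lattice `P`. -/
def weightLattice : AddSubgroup Weight where
  carrier := {lam | ∀ j, ∃ m : ℤ, lam j = m}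
  add_mem' := by
    intro a b ha hb j
    obtain ⟨m, hm⟩ := ha j
    obtain ⟨n, hn⟩ := hb j
    exact ⟨m + n, by simp [hm, hn]⟩
  zero_mem' := fun _ => ⟨0, by simp⟩
  neg_mem' := by
    intro a ha j
    obtain ⟨m, hm⟩ := ha j
    exact ⟨-m, by simp [hm]⟩

/-- A lattice `L` with `Q ⊆ L ⊆ P`. -/
structure IntermediateLattice where
  lattice : AddSubgroup Weight
  rootLattice_le : rootLattice ≤ lattice
  le_weightLattice : lattice ≤ weightLattice

/-- The simple root `α_j` as an element of `L`. -/
def IntermediateLattice.simpleRoot (L : IntermediateLattice) (j : Fin 2) : L.lattice :=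
  ⟨UnrolledSL3.simpleRoot j, L.rootLattice_le (AddSubgroup.subset_closure ⟨j, rfl⟩)⟩

/-- `i ^ z = exp (π i z / 2)`. -/
def iPow (z : ℂ) : ℂ := Complex.exp (Real.pi * Complex.I * z / 2)

/-! ### The unrolled restricted quantum group -/

/-- Generators `X_j`, `X_{-j}`, `H_j`, `K_γ`. -/
inductive Gen (L : IntermediateLattice) : Type
  | E (j : Fin 2) : Gen L
  | F (j : Fin 2) : Gen L
  | H (j : Fin 2) : Gen L
  | K (γ : L.lattice) : Gen L

section Relations

variable (L : IntermediateLattice)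

/-- The free generator `X_j`. -/
abbrev fE (j : Fin 2) : FreeAlgebra ℂ (Gen L) := FreeAlgebra.ι ℂ (Gen.E j)
/-- The free generator `X_{-j}`. -/
abbrev fF (j : Fin 2) : FreeAlgebra ℂ (Gen L) := FreeAlgebra.ι ℂ (Gen.F j)
/-- The free generator `H_j`. -/
abbrev fH (j : Fin 2) : FreeAlgebra ℂ (Gen L) := FreeAlgebra.ι ℂ (Gen.H j)
/-- The free generator `K_γ`. -/
abbrev fK (γ : L.lattice) : FreeAlgebra ℂ (Gen L) := FreeAlgebra.ι ℂ (Gen.K γ)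

/-- The defining relations. -/
inductive Rel : FreeAlgebra ℂ (Gen L) → FreeAlgebra ℂ (Gen L) → Prop
  | K_zero : Rel (fK L 0) 1
  | K_mul (γ δ : L.lattice) : Rel (fK L γ * fK L δ) (fK L (γ + δ))
  | K_E (γ : L.lattice) (j : Fin 2) :
      Rel (fK L γ * fE L j * fK L (-γ)) (iPow (form γ (simpleRoot j)) • fE L j)
  | K_F (γ : L.lattice) (j : Fin 2) :
      Rel (fK L γ * fF L j * fK L (-γ)) (iPow (-form γ (simpleRoot j)) • fF L j)
  | E_F_same (j : Fin 2) :
      Rel (fE L j * fF L j - fF L j * fE L j)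
        ((1 / (2 * Complex.I)) • (fK L (L.simpleRoot j) - fK L (-L.simpleRoot j)))
  | E_F_ne (j k : Fin 2) (h : j ≠ k) : Rel (fE L j * fF L k - fF L k * fE L j) 0
  | E_sq (j : Fin 2) : Rel (fE L j ^ 2) 0
  | F_sq (j : Fin 2) : Rel (fF L j ^ 2) 0
  | E_quartic : Rel ((fE L 0 * fE L 1) ^ 2) ((fE L 1 * fE L 0) ^ 2)
  | F_quartic : Rel ((fF L 0 * fF L 1) ^ 2) ((fF L 1 * fF L 0) ^ 2)
  | H_E (j k : Fin 2) :
      Rel (fH L j * fE L k - fE L k * fH L j) ((cartan j k : ℂ) • fE L k)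
  | H_F (j k : Fin 2) :
      Rel (fH L j * fF L k - fF L k * fH L j) (-(cartan j k : ℂ) • fF L k)
  | H_H (j k : Fin 2) : Rel (fH L j * fH L k - fH L k * fH L j) 0
  | H_K (j : Fin 2) (γ : L.lattice) : Rel (fH L j * fK L γ - fK L γ * fH L j) 0

/-- The unrolled restricted quantum group of `sl₃` at a fourth root of unity, as an algebra. -/
def QGrp : Type := RingQuot (Rel L)

instance : Ring (QGrp L) := inferInstanceAs (Ring (RingQuot (Rel L)))

instance : Algebra ℂ (QGrp L) := inferInstanceAs (Algebra ℂ (RingQuot (Rel L)))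

/-- The quotient map from the free algebra. -/
def toQGrp : FreeAlgebra ℂ (Gen L) →ₐ[ℂ] QGrp L := RingQuot.mkAlgHom ℂ (Rel L)

variable {L}

/-- The image of a generator in the quantum group. -/
def gen (x : Gen L) : QGrp L := toQGrp L (FreeAlgebra.ι ℂ x)

variable (L)

/-- `X_j`. -/
abbrev qE (j : Fin 2) : QGrp L := gen (Gen.E j)
/-- `X_{-j}`. -/
abbrev qF (j : Fin 2) : QGrp L := gen (Gen.F j)
/-- `H_j`. -/
abbrev qH (j : Fin 2) : QGrp L := gen (Gen.H j)
/-- `K_γ`. -/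
abbrev qK (γ : L.lattice) : QGrp L := gen (Gen.K γ)

/-- The coproduct on generators. -/
def comulGen : Gen L → QGrp L ⊗[ℂ] QGrp L
  | .E j => qE L j ⊗ₜ qK L (L.simpleRoot j) + 1 ⊗ₜ qE L j
  | .F j => qF L j ⊗ₜ 1 + qK L (-L.simpleRoot j) ⊗ₜ qF L j
  | .H j => 1 ⊗ₜ qH L j + qH L j ⊗ₜ 1
  | .K γ => qK L γ ⊗ₜ qK L γ

theorem iPow_zero : iPow 0 = 1 := by simp [iPow]

theorem iPow_add (a b : ℂ) : iPow (a + b) = iPow a * iPow b := by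
  rw [iPow, iPow, iPow, ← Complex.exp_add]; congr 1; ring

theorem iPow_one : iPow 1 = Complex.I := by
  have h : (Real.pi : ℂ) * Complex.I * 1 / 2 = Real.pi / 2 * Complex.I := by ring
  rw [iPow, h, Complex.exp_pi_div_two_mul_I]

theorem iPow_two : iPow 2 = -1 := by
  rw [show (2 : ℂ) = 1 + 1 by norm_num, iPow_add, iPow_one, Complex.I_mul_I]

theorem iPow_neg (a : ℂ) : iPow (-a) = (iPow a)⁻¹ := by
  rw [iPow, iPow, ← Complex.exp_neg]; congr 1; ring

variable {L}

theorem gen_rel {x y : FreeAlgebra ℂ (Gen L)} (h : Rel L x y) :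
    toQGrp L x = toQGrp L y :=
  RingQuot.mkAlgHom_rel ℂ h

theorem qK_zero : qK L 0 = 1 := by simpa [gen] using gen_rel (Rel.K_zero (L := L))

theorem qK_mul (γ δ : L.lattice) : qK L γ * qK L δ = qK L (γ + δ) := by
  simpa [gen] using gen_rel (Rel.K_mul γ δ)

theorem qK_qE_conj (γ : L.lattice) (j : Fin 2) :
    qK L γ * qE L j * qK L (-γ) = iPow (form γ (simpleRoot j)) • qE L j := by
  simpa [gen] using gen_rel (Rel.K_E γ j)

theorem qK_qF_conj (γ : L.lattice) (j : Fin 2) :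
    qK L γ * qF L j * qK L (-γ) = iPow (-form γ (simpleRoot j)) • qF L j := by
  simpa [gen] using gen_rel (Rel.K_F γ j)

theorem qK_qE (γ : L.lattice) (j : Fin 2) :
    qK L γ * qE L j = iPow (form γ (simpleRoot j)) • (qE L j * qK L γ) := by
  have h := qK_qE_conj γ j
  have h2 := congrArg (· * qK L γ) h
  simpa [mul_assoc, qK_mul, qK_zero] using h2

theorem qK_qF (γ : L.lattice) (j : Fin 2) :
    qK L γ * qF L j = iPow (-form γ (simpleRoot j)) • (qF L j * qK L γ) := by
  have h := qK_qF_conj γ j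
  have h2 := congrArg (· * qK L γ) h
  simpa [mul_assoc, qK_mul, qK_zero] using h2

theorem qE_qF (j : Fin 2) : qE L j * qF L j - qF L j * qE L j =
    (1 / (2 * Complex.I)) • (qK L (L.simpleRoot j) - qK L (-L.simpleRoot j)) := by
  have h := gen_rel (Rel.E_F_same (L := L) j)
  simp only [map_sub, map_mul, map_smul] at h
  exact h

theorem qE_qF_ne (j k : Fin 2) (hjk : j ≠ k) : qE L j * qF L k = qF L k * qE L j := by
  have h := gen_rel (Rel.E_F_ne (L := L) j k hjk)
  simp only [map_sub, map_mul, map_zero] at h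
  exact sub_eq_zero.1 h

theorem qE_sq (j : Fin 2) : qE L j * qE L j = 0 := by
  simpa [gen, sq] using gen_rel (Rel.E_sq (L := L) j)

theorem qF_sq (j : Fin 2) : qF L j * qF L j = 0 := by
  simpa [gen, sq] using gen_rel (Rel.F_sq (L := L) j)

theorem qE_quartic : (qE L 0 * qE L 1) ^ 2 = (qE L 1 * qE L 0) ^ 2 := by
  simpa [gen] using gen_rel (Rel.E_quartic (L := L))

theorem qF_quartic : (qF L 0 * qF L 1) ^ 2 = (qF L 1 * qF L 0) ^ 2 := by
  simpa [gen] using gen_rel (Rel.F_quartic (L := L))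

theorem qH_qE (j k : Fin 2) :
    qH L j * qE L k - qE L k * qH L j = (cartan j k : ℂ) • qE L k := by
  have h := gen_rel (Rel.H_E (L := L) j k)
  simp only [map_sub, map_mul, map_smul] at h
  exact h

theorem qH_qF (j k : Fin 2) :
    qH L j * qF L k - qF L k * qH L j = -(cartan j k : ℂ) • qF L k := by
  have h := gen_rel (Rel.H_F (L := L) j k)
  simp only [map_sub, map_mul, map_smul] at h
  exact h

theorem qH_qH (j k : Fin 2) : qH L j * qH L k = qH L k * qH L j := by
  have h := gen_rel (Rel.H_H (L := L) j k)
  simp only [map_sub, map_mul, map_zero] at h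
  exact sub_eq_zero.1 h

theorem qH_qK (j : Fin 2) (γ : L.lattice) : qH L j * qK L γ = qK L γ * qH L j := by
  have h := gen_rel (Rel.H_K (L := L) j γ)
  simp only [map_sub, map_mul, map_zero] at h
  exact sub_eq_zero.1 h

theorem quartic_aux {R : Type*} [Ring R] [Algebra ℂ R] {a₁ a₂ b₁ b₂ : R} {c : ℂ}
    (hc : c * c = -1) (ha₁ : a₁ * a₁ = 0) (ha₂ : a₂ * a₂ = 0) (hb₁ : b₁ * b₁ = 0)
    (hb₂ : b₂ * b₂ = 0) (h₁₁ : b₁ * a₁ = (-1 : ℂ) • (a₁ * b₁))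
    (h₂₂ : b₂ * a₂ = (-1 : ℂ) • (a₂ * b₂))
    (h₁₂ : b₁ * a₂ = c • (a₂ * b₁)) (h₂₁ : b₂ * a₁ = c • (a₁ * b₂))
    (ha : (a₁ * a₂) ^ 2 = (a₂ * a₁) ^ 2) (hb : (b₁ * b₂) ^ 2 = (b₂ * b₁) ^ 2) :
    ((a₁ + b₁) * (a₂ + b₂)) ^ 2 = ((a₂ + b₂) * (a₁ + b₁)) ^ 2 := by
  have assoc {x y z : R} (h : x * y = z) (t : R) : x * (y * t) = z * t := by
    rw [← mul_assoc, h]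
  have ha' : a₁ * (a₂ * (a₁ * a₂)) = a₂ * (a₁ * (a₂ * a₁)) := by
    simpa [sq, mul_assoc] using ha
  have hb' : b₁ * (b₂ * (b₁ * b₂)) = b₂ * (b₁ * (b₂ * b₁)) := by
    simpa [sq, mul_assoc] using hb
  simp only [sq, mul_add, add_mul, mul_assoc, hb₁, hb₂, h₁₁, h₂₂, h₁₂, h₂₁,
    assoc ha₁, assoc ha₂, assoc hb₁, assoc hb₂, assoc h₁₁, assoc h₂₂, assoc h₁₂, assoc h₂₁,
    smul_mul_assoc, mul_smul_comm, smul_smul, mul_zero, zero_mul, smul_zero, ha', hb',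
    zero_add, add_zero]
  match_scalars <;> first
    | ring1
    | linear_combination hc
    | linear_combination -hc

variable (L)

/-- The extension of the coproduct to the free algebra. -/
def comulFree : FreeAlgebra ℂ (Gen L) →ₐ[ℂ] QGrp L ⊗[ℂ] QGrp L :=
  FreeAlgebra.lift ℂ (comulGen L)

theorem comulFree_ι (x : Gen L) : comulFree L (FreeAlgebra.ι ℂ x) = comulGen L x := by
  simp [comulFree]

theorem form_sr (j k : Fin 2) :
    form (L.simpleRoot j) (simpleRoot k) = (cartan j k : ℂ) :=
  form_simpleRoot_simpleRoot j k

theorem cartan_symm (j k : Fin 2) : cartan j k = cartan k j := by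
  fin_cases j <;> fin_cases k <;> rfl

theorem qK_comm (γ δ : L.lattice) : qK L γ * qK L δ = qK L δ * qK L γ := by
  rw [qK_mul, qK_mul, add_comm]

theorem iPow_ne_zero (a : ℂ) : iPow a ≠ 0 := Complex.exp_ne_zero _

theorem qE_qK (γ : L.lattice) (j : Fin 2) :
    qE L j * qK L γ = iPow (-form γ (simpleRoot j)) • (qK L γ * qE L j) := by
  rw [qK_qE, smul_smul, iPow_neg, inv_mul_cancel₀ (iPow_ne_zero _), one_smul]

theorem cross (j k : Fin 2) :
    (qE L j * qK L (-L.simpleRoot k)) ⊗ₜ[ℂ] (qK L (L.simpleRoot j) * qF L k) =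
      (qK L (-L.simpleRoot k) * qE L j) ⊗ₜ[ℂ] (qF L k * qK L (L.simpleRoot j)) := by
  rw [qE_qK, qK_qF, NegMemClass.coe_neg, form_neg, neg_neg, form_sr, form_sr, cartan_symm k j,
    TensorProduct.smul_tmul_smul, iPow_neg, mul_inv_cancel₀ (iPow_ne_zero _), one_smul]

theorem iPow_cartan_self (j : Fin 2) : iPow ((cartan j j : ℤ) : ℂ) = -1 := by
  rw [← iPow_two]; congr 1; fin_cases j <;> simp [cartan]

theorem iPow_cartan_ne {j k : Fin 2} (h : j ≠ k) :
    iPow ((cartan j k : ℤ) : ℂ) = -Complex.I := by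
  rw [← Complex.inv_I, ← iPow_one, ← iPow_neg]
  congr 1; fin_cases j <;> fin_cases k <;> simp [cartan] at h ⊢

theorem comulFree_rel {x y : FreeAlgebra ℂ (Gen L)} (h : Rel L x y) :
    comulFree L x = comulFree L y := by
  have hK (γ : L.lattice) : qK L γ * qK L (-γ) = 1 := by
    rw [qK_mul, add_neg_cancel, qK_zero]
  have hK' (γ δ : L.lattice) : qK L γ * qK L δ * qK L (-γ) = qK L δ := by
    rw [qK_comm, mul_assoc, hK, mul_one]
  have hEE (j k : Fin 2) : (1 ⊗ₜ qE L j : QGrp L ⊗[ℂ] QGrp L) *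
      (qE L k ⊗ₜ qK L (L.simpleRoot k)) = iPow (-(cartan j k : ℂ)) •
        ((qE L k ⊗ₜ qK L (L.simpleRoot k)) * (1 ⊗ₜ qE L j)) := by
    rw [Algebra.TensorProduct.tmul_mul_tmul, Algebra.TensorProduct.tmul_mul_tmul, qE_qK,
      form_sr, one_mul, mul_one, TensorProduct.tmul_smul, cartan_symm k j]
  have hFF (j k : Fin 2) : (qK L (-L.simpleRoot j) ⊗ₜ qF L j : QGrp L ⊗[ℂ] QGrp L) *
      (qF L k ⊗ₜ 1) = iPow (cartan j k : ℂ) •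
        ((qF L k ⊗ₜ 1) * (qK L (-L.simpleRoot j) ⊗ₜ qF L j)) := by
    rw [Algebra.TensorProduct.tmul_mul_tmul, Algebra.TensorProduct.tmul_mul_tmul, qK_qF,
      NegMemClass.coe_neg, form_neg, neg_neg, form_sr, one_mul, mul_one,
      TensorProduct.smul_tmul']
  have hE1 : qE L 0 * qE L 1 * (qE L 0 * qE L 1) = qE L 1 * qE L 0 * (qE L 1 * qE L 0) := by
    simpa only [sq] using qE_quartic (L := L)
  have hF1 : qF L 0 * qF L 1 * (qF L 0 * qF L 1) = qF L 1 * qF L 0 * (qF L 1 * qF L 0) := by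
    simpa only [sq] using qF_quartic (L := L)
  have hKK (γ δ : L.lattice) :
      qK L γ * qK L δ * (qK L γ * qK L δ) = qK L δ * qK L γ * (qK L δ * qK L γ) := by
    rw [qK_comm L γ δ]
  induction h with
  | K_zero =>
    simp only [comulFree_ι, comulGen, qK_zero, map_one, Algebra.TensorProduct.one_def]
  | K_mul γ δ =>
    simp only [map_mul, comulFree_ι, comulGen, Algebra.TensorProduct.tmul_mul_tmul, qK_mul]
  | K_E γ j =>
    simp only [map_mul, map_smul, comulFree_ι, comulGen, mul_add, add_mul,
      Algebra.TensorProduct.tmul_mul_tmul, qK_qE_conj, mul_one, hK, hK', smul_add,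
      TensorProduct.tmul_smul, TensorProduct.smul_tmul']
  | K_F γ j =>
    simp only [map_mul, map_smul, comulFree_ι, comulGen, mul_add, add_mul,
      Algebra.TensorProduct.tmul_mul_tmul, qK_qF_conj, mul_one, hK, hK', smul_add,
      TensorProduct.tmul_smul, TensorProduct.smul_tmul']
  | E_F_same j =>
    simp only [map_mul, map_sub, map_smul, comulFree_ι, comulGen, mul_add, add_mul,
      Algebra.TensorProduct.tmul_mul_tmul, one_mul, mul_one, cross]
    have h1 := congrArg (fun t => t ⊗ₜ[ℂ] qK L (L.simpleRoot j)) (qE_qF (L := L) j)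
    have h2 := congrArg (fun t => qK L (-L.simpleRoot j) ⊗ₜ[ℂ] t) (qE_qF (L := L) j)
    simp only [TensorProduct.sub_tmul, TensorProduct.tmul_sub, TensorProduct.tmul_smul,
      ← TensorProduct.smul_tmul'] at h1 h2
    rw [show ∀ a b c d e f : QGrp L ⊗[ℂ] QGrp L,
        a + b + (c + d) - (e + c + (b + f)) = a - e + (d - f) by intros; abel, h1, h2]
    module
  | E_F_ne j k hjk =>
    simp only [map_mul, map_sub, map_zero, comulFree_ι, comulGen, mul_add, add_mul,
      Algebra.TensorProduct.tmul_mul_tmul, one_mul, mul_one, cross, qE_qF_ne j k hjk]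
    abel
  | E_sq j =>
    simp only [sq, map_mul, map_zero, comulFree_ι, comulGen, mul_add, add_mul, hEE, iPow_neg,
      iPow_cartan_self]
    simp only [Algebra.TensorProduct.tmul_mul_tmul, qE_sq, TensorProduct.zero_tmul,
      TensorProduct.tmul_zero]
    module
  | F_sq j =>
    simp only [sq, map_mul, map_zero, comulFree_ι, comulGen, mul_add, add_mul, hFF,
      iPow_cartan_self]
    simp only [Algebra.TensorProduct.tmul_mul_tmul, qF_sq, TensorProduct.zero_tmul,
      TensorProduct.tmul_zero]
    module
  | E_quartic =>
    simp only [map_pow, map_mul, comulFree_ι, comulGen]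
    refine quartic_aux (c := Complex.I) Complex.I_mul_I ?_ ?_ ?_ ?_ ?_ ?_ ?_ ?_ ?_ ?_
    · simp only [Algebra.TensorProduct.tmul_mul_tmul, qE_sq, TensorProduct.zero_tmul]
    · simp only [Algebra.TensorProduct.tmul_mul_tmul, qE_sq, TensorProduct.zero_tmul]
    · simp only [Algebra.TensorProduct.tmul_mul_tmul, qE_sq, TensorProduct.tmul_zero]
    · simp only [Algebra.TensorProduct.tmul_mul_tmul, qE_sq, TensorProduct.tmul_zero]
    · rw [hEE, iPow_neg, iPow_cartan_self]; norm_num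
    · rw [hEE, iPow_neg, iPow_cartan_self]; norm_num
    · rw [hEE, iPow_neg, iPow_cartan_ne (by decide)]; simp
    · rw [hEE, iPow_neg, iPow_cartan_ne (by decide)]; simp
    · simp only [sq, Algebra.TensorProduct.tmul_mul_tmul, hE1, hKK (L.simpleRoot 0)]
    · simp only [sq, Algebra.TensorProduct.tmul_mul_tmul, hE1, one_mul]
  | F_quartic =>
    simp only [map_pow, map_mul, comulFree_ι, comulGen]
    refine quartic_aux (c := -Complex.I) (by rw [neg_mul_neg, Complex.I_mul_I])
      ?_ ?_ ?_ ?_ ?_ ?_ ?_ ?_ ?_ ?_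
    · simp only [Algebra.TensorProduct.tmul_mul_tmul, qF_sq, TensorProduct.zero_tmul]
    · simp only [Algebra.TensorProduct.tmul_mul_tmul, qF_sq, TensorProduct.zero_tmul]
    · simp only [Algebra.TensorProduct.tmul_mul_tmul, qF_sq, TensorProduct.tmul_zero]
    · simp only [Algebra.TensorProduct.tmul_mul_tmul, qF_sq, TensorProduct.tmul_zero]
    · rw [hFF, iPow_cartan_self]
    · rw [hFF, iPow_cartan_self]
    · rw [hFF, iPow_cartan_ne (by decide)]
    · rw [hFF, iPow_cartan_ne (by decide)]
    · simp only [sq, Algebra.TensorProduct.tmul_mul_tmul, hF1, one_mul]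
    · simp only [sq, Algebra.TensorProduct.tmul_mul_tmul, hF1, hKK (-L.simpleRoot 0)]
  | H_E j k =>
    have h1 := congrArg (fun t => t ⊗ₜ[ℂ] qK L (L.simpleRoot k)) (qH_qE (L := L) j k)
    have h2 := congrArg (fun t => (1 : QGrp L) ⊗ₜ[ℂ] t) (qH_qE (L := L) j k)
    simp only [TensorProduct.sub_tmul, TensorProduct.tmul_sub, TensorProduct.tmul_smul,
      ← TensorProduct.smul_tmul'] at h1 h2
    simp only [map_mul, map_sub, map_smul, comulFree_ι, comulGen, mul_add, add_mul,
      Algebra.TensorProduct.tmul_mul_tmul, one_mul, mul_one, qH_qK, smul_add, ← h1, ← h2]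
    abel
  | H_F j k =>
    have h1 := congrArg (fun t => t ⊗ₜ[ℂ] (1 : QGrp L)) (qH_qF (L := L) j k)
    have h2 := congrArg (fun t => qK L (-L.simpleRoot k) ⊗ₜ[ℂ] t) (qH_qF (L := L) j k)
    simp only [TensorProduct.sub_tmul, TensorProduct.tmul_sub, TensorProduct.tmul_smul,
      ← TensorProduct.smul_tmul'] at h1 h2
    simp only [map_mul, map_sub, map_smul, comulFree_ι, comulGen, mul_add, add_mul,
      Algebra.TensorProduct.tmul_mul_tmul, one_mul, mul_one, qH_qK, smul_add, ← h1, ← h2]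
    abel
  | H_H j k =>
    simp only [map_mul, map_sub, map_zero, comulFree_ι, comulGen, mul_add, add_mul,
      Algebra.TensorProduct.tmul_mul_tmul, one_mul, mul_one, qH_qH j k]
    abel
  | H_K j γ =>
    simp only [map_mul, map_sub, map_zero, comulFree_ι, comulGen, mul_add, add_mul,
      Algebra.TensorProduct.tmul_mul_tmul, one_mul, mul_one, qH_qK]
    abel

/-- The coproduct of the quantum group, as a homomorphism of algebras. -/
def comul : QGrp L →ₐ[ℂ] QGrp L ⊗[ℂ] QGrp L :=
  RingQuot.liftAlgHom ℂ ⟨comulFree L, fun _ _ h => comulFree_rel L h⟩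

theorem comul_gen (x : Gen L) : comul L (gen x) = comulGen L x := by
  rw [← comulFree_ι]
  exact RingQuot.liftAlgHom_mkAlgHom_apply ℂ _ _ _

end Relations

/-! ### Modules -/

section Modules

variable (L : IntermediateLattice)

/-- The tensor product `V ⊗_ℂ W` of two modules, on which the quantum group acts through its
coproduct.  (A type synonym, since `V ⊗_ℂ W` already carries the action on the left factor.) -/
def TensorMod (_L : IntermediateLattice) (V W : Type) [AddCommGroup V] [Module ℂ V]
    [AddCommGroup W] [Module ℂ W] : Type := V ⊗[ℂ] W

section Tensor

variable (V W : Type) [AddCommGroup V] [Module ℂ V] [Module (QGrp L) V]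
  [IsScalarTower ℂ (QGrp L) V] [AddCommGroup W] [Module ℂ W] [Module (QGrp L) W]
  [IsScalarTower ℂ (QGrp L) W]

instance : AddCommGroup (TensorMod L V W) := inferInstanceAs (AddCommGroup (V ⊗[ℂ] W))

instance : Module ℂ (TensorMod L V W) := inferInstanceAs (Module ℂ (V ⊗[ℂ] W))

/-- The action `u ↦ (v ⊗ w ↦ ∑ u₍₁₎ v ⊗ u₍₂₎ w)`. -/
def tensorAction : QGrp L →ₐ[ℂ] Module.End ℂ (V ⊗[ℂ] W) :=
  ((Module.endTensorEndAlgHom (R := ℂ) (A := ℂ) (M := V) (N := W)).comp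
    (Algebra.TensorProduct.map (Algebra.lsmul ℂ ℂ V) (Algebra.lsmul ℂ ℂ W))).comp (comul L)

instance : Module (QGrp L) (TensorMod L V W) :=
  Module.compHom (V ⊗[ℂ] W) (tensorAction L V W).toRingHom

theorem tensorMod_smul_def (u : QGrp L) (t : V ⊗[ℂ] W) :
    (show V ⊗[ℂ] W from u • (show TensorMod L V W from t)) = tensorAction L V W u t := rfl

theorem tensorAction_qE (j : Fin 2) (v : V) (w : W) :
    tensorAction L V W (qE L j) (v ⊗ₜ w) =
      (qE L j • v) ⊗ₜ (qK L (L.simpleRoot j) • w) + v ⊗ₜ (qE L j • w) := by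
  simp only [tensorAction, AlgHom.comp_apply, comul_gen, comulGen, map_add,
    Algebra.TensorProduct.map_tmul, Module.endTensorEndAlgHom_apply, map_one,
    LinearMap.add_apply]
  rfl

instance : IsScalarTower ℂ (QGrp L) (TensorMod L V W) where
  smul_assoc c u t := by
    change tensorAction L V W (c • u) t = c • tensorAction L V W u t
    rw [map_smul]; rfl

end Tensor

/-- The simultaneous eigenspace `V(lam)` of `H_1` and `H_2`. -/
def weightSpace (V : Type) [AddCommGroup V] [Module ℂ V] [Module (QGrp L) V]
    [IsScalarTower ℂ (QGrp L) V] (lam : Weight) : Submodule ℂ V where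
  carrier := {v | ∀ j, qH L j • v = lam j • v}
  add_mem' := by
    intro v w hv hw j
    rw [smul_add, smul_add, hv j, hw j]
  zero_mem' := fun j => by rw [smul_zero, smul_zero]
  smul_mem' := by
    intro c v hv j
    rw [smul_comm (qH L j) c v, hv j, smul_comm]

/-- An object of the category `𝒞` of finite-dimensional weight modules.  (The sum of the
weight spaces is automatically direct, being a sum of simultaneous eigenspaces.) -/
structure WeightModule where
  carrier : Type
  [addCommGroup : AddCommGroup carrier]
  [moduleComplex : Module ℂ carrier]
  [moduleQGrp : Module (QGrp L) carrier]
  [isScalarTower : IsScalarTower ℂ (QGrp L) carrier]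
  finite : Module.Finite ℂ carrier
  iSup_weightSpace : ⨆ lam : Weight, weightSpace L carrier lam = ⊤
  qK_smul : ∀ (γ : L.lattice) (lam : Weight), ∀ v ∈ weightSpace L carrier lam,
    qK L γ • v = iPow (form γ lam) • v

attribute [instance] WeightModule.addCommGroup WeightModule.moduleComplex
  WeightModule.moduleQGrp WeightModule.isScalarTower

instance : CoeSort (WeightModule L) Type := ⟨WeightModule.carrier⟩

/-- The left ideal of relations satisfied by a maximal vector of weight `lam`. -/
def vermaIdeal (lam : Weight) : Submodule (QGrp L) (QGrp L) :=
  Submodule.span (QGrp L)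
    (Set.range (fun j => qE L j) ∪
      Set.range (fun j => qH L j - algebraMap ℂ (QGrp L) (lam j)) ∪
      Set.range (fun γ : L.lattice => qK L γ - algebraMap ℂ (QGrp L) (iPow (form γ lam))))

/-- The Verma module `M_lam`. -/
abbrev Verma (lam : Weight) : Type := QGrp L ⧸ vermaIdeal L lam

/-- The irreducible module `L_lam`: the quotient of the Verma module `M_lam` by its largest
proper submodule, which is the sum of all the proper ones. -/
abbrev Irr (lam : Weight) : Type :=
  Verma L lam ⧸ sSup {N : Submodule (QGrp L) (Verma L lam) | N ≠ ⊤}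

/-- `P` is projective in the category `𝒞`. -/
def IsProjectiveIn (P : WeightModule L) : Prop :=
  ∀ (V W : WeightModule L) (f : V →ₗ[QGrp L] W) (g : P →ₗ[QGrp L] W),
    Function.Surjective f → ∃ h : P →ₗ[QGrp L] V, f ∘ₗ h = g

/-- `P` is the projective cover `P_lam` of `L_lam` in `𝒞`: it is projective in `𝒞` and has
an essential surjection onto `L_lam`. -/
def IsProjectiveCover (lam : Weight) (P : WeightModule L) : Prop :=
  IsProjectiveIn L P ∧
    ∃ f : P →ₗ[QGrp L] Irr L lam, Function.Surjective f ∧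
      ∀ N : Submodule (QGrp L) P, N ⊔ LinearMap.ker f = ⊤ → N = ⊤

end Modules

end UnrolledSL3

end

noncomputable section

namespace UnrolledSL3

/-! ### The quantum integers at a fourth root of unity -/

/-! Write br(z) = sin(πz/2), which vanishes exactly at the even integers. For i = 1, 2 the index λ_i
is odd iff br(λ(H_i)) = 0, and λ_3 is odd iff br(λ(H_1) + λ(H_2) + 1) = 0.

Highest weight modules. If v is maximal of weight λ, the eight words in X_{-1}, X_{-2} span the
submodule generated by v, and raising the longest word back to v yields minus the product of the
three numbers above (`IsMaximal.qE_top_qF_top`). For typical λ this product is nonzero, so the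
irreducible module has dimension 8 (`Typ.finrank_irr`) and every nonzero highest weight module of
weight λ is irreducible. It is also projective: a weight vector lifting the generator becomes a
maximal lift after applying the longest lowering word, then the longest raising word, and dividing
by the product (`Typ.isProjectiveIn`). So P_λ = L_λ for typical λ, and every claim becomes a
decomposition into irreducible modules. For atypical λ, a vector of strictly lower weight killed by
X_1 and X_2 is zero in L_λ (`Irr.eq_zero_of_isMaximal`); the resulting relations give the dimensions
4, at most 3, and 1.

Tensor products. Besides the product of the two generators, L_λ ⊗ L_μ contains explicit nonzero
maximal vectors whose weights are those of the remaining summands (the lemmas `exists_maximal_…`).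
Together these vectors define a map Φ from a direct sum of Verma modules to the tensor product. Once
no vector lies in the submodule generated by the others, ker Φ is contained in the kernel of the
projection of the Verma modules onto their irreducible quotients, so the image of Φ is at least as
large as the sum of those quotients. The counts 4·4 = 8+8 = 4+8+4, 3·4 = 8+4 and 3·3 = 8+1 bound the
tensor product from above, so the two kernels agree and Φ induces the isomorphism
(`nonempty_equiv_of_finrank_le`). -/

/-- The quantum integer `(i ^ z - i ^ (-z)) / 2i = sin (π z / 2)`. -/
def br (z : ℂ) : ℂ := (1 / (2 * Complex.I)) * (iPow z - iPow (-z))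

theorem inv_I_eq : (1 / (2 * Complex.I) : ℂ) = -Complex.I / 2 := by
  rw [one_div, mul_inv, Complex.inv_I]; ring

theorem iPow_neg_one : iPow (-1) = -Complex.I := by
  rw [iPow_neg, iPow_one, Complex.inv_I]

theorem br_add_one (z : ℂ) : br (z + 1) = (iPow z + iPow (-z)) / 2 := by
  rw [br, inv_I_eq, neg_add, iPow_add, iPow_add, iPow_one, iPow_neg_one]
  linear_combination (-(iPow z + iPow (-z)) / 2) * Complex.I_mul_I

theorem br_neg (z : ℂ) : br (-z) = -br z := by
  rw [br, br, neg_neg]; ring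

theorem br_add_two (z : ℂ) : br (z + 2) = -br z := by
  rw [show z + 2 = (z + 1) + 1 by ring, br_add_one, neg_add, iPow_add, iPow_add, iPow_one,
    iPow_neg_one, br, inv_I_eq]
  ring

theorem br_sub_two (z : ℂ) : br (z - 2) = -br z := by
  rw [← neg_eq_iff_eq_neg, ← br_add_two]; congr 1; ring

theorem br_sub_one (z : ℂ) : br (z - 1) = -br (z + 1) := by
  rw [← neg_eq_iff_eq_neg, ← br_add_two]; congr 1; ring

theorem br_zero : br 0 = 0 := by simp [br]

theorem br_one : br 1 = 1 := by
  have := br_add_one 0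
  simpa [iPow_zero] using this

theorem iPow_mul_neg (z : ℂ) : iPow z * iPow (-z) = 1 := by
  rw [← iPow_add, add_neg_cancel, iPow_zero]

theorem br_sq_add (z : ℂ) : br z ^ 2 + br (z + 1) ^ 2 = 1 := by
  rw [br_add_one, br, inv_I_eq]
  linear_combination ((iPow z - iPow (-z)) ^ 2 / 4) * Complex.I_mul_I + iPow_mul_neg z

theorem br_add_one_ne {z : ℂ} (h : br z = 0) : br (z + 1) ≠ 0 := by
  intro h'
  have := br_sq_add z
  simp [h, h'] at this

theorem br_ne_of_add_one {z : ℂ} (h : br (z + 1) = 0) : br z ≠ 0 :=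
  fun h' => br_add_one_ne h' h

/-- The addition formula for the cosine, since br(z + 1) = cos(πz/2). The right side is the
determinant of the raising operators on the two words of weight λ - α_3, for a = λ(H_1) and b =
λ(H_2); this is how the third index enters. -/
theorem br_det (a b : ℂ) :
    br (a + b + 1) = br (a + 1) * br (b + 1) - br a * br b := by
  rw [br_add_one, br_add_one, br_add_one, br, br, inv_I_eq, neg_add, iPow_add, iPow_add]
  linear_combination ((iPow a - iPow (-a)) * (iPow b - iPow (-b)) / 4) * Complex.I_mul_I

theorem br_eq_zero_iff (z : ℂ) : br z = 0 ↔ ∃ m : ℤ, z = 2 * m := by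
  have h0 : (Real.pi : ℂ) * Complex.I ≠ 0 :=
    mul_ne_zero (by exact_mod_cast Real.pi_ne_zero) Complex.I_ne_zero
  have h1 : br z = 0 ↔ iPow z = iPow (-z) := by
    rw [br, mul_eq_zero, or_iff_right (by simp), sub_eq_zero]
  rw [h1, iPow, iPow, Complex.exp_eq_exp_iff_exists_int]
  constructor
  · rintro ⟨n, hn⟩
    exact ⟨n, mul_left_cancel₀ h0 (by linear_combination hn)⟩
  · rintro ⟨m, rfl⟩
    exact ⟨m, by ring⟩

theorem isOddInt_add_one_iff (z : ℂ) : IsOddInt (z + 1) ↔ br z = 0 := by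
  rw [br_eq_zero_iff]
  exact exists_congr fun m => by rw [add_left_inj]

/-- Neither `z` nor `z + 1` is an even integer. -/
def NonInt (z : ℂ) : Prop := br z ≠ 0 ∧ br (z + 1) ≠ 0

/-- `z` is an integer. -/
def IsInt (z : ℂ) : Prop := ∃ m : ℤ, z = m

theorem nonInt_iff (z : ℂ) : NonInt z ↔ ¬ IsInt z := by
  rw [NonInt, ← not_or, not_iff_not, br_eq_zero_iff, br_eq_zero_iff]
  constructor
  · rintro (⟨m, hm⟩ | ⟨m, hm⟩)
    · exact ⟨2 * m, by push_cast; exact hm⟩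
    · exact ⟨2 * m - 1, by push_cast; linear_combination hm⟩
  · rintro ⟨m, rfl⟩
    rcases Int.even_or_odd' m with ⟨k, rfl | rfl⟩
    · exact Or.inl ⟨k, by push_cast; ring⟩
    · exact Or.inr ⟨k + 1, by push_cast; ring⟩

theorem IsInt.add {z w : ℂ} (hz : IsInt z) (hw : IsInt w) : IsInt (z + w) := by
  obtain ⟨m, rfl⟩ := hz
  obtain ⟨n, rfl⟩ := hw
  exact ⟨m + n, by push_cast; rfl⟩

theorem IsInt.sub {z w : ℂ} (hz : IsInt z) (hw : IsInt w) : IsInt (z - w) := by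
  obtain ⟨m, rfl⟩ := hz
  obtain ⟨n, rfl⟩ := hw
  exact ⟨m - n, by push_cast; rfl⟩

theorem isInt_intCast (m : ℤ) : IsInt m := ⟨m, rfl⟩

theorem isInt_of_br_eq_zero {z : ℂ} (h : br z = 0) : IsInt z := by
  obtain ⟨m, rfl⟩ := (br_eq_zero_iff z).1 h
  exact ⟨2 * m, by push_cast; rfl⟩

/-- When exactly one index is odd, the coordinates not forced to be even are non-integral. Stability
under integral shifts then settles most typicality checks for sums of weights. -/
theorem NonInt.of_sub {z w : ℂ} (hz : NonInt z) (h : IsInt (w - z)) : NonInt w := by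
  rw [nonInt_iff] at hz ⊢
  exact fun hw => hz (by simpa using hw.sub h)

/-! ### A four-dimensional family of representations -/

variable (L : IntermediateLattice)

theorem form_add_left (a b c : Weight) : form (a + b) c = form a c + form b c := by
  simp only [form, Pi.add_apply]; ring

theorem form_add_right (a b c : Weight) : form a (b + c) = form a b + form a c := by
  simp only [form, Pi.add_apply]; ring

theorem form_zero_left (c : Weight) : form 0 c = 0 := by
  simp [form]

theorem form_simpleRoot_left (j : Fin 2) (lam : Weight) : form (L.simpleRoot j) lam = lam j := by
  rw [← form_simpleRoot lam j]
  simp only [form, IntermediateLattice.simpleRoot]; ring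

/-- Matrices that are homogeneous for a weight grading of the basis and satisfy the relations among
the root vectors define a representation. -/
theorem exists_rep {n : Type} [Fintype n] [DecidableEq n] (wt : n → Weight)
    (E F : Fin 2 → Matrix n n ℂ)
    (hE : ∀ j a b, E j a b ≠ 0 → wt a = wt b + simpleRoot j)
    (hF : ∀ j a b, F j a b ≠ 0 → wt b = wt a + simpleRoot j)
    (hEF : ∀ j, E j * F j - F j * E j = Matrix.diagonal fun a => br (wt a j))
    (hEF' : ∀ j k, j ≠ k → E j * F k = F k * E j)
    (hE2 : ∀ j, E j * E j = 0) (hF2 : ∀ j, F j * F j = 0)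
    (hE4 : (E 0 * E 1) ^ 2 = (E 1 * E 0) ^ 2) (hF4 : (F 0 * F 1) ^ 2 = (F 1 * F 0) ^ 2) :
    ∃ f : QGrp L →ₐ[ℂ] Matrix n n ℂ, (∀ j, f (qE L j) = E j) ∧ (∀ j, f (qF L j) = F j) ∧
      (∀ j, f (qH L j) = Matrix.diagonal fun a => wt a j) ∧
      (∀ γ, f (qK L γ) = Matrix.diagonal fun a => iPow (form γ (wt a))) := by
  let g : Gen L → Matrix n n ℂ
    | .E j => E j
    | .F j => F j
    | .H j => Matrix.diagonal fun a => wt a j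
    | .K γ => Matrix.diagonal fun a => iPow (form γ (wt a))
  have key : ∀ x y, Rel L x y → FreeAlgebra.lift ℂ g x = FreeAlgebra.lift ℂ g y := by
    intro x y h
    induction h with
    | K_zero =>
      simp only [FreeAlgebra.lift_ι_apply, map_one, g, ZeroMemClass.coe_zero, form_zero_left,
        iPow_zero, Matrix.diagonal_one]
    | K_mul γ δ =>
      simp only [FreeAlgebra.lift_ι_apply, map_mul, g, Matrix.diagonal_mul_diagonal,
        AddMemClass.coe_add, form_add_left, iPow_add]
    | K_E γ j =>
      ext a b
      simp only [FreeAlgebra.lift_ι_apply, map_mul, map_smul, g, Matrix.mul_diagonal,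
        Matrix.diagonal_mul, Matrix.smul_apply, smul_eq_mul]
      by_cases h : E j a b = 0
      · simp [h]
      · rw [hE j a b h, form_add_right, iPow_add, NegMemClass.coe_neg, form_neg]
        linear_combination (iPow (form γ (simpleRoot j)) * E j a b) * iPow_mul_neg (form γ (wt b))
    | K_F γ j =>
      ext a b
      simp only [FreeAlgebra.lift_ι_apply, map_mul, map_smul, g, Matrix.mul_diagonal,
        Matrix.diagonal_mul, Matrix.smul_apply, smul_eq_mul]
      by_cases h : F j a b = 0
      · simp [h]
      · rw [hF j a b h, form_add_right, NegMemClass.coe_neg, form_neg, form_neg, iPow_add]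
        linear_combination (iPow (-form γ (simpleRoot j)) * F j a b) * iPow_mul_neg (form γ (wt a))
    | E_F_same j =>
      simp only [FreeAlgebra.lift_ι_apply, map_mul, map_smul, map_sub, g, hEF]
      ext a b
      by_cases h : a = b
      · subst h
        simp only [Matrix.diagonal_apply_eq, Matrix.smul_apply, Matrix.sub_apply, smul_eq_mul,
          NegMemClass.coe_neg, form_neg, form_simpleRoot_left, br]
      · simp [h]
    | E_F_ne j k h =>
      simp only [FreeAlgebra.lift_ι_apply, map_mul, map_sub, map_zero, g, hEF' j k h, sub_self]
    | E_sq j => simp only [sq, map_mul, map_zero, FreeAlgebra.lift_ι_apply, g, hE2]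
    | F_sq j => simp only [sq, map_mul, map_zero, FreeAlgebra.lift_ι_apply, g, hF2]
    | E_quartic => simp only [FreeAlgebra.lift_ι_apply, map_pow, map_mul, g, hE4]
    | F_quartic => simp only [FreeAlgebra.lift_ι_apply, map_pow, map_mul, g, hF4]
    | H_E j k =>
      ext a b
      simp only [FreeAlgebra.lift_ι_apply, map_mul, map_smul, map_sub, g, Matrix.mul_diagonal,
        Matrix.diagonal_mul, Matrix.smul_apply, Matrix.sub_apply, smul_eq_mul]
      by_cases h : E k a b = 0
      · simp [h]
      · rw [hE k a b h, Pi.add_apply, simpleRoot]; ring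
    | H_F j k =>
      ext a b
      simp only [FreeAlgebra.lift_ι_apply, map_mul, map_smul, map_sub, g, Matrix.mul_diagonal,
        Matrix.diagonal_mul, Matrix.smul_apply, Matrix.sub_apply, smul_eq_mul]
      by_cases h : F k a b = 0
      · simp [h]
      · rw [hF k a b h, Pi.add_apply, simpleRoot]; ring
    | H_H j k =>
      simp only [FreeAlgebra.lift_ι_apply, map_mul, map_sub, map_zero, g,
        Matrix.diagonal_mul_diagonal, mul_comm, sub_self]
    | H_K j γ =>
      simp only [FreeAlgebra.lift_ι_apply, map_mul, map_sub, map_zero, g,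
        Matrix.diagonal_mul_diagonal, mul_comm, sub_self]
  let f : QGrp L →ₐ[ℂ] Matrix n n ℂ := RingQuot.liftAlgHom ℂ ⟨FreeAlgebra.lift ℂ g, key⟩
  have hf (x : Gen L) : f (gen x) = g x :=
    (RingQuot.liftAlgHom_mkAlgHom_apply ℂ _ _ _).trans (FreeAlgebra.lift_ι_apply _ _)
  exact ⟨f, fun j => hf (.E j), fun j => hf (.F j), fun j => hf (.H j), fun γ => hf (.K γ)⟩

/-- A representation on which some nonzero vector is maximal of weight `lam`. -/
def HasMaximalRep (lam : Weight) : Prop :=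
  ∃ (V : Type) (_ : AddCommGroup V) (_ : Module ℂ V) (f : QGrp L →ₐ[ℂ] Module.End ℂ V) (v : V),
    v ≠ 0 ∧ (∀ j, f (qE L j) v = 0) ∧ (∀ j, f (qH L j) v = lam j • v) ∧
      ∀ γ, f (qK L γ) v = iPow (form γ lam) • v

/-- The model is the quotient of a Verma module by X_{-i} v, with basis v, X_{-j} v, X_{-i} X_{-j}
v, X_{-j} X_{-i} X_{-j} v. The entries of `E` are those dictated by the commutators: br(b), br(0 +
1) = 1 and br(b - 1), where b = λ(H_j). -/
theorem hasMaximalRep_of_apply_eq_zero (i : Fin 2) (lam : Weight) (h : lam i = 0) :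
    HasMaximalRep L lam := by
  obtain ⟨j, hij⟩ : ∃ j, j ≠ i := ⟨1 - i, by fin_cases i <;> decide⟩
  let b := lam j
  let wt : Fin 4 → Weight := ![lam, lam - simpleRoot j, lam - simpleRoot j - simpleRoot i,
    lam - simpleRoot j - simpleRoot i - simpleRoot j]
  let E : Fin 2 → Matrix (Fin 4) (Fin 4) ℂ := fun k => if k = i
    then !![0, 0, 0, 0; 0, 0, 1, 0; 0, 0, 0, 0; 0, 0, 0, 0]
    else !![0, br b, 0, 0; 0, 0, 0, 0; 0, 0, 0, br (b - 1); 0, 0, 0, 0]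
  let F : Fin 2 → Matrix (Fin 4) (Fin 4) ℂ := fun k => if k = i
    then !![0, 0, 0, 0; 0, 0, 0, 0; 0, 1, 0, 0; 0, 0, 0, 0]
    else !![0, 0, 0, 0; 1, 0, 0, 0; 0, 0, 0, 0; 0, 0, 1, 0]
  have hk (k : Fin 2) : k = i ∨ k = j := by omega
  have hEi : E i = !![0, 0, 0, 0; 0, 0, 1, 0; 0, 0, 0, 0; 0, 0, 0, 0] := if_pos rfl
  have hEj : E j = !![0, br b, 0, 0; 0, 0, 0, 0; 0, 0, 0, br (b - 1); 0, 0, 0, 0] := if_neg hij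
  have hFi : F i = !![0, 0, 0, 0; 0, 0, 0, 0; 0, 1, 0, 0; 0, 0, 0, 0] := if_pos rfl
  have hFj : F j = !![0, 0, 0, 0; 1, 0, 0, 0; 0, 0, 0, 0; 0, 0, 1, 0] := if_neg hij
  have hii : simpleRoot i i = 2 := by fin_cases i <;> simp [simpleRoot, cartan]
  have hjj : simpleRoot j j = 2 := by fin_cases j <;> simp [simpleRoot, cartan]
  have hji : simpleRoot j i = -1 := by
    fin_cases i <;> fin_cases j <;> simp [simpleRoot, cartan] at hij ⊢
  have hij' : simpleRoot i j = -1 := by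
    fin_cases i <;> fin_cases j <;> simp [simpleRoot, cartan] at hij ⊢
  have hw : wt 0 = lam ∧ wt 1 = lam - simpleRoot j ∧ wt 2 = lam - simpleRoot j - simpleRoot i ∧
    wt 3 = lam - simpleRoot j - simpleRoot i - simpleRoot j := ⟨rfl, rfl, rfl, rfl⟩
  have hEFi : E i * F i - F i * E i = Matrix.diagonal fun a => br (wt a i) := by
    rw [hEi, hFi]
    ext p q
    fin_cases p <;> fin_cases q <;>
      simp [hw, hii, hji, h, br_one, br_zero]
    · rw [show (1 : ℂ) - 2 = -1 by norm_num, br_neg, br_one]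
    · rw [show (1 : ℂ) - 2 + 1 = 0 by norm_num, br_zero]
  have hEFj : E j * F j - F j * E j = Matrix.diagonal fun a => br (wt a j) := by
    rw [hEj, hFj]
    ext p q
    fin_cases p <;> fin_cases q <;>
      simp [hw, hjj, hij', b, br_sub_two]
    all_goals congr 1; ring
  have hEFij : E i * F j = F j * E i := by
    rw [hEi, hFj]; ext p q
    fin_cases p <;> fin_cases q <;> simp [Matrix.mul_apply, Fin.sum_univ_four]
  have hEFji : E j * F i = F i * E j := by
    rw [hEj, hFi]; ext p q
    fin_cases p <;> fin_cases q <;> simp [Matrix.mul_apply, Fin.sum_univ_four]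
  have hE4 : (E i * E j) ^ 2 = (E j * E i) ^ 2 := by
    rw [hEi, hEj, sq, sq]
    ext p q; fin_cases p <;> fin_cases q <;> simp [Matrix.mul_apply, Fin.sum_univ_four]
  have hF4 : (F i * F j) ^ 2 = (F j * F i) ^ 2 := by
    rw [hFi, hFj, sq, sq]
    ext p q; fin_cases p <;> fin_cases q <;> simp [Matrix.mul_apply, Fin.sum_univ_four]
  have h1 : ∀ k p q, E k p q ≠ 0 → wt p = wt q + simpleRoot k := by
    intro k p q
    rcases hk k with rfl | rfl
    · rw [hEi]; fin_cases p <;> fin_cases q <;> simp [hw]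
    · rw [hEj]; fin_cases p <;> fin_cases q <;> simp [hw]
  have h2 : ∀ k p q, F k p q ≠ 0 → wt q = wt p + simpleRoot k := by
    intro k p q
    rcases hk k with rfl | rfl
    · rw [hFi]; fin_cases p <;> fin_cases q <;> simp [hw]
    · rw [hFj]; fin_cases p <;> fin_cases q <;> simp [hw]
  have h3 : ∀ k, E k * F k - F k * E k = Matrix.diagonal fun p => br (wt p k) := by
    intro k
    rcases hk k with rfl | rfl <;> assumption
  have h4 : ∀ k l, k ≠ l → E k * F l = F l * E k := by
    intro k l hkl
    rcases hk k with rfl | rfl <;> rcases hk l with rfl | rfl <;> first | assumption | simp at hkl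
  have h5 : ∀ k, E k * E k = 0 := by
    intro k
    rcases hk k with rfl | rfl
    · rw [hEi]; ext p q
      fin_cases p <;> fin_cases q <;> simp [Matrix.mul_apply, Fin.sum_univ_four]
    · rw [hEj]; ext p q
      fin_cases p <;> fin_cases q <;> simp [Matrix.mul_apply, Fin.sum_univ_four]
  have h6 : ∀ k, F k * F k = 0 := by
    intro k
    rcases hk k with rfl | rfl
    · rw [hFi]; ext p q
      fin_cases p <;> fin_cases q <;> simp [Matrix.mul_apply, Fin.sum_univ_four]
    · rw [hFj]; ext p q
      fin_cases p <;> fin_cases q <;> simp [Matrix.mul_apply, Fin.sum_univ_four]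
  have h7 : (E 0 * E 1) ^ 2 = (E 1 * E 0) ^ 2 := by
    rcases hk 0 with h0 | h0
    · obtain rfl : j = 1 := by omega
      obtain rfl := h0
      exact hE4
    · obtain rfl : i = 1 := by omega
      obtain rfl := h0
      exact hE4.symm
  have h8 : (F 0 * F 1) ^ 2 = (F 1 * F 0) ^ 2 := by
    rcases hk 0 with h0 | h0
    · obtain rfl : j = 1 := by omega
      obtain rfl := h0
      exact hF4
    · obtain rfl : i = 1 := by omega
      obtain rfl := h0
      exact hF4.symm
  obtain ⟨f, hfE, hfF, hfH, hfK⟩ := exists_rep L wt E F h1 h2 h3 h4 h5 h6 h7 h8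
  refine ⟨Fin 4 → ℂ, inferInstance, inferInstance,
    (Matrix.toLinAlgEquiv' (R := ℂ) (n := Fin 4)).toAlgHom.comp f, Pi.single 0 1, by simp,
    fun k => ?_, fun k => ?_, fun γ => ?_⟩
  · simp only [AlgHom.comp_apply, hfE]
    rcases hk k with rfl | rfl
    · rw [hEi]; ext p; fin_cases p <;> simp [Matrix.toLinAlgEquiv'_apply]
    · rw [hEj]; ext p; fin_cases p <;> simp [Matrix.toLinAlgEquiv'_apply]
  · simp only [AlgHom.comp_apply, hfH]
    ext p; fin_cases p <;> simp [Matrix.toLinAlgEquiv'_apply, hw]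
  · simp only [AlgHom.comp_apply, hfK]
    ext p; fin_cases p <;> simp [Matrix.toLinAlgEquiv'_apply, hw]

/-- Contraction of a tensor with a linear form on the left factor. -/
def contractLeft {V W : Type} [AddCommGroup V] [Module ℂ V] [AddCommGroup W] [Module ℂ W]
    (φ : V →ₗ[ℂ] ℂ) : V ⊗[ℂ] W →ₗ[ℂ] W :=
  (TensorProduct.lid ℂ W).toLinearMap ∘ₗ φ.rTensor W

@[simp]
theorem contractLeft_tmul {V W : Type} [AddCommGroup V] [Module ℂ V] [AddCommGroup W]
    [Module ℂ W] (φ : V →ₗ[ℂ] ℂ) (v : V) (w : W) : contractLeft φ (v ⊗ₜ w) = φ v • w := by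
  simp [contractLeft]

theorem tmul_ne_zero {V W : Type} [AddCommGroup V] [Module ℂ V] [AddCommGroup W] [Module ℂ W]
    {v : V} {w : W} (hv : v ≠ 0) (hw : w ≠ 0) : v ⊗ₜ[ℂ] w ≠ 0 := by
  obtain ⟨φ, hφ, -⟩ := Submodule.exists_le_ker_of_notMem (p := (⊥ : Submodule ℂ V)) (v := v)
    (by simpa using hv)
  intro h
  have := congrArg (contractLeft φ) h
  simp [hφ, hw] at this

/-- By the coproduct, the tensor product of two maximal vectors is maximal and their weights add. -/
theorem HasMaximalRep.add {lam mu : Weight} (h₁ : HasMaximalRep L lam) (h₂ : HasMaximalRep L mu) :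
    HasMaximalRep L (lam + mu) := by
  obtain ⟨V, _, _, f, v, hv, hfE, hfH, hfK⟩ := h₁
  obtain ⟨W, _, _, g, w, hw, hgE, hgH, hgK⟩ := h₂
  let T : QGrp L →ₐ[ℂ] Module.End ℂ (V ⊗[ℂ] W) :=
    ((Module.endTensorEndAlgHom (R := ℂ) (A := ℂ) (M := V) (N := W)).comp
      (Algebra.TensorProduct.map f g)).comp (comul L)
  refine ⟨V ⊗[ℂ] W, inferInstance, inferInstance, T, v ⊗ₜ w, ?_, fun j => ?_, fun j => ?_,
    fun γ => ?_⟩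
  · exact tmul_ne_zero hv hw
  · simp [T, comul_gen, comulGen, Module.endTensorEndAlgHom_apply, hfE, hgE]
  · simp [T, comul_gen, comulGen, Module.endTensorEndAlgHom_apply, hfH, hgH, 
      TensorProduct.smul_tmul', add_smul, add_comm]
  · simp [T, comul_gen, comulGen, Module.endTensorEndAlgHom_apply, hfK, hgK,
      TensorProduct.smul_tmul', form_add_right, iPow_add, smul_smul, mul_comm]

/-- Every weight is a sum of two weights that each vanish on one coroot. This shows that Verma
modules are nonzero without a basis theorem for the algebra. -/
theorem hasMaximalRep (lam : Weight) : HasMaximalRep L lam := by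
  have h : lam = ![0, lam 1] + ![lam 0, 0] := by
    ext j; fin_cases j <;> simp
  rw [h]
  exact (hasMaximalRep_of_apply_eq_zero L 0 _ rfl).add L (hasMaximalRep_of_apply_eq_zero L 1 _ rfl)

/-! ### Weight vectors and maximal vectors -/

section Words

variable {L : IntermediateLattice} {V : Type} [AddCommGroup V] [Module (QGrp L) V]

theorem qE_qF_smul_ne {j k : Fin 2} (hjk : j ≠ k) (v : V) :
    qE L j • qF L k • v = qF L k • qE L j • v := by
  rw [← mul_smul, qE_qF_ne j k hjk, mul_smul]

theorem qE_qE_smul (j : Fin 2) (v : V) : qE L j • qE L j • v = 0 := by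
  rw [← mul_smul, qE_sq, zero_smul]

theorem qF_qF_smul (j : Fin 2) (v : V) : qF L j • qF L j • v = 0 := by
  rw [← mul_smul, qF_sq, zero_smul]

theorem qF_quartic_smul {i j : Fin 2} (hij : i ≠ j) (v : V) :
    qF L i • qF L j • qF L i • qF L j • v = qF L j • qF L i • qF L j • qF L i • v := by
  have h := congrArg (· • v) (qF_quartic (L := L))
  simp only [sq, mul_smul] at h
  fin_cases i <;> fin_cases j <;> first | exact absurd rfl hij | exact h | exact h.symm

theorem qE_quartic_smul {i j : Fin 2} (hij : i ≠ j) (v : V) :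
    qE L i • qE L j • qE L i • qE L j • v = qE L j • qE L i • qE L j • qE L i • v := by
  have h := congrArg (· • v) (qE_quartic (L := L))
  simp only [sq, mul_smul] at h
  fin_cases i <;> fin_cases j <;> first | exact absurd rfl hij | exact h | exact h.symm

/-- The eight reduced words in `X_{-1}`, `X_{-2}` applied to a vector. -/
def words (L : IntermediateLattice) {V : Type} [AddCommGroup V] [Module (QGrp L) V] (v : V) :
    Fin 8 → V :=
  ![v, qF L 0 • v, qF L 1 • v, qF L 0 • qF L 1 • v, qF L 1 • qF L 0 • v,
    qF L 0 • qF L 1 • qF L 0 • v, qF L 1 • qF L 0 • qF L 1 • v,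
    qF L 0 • qF L 1 • qF L 0 • qF L 1 • v]

end Words

section MaximalVectors

variable {L : IntermediateLattice} {V : Type} [AddCommGroup V] [Module ℂ V] [Module (QGrp L) V]
  [IsScalarTower ℂ (QGrp L) V]

variable (L V) in
/-- The vectors of weight `lam` on which the `K_γ` act by the corresponding scalars. -/
def wtSpace (lam : Weight) : Submodule ℂ V where
  carrier := {v | (∀ j, qH L j • v = lam j • v) ∧ ∀ γ, qK L γ • v = iPow (form γ lam) • v}
  add_mem' := by
    rintro v w ⟨hv, hv'⟩ ⟨hw, hw'⟩
    exact ⟨fun j => by rw [smul_add, smul_add, hv j, hw j],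
      fun γ => by rw [smul_add, smul_add, hv' γ, hw' γ]⟩
  zero_mem' := ⟨fun j => by rw [smul_zero, smul_zero], fun γ => by rw [smul_zero, smul_zero]⟩
  smul_mem' := by
    rintro c v ⟨hv, hv'⟩
    exact ⟨fun j => by rw [smul_comm (qH L j) c v, hv j, smul_comm],
      fun γ => by rw [smul_comm (qK L γ) c v, hv' γ, smul_comm]⟩

theorem wtSpace_le_weightSpace (lam : Weight) : wtSpace L V lam ≤ weightSpace L V lam :=
  fun _ hv => hv.1

theorem form_comm (a b : Weight) : form a b = form b a := by
  simp only [form]; ring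

theorem simpleRoot_apply (j k : Fin 2) : simpleRoot k j = (cartan j k : ℂ) := rfl

theorem qE_mem_wtSpace {lam : Weight} {v : V} (hv : v ∈ wtSpace L V lam) (j : Fin 2) :
    qE L j • v ∈ wtSpace L V (lam + simpleRoot j) := by
  refine ⟨fun k => ?_, fun γ => ?_⟩
  · have h := congrArg (· • v) (qH_qE (L := L) k j)
    simp only [sub_smul, mul_smul, smul_assoc, hv.1 k, smul_comm (qE L j) (lam k) v] at h
    rw [Pi.add_apply, add_smul, simpleRoot_apply, ← h]; abel
  · rw [← mul_smul, qK_qE, smul_assoc, mul_smul, hv.2 γ, smul_comm (qE L j), smul_smul,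
      form_add_right, iPow_add, mul_comm]

theorem qF_mem_wtSpace {lam : Weight} {v : V} (hv : v ∈ wtSpace L V lam) (j : Fin 2) :
    qF L j • v ∈ wtSpace L V (lam - simpleRoot j) := by
  refine ⟨fun k => ?_, fun γ => ?_⟩
  · have h := congrArg (· • v) (qH_qF (L := L) k j)
    simp only [sub_smul, mul_smul, smul_assoc, hv.1 k, smul_comm (qF L j) (lam k) v] at h
    rw [Pi.sub_apply, sub_smul, simpleRoot_apply, ← sub_add_cancel (qH L k • qF L j • v), h,
      neg_smul, sub_eq_add_neg, add_comm]
  · rw [← mul_smul, qK_qF, smul_assoc, mul_smul, hv.2 γ, smul_comm (qF L j), smul_smul,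
      sub_eq_add_neg, form_add_right, iPow_add, mul_comm, form_comm γ (-simpleRoot j), form_neg,
      form_comm (simpleRoot j)]

theorem qK_simpleRoot_smul {lam : Weight} {v : V} (hv : v ∈ wtSpace L V lam) (j : Fin 2) :
    qK L (L.simpleRoot j) • v = iPow (lam j) • v := by
  rw [hv.2, form_simpleRoot_left]

theorem qE_qF_smul_self {lam : Weight} {v : V} (hv : v ∈ wtSpace L V lam) (j : Fin 2) :
    qE L j • qF L j • v = qF L j • qE L j • v + br (lam j) • v := by
  have h := congrArg (· • v) (qE_qF (L := L) j)
  simp only [sub_smul, mul_smul, smul_assoc, hv.2, NegMemClass.coe_neg, form_neg,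
    form_simpleRoot_left] at h
  rw [br, mul_smul, sub_smul, ← h]; abel

theorem simpleRoot_self (i : Fin 2) : simpleRoot i i = 2 := by
  fin_cases i <;> simp [simpleRoot, cartan]

theorem simpleRoot_ne {i j : Fin 2} (h : i ≠ j) : simpleRoot i j = -1 := by
  fin_cases i <;> fin_cases j <;> simp [simpleRoot, cartan] at h ⊢

variable (L) in
/-- `v` is a maximal vector of weight `lam` (possibly zero). -/
structure IsMaximal (lam : Weight) (v : V) : Prop where
  mem : v ∈ wtSpace L V lam
  qE_smul : ∀ j, qE L j • v = 0

/-! ### Raising operators on the words applied to a maximal vector -/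

section Formulas

variable {lam : Weight} {v : V} (hv : IsMaximal L lam v) {i j : Fin 2} (hij : i ≠ j)

include hv

theorem IsMaximal.qE_qF (i : Fin 2) : qE L i • qF L i • v = br (lam i) • v := by
  rw [qE_qF_smul_self hv.mem, hv.qE_smul, smul_zero, zero_add]

theorem IsMaximal.smul (c : ℂ) : IsMaximal L lam (c • v) :=
  ⟨Submodule.smul_mem _ _ hv.mem, fun j => by rw [smul_comm, hv.qE_smul, smul_zero]⟩

include hij

theorem IsMaximal.qE_qF_ne : qE L j • qF L i • v = 0 := by
  rw [qE_qF_smul_ne hij.symm, hv.qE_smul, smul_zero]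

theorem IsMaximal.qE_qF_qF : qE L i • qF L i • qF L j • v = br (lam i + 1) • qF L j • v := by
  rw [qE_qF_smul_self (qF_mem_wtSpace hv.mem j), hv.qE_qF_ne hij.symm, smul_zero, zero_add,
    Pi.sub_apply, simpleRoot_ne hij.symm, sub_neg_eq_add]

theorem IsMaximal.qE_qF_qF_ne : qE L j • qF L i • qF L j • v = br (lam j) • qF L i • v := by
  rw [qE_qF_smul_ne hij.symm, hv.qE_qF, smul_comm]

theorem IsMaximal.qE_qF_qF_qF : qE L j • qF L j • qF L i • qF L j • v =
    br (lam j - 1) • qF L i • qF L j • v + br (lam j) • qF L j • qF L i • v := by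
  rw [qE_qF_smul_self (qF_mem_wtSpace (qF_mem_wtSpace hv.mem j) i), hv.qE_qF_qF_ne hij,
    smul_comm, add_comm, Pi.sub_apply, Pi.sub_apply, simpleRoot_ne hij, simpleRoot_self]
  congr 3; ring

theorem IsMaximal.qE_qF_qF_qF_ne : qE L i • qF L j • qF L i • qF L j • v = 0 := by
  rw [qE_qF_smul_ne hij, hv.qE_qF_qF hij, smul_comm, qF_qF_smul, smul_zero]

theorem IsMaximal.qE_top : qE L i • qF L i • qF L j • qF L i • qF L j • v =
    br (lam i) • qF L j • qF L i • qF L j • v := by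
  rw [qE_qF_smul_self (qF_mem_wtSpace (qF_mem_wtSpace (qF_mem_wtSpace hv.mem j) i) j),
    hv.qE_qF_qF_qF_ne hij, smul_zero, zero_add, Pi.sub_apply, Pi.sub_apply, Pi.sub_apply,
    simpleRoot_ne hij.symm, simpleRoot_self]
  congr 2; ring

/-- The value of the contravariant form on the lowest weight vector. -/
theorem IsMaximal.qE_top_qF_top :
    qE L j • qE L i • qE L j • qE L i • qF L i • qF L j • qF L i • qF L j • v =
      (-(br (lam i) * br (lam j) * br (lam i + lam j + 1))) • v := by
  have c (k : Fin 2) (z : ℂ) (x : V) : qE L k • z • x = z • qE L k • x := smul_comm _ _ _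
  -- After three raisings the coefficient of X_{-j} v is br(λ(H_i)) times br(λ(H_j) - 1) br(λ(H_i) +
  -- 1) + br(λ(H_j)) br(λ(H_i)); by `br_sub_one` and `br_det` the second factor equals -br(λ(H_i) +
  -- λ(H_j) + 1).
  simp only [hv.qE_top hij, c, hv.qE_qF_qF_qF hij, smul_add, hv.qE_qF_qF hij,
    hv.qE_qF_qF_ne hij.symm, hv.qE_qF, br_det, br_sub_one]
  module

end Formulas

/-! ### The submodule generated by a maximal vector -/

theorem gen_induction (W : Submodule ℂ V) (hW : ∀ x : Gen L, ∀ w ∈ W, gen x • w ∈ W)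
    (u : QGrp L) : ∀ w ∈ W, u • w ∈ W := by
  obtain ⟨a, rfl⟩ := RingQuot.mkAlgHom_surjective ℂ (Rel L) u
  change ∀ w ∈ W, toQGrp L a • w ∈ W
  induction a using FreeAlgebra.induction with
  | grade0 r =>
    intro w hw
    rw [AlgHom.commutes, algebraMap_smul]
    exact W.smul_mem r hw
  | grade1 x => exact hW x
  | mul a b ha hb =>
    intro w hw
    rw [map_mul, mul_smul]
    exact ha _ (hb _ hw)
  | add a b ha hb =>
    intro w hw
    rw [map_add, add_smul]
    exact W.add_mem (ha _ hw) (hb _ hw)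

/-- The multiplicities of the simple roots in the weights of the words. -/
def wordDepth : Fin 8 → ℕ × ℕ :=
  ![(0, 0), (1, 0), (0, 1), (1, 1), (1, 1), (2, 1), (1, 2), (2, 2)]

/-- The weight `lam - n α₁ - m α₂`. -/
def lower (lam : Weight) (p : ℕ × ℕ) : Weight :=
  lam - ((p.1 : ℂ) • simpleRoot 0 + (p.2 : ℂ) • simpleRoot 1)

theorem words_mem_wtSpace {lam : Weight} {v : V} (hv : v ∈ wtSpace L V lam) (n : Fin 8) :
    words L v n ∈ wtSpace L V (lower lam (wordDepth n)) := by
  have h (mu : Weight) (w : V) (hw : w ∈ wtSpace L V mu) (hmu : mu = lower lam (wordDepth n)) :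
      w ∈ wtSpace L V (lower lam (wordDepth n)) := hmu ▸ hw
  have h0 {mu : Weight} {w : V} (hw : w ∈ wtSpace L V mu) := qF_mem_wtSpace hw 0
  have h1 {mu : Weight} {w : V} (hw : w ∈ wtSpace L V mu) := qF_mem_wtSpace hw 1
  fin_cases n
  · exact h _ _ hv (by simp [lower, wordDepth])
  · exact h _ _ (h0 hv) (by simp [lower, wordDepth])
  · exact h _ _ (h1 hv) (by simp [lower, wordDepth])
  · exact h _ _ (h0 (h1 hv)) (by simp [lower, wordDepth]; abel)
  · exact h _ _ (h1 (h0 hv)) (by simp [lower, wordDepth]; abel)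
  · exact h _ _ (h0 (h1 (h0 hv))) (by simp [lower, wordDepth]; module)
  · exact h _ _ (h1 (h0 (h1 hv))) (by simp [lower, wordDepth]; module)
  · exact h _ _ (h0 (h1 (h0 (h1 hv)))) (by simp [lower, wordDepth]; module)

/-- The span of the words is stable under each generator: under X_{-j} because X_{-j}² = 0 and the
quartic relation leave only eight words, under X_j by the raising formulas, and under H_j, K_γ
because words are weight vectors. In particular highest weight modules have dimension at most 8. -/
theorem IsMaximal.smul_mem_span {lam : Weight} {v : V} (hv : IsMaximal L lam v) (u : QGrp L) :
    u • v ∈ Submodule.span ℂ (Set.range (words L v)) := by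
  set W := Submodule.span ℂ (Set.range (words L v)) with hW
  have hw (n : Fin 8) : words L v n ∈ W := Submodule.subset_span ⟨n, rfl⟩
  have h01 : (0 : Fin 2) ≠ 1 := by decide
  have hE (k : Fin 2) (n : Fin 8) : qE L k • words L v n ∈ W := by
    fin_cases k <;> fin_cases n <;>
      simp only [words, Fin.zero_eta, Fin.mk_one, Fin.reduceFinMk, Matrix.cons_val, hv.qE_smul,
        hv.qE_qF, hv.qE_qF_ne h01, hv.qE_qF_ne h01.symm, hv.qE_qF_qF h01, hv.qE_qF_qF h01.symm,
        hv.qE_qF_qF_ne h01, hv.qE_qF_qF_ne h01.symm, hv.qE_qF_qF_qF h01, hv.qE_qF_qF_qF h01.symm,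
        hv.qE_qF_qF_qF_ne h01, hv.qE_qF_qF_qF_ne h01.symm, hv.qE_top h01]
    all_goals first
      | exact W.zero_mem
      | exact W.smul_mem _ (hw 0)
      | exact W.smul_mem _ (hw 1)
      | exact W.smul_mem _ (hw 2)
      | exact W.smul_mem _ (hw 6)
      | exact W.add_mem (W.smul_mem _ (hw 3)) (W.smul_mem _ (hw 4))
      | exact W.add_mem (W.smul_mem _ (hw 4)) (W.smul_mem _ (hw 3))
      | skip
    -- The case left over is X_2 on the longest word, which is stored beginning with X_{-1}; the
    -- quartic relation makes it begin with X_{-2}.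
    rw [qF_quartic_smul h01, hv.qE_top h01.symm]
    exact W.smul_mem _ (hw 5)
  have hF (k : Fin 2) (n : Fin 8) : qF L k • words L v n ∈ W := by
    fin_cases k <;> fin_cases n <;>
      simp only [words, Fin.zero_eta, Fin.mk_one, Fin.reduceFinMk, Matrix.cons_val, qF_qF_smul]
    all_goals first
      | exact W.zero_mem
      | exact hw 1
      | exact hw 2
      | exact hw 3
      | exact hw 4
      | exact hw 5
      | exact hw 6
      | exact hw 7
      | skip
    -- Two cases remain for X_{-2}: it turns the sixth word into the other spelling of the longest
    -- word, and it kills the longest word.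
    · rw [← qF_quartic_smul h01]
      exact hw 7
    · rw [qF_quartic_smul h01, qF_qF_smul]
      exact W.zero_mem
  have hgen (x : Gen L) (n : Fin 8) : gen x • words L v n ∈ W := by
    cases x with
    | E k => exact hE k n
    | F k => exact hF k n
    | H k => rw [(words_mem_wtSpace hv.mem n).1]; exact W.smul_mem _ (hw n)
    | K γ => rw [(words_mem_wtSpace hv.mem n).2]; exact W.smul_mem _ (hw n)
  refine gen_induction W (fun x w hwW => ?_) u v (hw 0)
  induction hwW using Submodule.span_induction with
  | mem w h => obtain ⟨n, rfl⟩ := h; exact hgen x n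
  | zero => rw [smul_zero]; exact W.zero_mem
  | add a b _ _ ha hb => rw [smul_add]; exact W.add_mem ha hb
  | smul c a _ ha => rw [smul_comm]; exact W.smul_mem c ha

end MaximalVectors

/-! ### Comparison of weights -/

theorem lower_zero (lam : Weight) : lower lam 0 = lam := by
  simp [lower]

theorem lower_lower (lam : Weight) (p q : ℕ × ℕ) : lower (lower lam p) q = lower lam (p + q) := by
  simp only [lower, Prod.fst_add, Prod.snd_add, Nat.cast_add]
  module

theorem lower_injective (lam : Weight) : Function.Injective (lower lam) := by
  intro p q h
  have h0 := congrFun h 0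
  have h1 := congrFun h 1
  simp only [lower, Pi.sub_apply, Pi.add_apply, Pi.smul_apply, smul_eq_mul, simpleRoot_self,
    simpleRoot_ne (i := 0) (j := 1) (by decide), simpleRoot_ne (i := 1) (j := 0) (by decide)]
    at h0 h1
  -- The coefficients are, up to sign, the entries of the inverse Cartan matrix.
  have e1 : (p.1 : ℂ) = q.1 := by linear_combination (-2 / 3) * h0 - (1 / 3) * h1
  have e2 : (p.2 : ℂ) = q.2 := by linear_combination (-1 / 3) * h0 - (2 / 3) * h1
  exact Prod.ext (by exact_mod_cast e1) (by exact_mod_cast e2)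

/-- No weight `lam - n α₁ - m α₂` equals `mu`. -/
def NotBelow (mu lam : Weight) : Prop := ∀ p, lower lam p ≠ mu

theorem notBelow_lower {lam : Weight} {p q : ℕ × ℕ} (h : ¬ p ≤ q) :
    NotBelow (lower lam q) (lower lam p) := by
  intro r hr
  rw [lower_lower] at hr
  exact h (lower_injective lam hr ▸ le_self_add)

/-- The multiplicities of the simple roots in a simple root. -/
def depth (j : Fin 2) : ℕ × ℕ := if j = 0 then (1, 0) else (0, 1)

theorem lower_depth (lam : Weight) (j : Fin 2) : lower lam (depth j) = lam - simpleRoot j := by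
  fin_cases j <;> simp [lower, depth]

/-! ### Independence of weight spaces -/

section Independence

variable (L : IntermediateLattice) (V : Type) [AddCommGroup V] [Module ℂ V] [Module (QGrp L) V]
  [IsScalarTower ℂ (QGrp L) V]

/-- H_1 and H_2 commute, so their simultaneous generalized eigenspaces are independent, and the
weight spaces lie inside these. -/
theorem iSupIndep_weightSpace : iSupIndep (weightSpace L V) := by
  let f : Fin 2 → Module.End ℂ V := fun j => Algebra.lsmul ℂ ℂ V (qH L j)
  have hc (i j : Fin 2) : Commute (f i) (f j) := by
    ext v
    simp only [f, Module.End.mul_apply, Algebra.lsmul_coe, ← mul_smul, qH_qH i j]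
  refine (Module.End.independent_iInf_maxGenEigenspace_of_forall_mapsTo f fun i j φ =>
    Module.End.mapsTo_maxGenEigenspace_of_comm (hc j i) φ).mono fun lam v hv => ?_
  rw [Submodule.mem_iInf]
  exact fun j => Module.End.eigenspace_le_maxGenEigenspace
    (Module.End.mem_eigenspace_iff.2 (hv j))

/-- The sum of the weight spaces other than that of `lam`. -/
def otherWeights (lam : Weight) : Submodule ℂ V := ⨆ mu, ⨆ _ : mu ≠ lam, weightSpace L V mu

variable {L V}

theorem weightSpace_le_otherWeights {lam mu : Weight} (h : mu ≠ lam) :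
    weightSpace L V mu ≤ otherWeights L V lam :=
  le_iSup₂_of_le mu h le_rfl

/-- This replaces weight projections throughout: a weight vector is shown to be zero, or to lie
outside a submodule, by comparison with the sum of the other weight spaces. -/
theorem eq_zero_of_mem_otherWeights {lam : Weight} {v : V} (hv : v ∈ weightSpace L V lam)
    (hv' : v ∈ otherWeights L V lam) : v = 0 :=
  (Submodule.disjoint_def.1 (iSupIndep_weightSpace L V lam)) v hv hv'

theorem linearIndependent_of_mem_weightSpace {ι : Type} {lam : ι → Weight}
    (hlam : Function.Injective lam) {v : ι → V} (hv : ∀ n, v n ∈ weightSpace L V (lam n))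
    (h0 : ∀ n, v n ≠ 0) : LinearIndependent ℂ v :=
  ((iSupIndep_weightSpace L V).comp hlam).linearIndependent _ hv h0

end Independence

/-! ### Verma modules and their irreducible quotients -/

section Universal

variable {L : IntermediateLattice}
  {V : Type} [AddCommGroup V] [Module ℂ V] [Module (QGrp L) V] [IsScalarTower ℂ (QGrp L) V]
  {W : Type} [AddCommGroup W] [Module ℂ W] [Module (QGrp L) W] [IsScalarTower ℂ (QGrp L) W]

theorem map_mem_wtSpace {lam : Weight} {v : V} (hv : v ∈ wtSpace L V lam)
    (f : V →ₗ[QGrp L] W) : f v ∈ wtSpace L W lam :=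
  ⟨fun j => by rw [← map_smul, hv.1, LinearMap.map_smul_of_tower],
    fun γ => by rw [← map_smul, hv.2, LinearMap.map_smul_of_tower]⟩

theorem map_mem_weightSpace {lam : Weight} {v : V} (hv : v ∈ weightSpace L V lam)
    (f : V →ₗ[QGrp L] W) : f v ∈ weightSpace L W lam :=
  fun j => by rw [← map_smul, hv, LinearMap.map_smul_of_tower]

theorem IsMaximal.map {lam : Weight} {v : V} (hv : IsMaximal L lam v) (f : V →ₗ[QGrp L] W) :
    IsMaximal L lam (f v) :=
  ⟨map_mem_wtSpace hv.mem f, fun j => by rw [← map_smul, hv.qE_smul, map_zero]⟩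

variable (L) in
/-- The canonical generator of the Verma module. -/
def vermaGen (lam : Weight) : Verma L lam := Submodule.Quotient.mk 1

theorem smul_vermaGen (lam : Weight) (u : QGrp L) :
    u • vermaGen L lam = Submodule.Quotient.mk u := by
  rw [vermaGen, ← Submodule.Quotient.mk_smul, smul_eq_mul, mul_one]

theorem isMaximal_vermaGen (lam : Weight) : IsMaximal L lam (vermaGen L lam) := by
  refine ⟨⟨fun j => ?_, fun γ => ?_⟩, fun j => ?_⟩
  · rw [smul_vermaGen, ← algebraMap_smul (QGrp L) (lam j), smul_vermaGen,
      Submodule.Quotient.eq]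
    exact Submodule.subset_span (Or.inl (Or.inr ⟨j, rfl⟩))
  · rw [smul_vermaGen, ← algebraMap_smul (QGrp L) (iPow _), smul_vermaGen,
      Submodule.Quotient.eq]
    exact Submodule.subset_span (Or.inr ⟨γ, rfl⟩)
  · rw [smul_vermaGen, Submodule.Quotient.mk_eq_zero]
    exact Submodule.subset_span (Or.inl (Or.inl ⟨j, rfl⟩))

/-- The universal property of Verma modules. -/
def IsMaximal.lift {lam : Weight} {v : V} (hv : IsMaximal L lam v) :
    Verma L lam →ₗ[QGrp L] V :=
  (vermaIdeal L lam).liftQ (LinearMap.toSpanSingleton (QGrp L) V v) <| by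
    rw [vermaIdeal, Submodule.span_le]
    rintro _ ((⟨j, rfl⟩ | ⟨j, rfl⟩) | ⟨γ, rfl⟩)
    · simp [hv.qE_smul]
    · simp [sub_smul, hv.mem.1 j]
    · simp [sub_smul, hv.mem.2 γ]

theorem IsMaximal.lift_smul_vermaGen {lam : Weight} {v : V} (hv : IsMaximal L lam v)
    (u : QGrp L) : hv.lift (u • vermaGen L lam) = u • v := by
  rw [smul_vermaGen]
  rfl

theorem IsMaximal.lift_vermaGen {lam : Weight} {v : V} (hv : IsMaximal L lam v) :
    hv.lift (vermaGen L lam) = v := by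
  simpa using hv.lift_smul_vermaGen 1

theorem exists_smul_vermaGen {lam : Weight} (x : Verma L lam) : ∃ u : QGrp L,
    u • vermaGen L lam = x := by
  obtain ⟨u, rfl⟩ := Submodule.Quotient.mk_surjective _ x
  exact ⟨u, smul_vermaGen lam u⟩

/-- The defining left ideal annihilates the maximal vector supplied by `hasMaximalRep`, whereas 1
does not. -/
theorem vermaGen_ne_zero (lam : Weight) : vermaGen L lam ≠ 0 := by
  obtain ⟨V, _, _, f, v, hv, hE, hH, hK⟩ := hasMaximalRep L lam
  intro h
  rw [vermaGen, Submodule.Quotient.mk_eq_zero] at h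
  have key : ∀ u ∈ vermaIdeal L lam, f u v = 0 := by
    intro u hu
    induction hu using Submodule.span_induction with
    | mem u hu =>
      rcases hu with (⟨j, rfl⟩ | ⟨j, rfl⟩) | ⟨γ, rfl⟩
      · exact hE j
      · simp [hH j]
      · simp [hK γ]
    | zero => simp
    | add a b _ _ ha hb => simp [ha, hb]
    | smul a b _ hb => simp [hb]
  exact hv (by simpa using key 1 h)

theorem IsMaximal.range_lift {lam : Weight} {v : V} (hv : IsMaximal L lam v) {x : V}
    (hx : x ∈ LinearMap.range hv.lift) : x ∈ Submodule.span ℂ (Set.range (words L v)) := by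
  obtain ⟨y, rfl⟩ := hx
  obtain ⟨u, rfl⟩ := exists_smul_vermaGen y
  rw [hv.lift_smul_vermaGen]
  exact hv.smul_mem_span u

theorem IsMaximal.mem_range_lift {lam : Weight} {v : V} (hv : IsMaximal L lam v) :
    v ∈ LinearMap.range hv.lift := ⟨_, hv.lift_vermaGen⟩

theorem IsMaximal.mem_otherWeights {lam mu : Weight} {v : V} (hv : IsMaximal L lam v)
    (h : NotBelow mu lam) {x : V} (hx : x ∈ LinearMap.range hv.lift) :
    x ∈ otherWeights L V mu := by
  refine (Submodule.span_le.2 ?_) (hv.range_lift hx)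
  rintro _ ⟨n, rfl⟩
  exact weightSpace_le_otherWeights (h _)
    (wtSpace_le_weightSpace _ (words_mem_wtSpace hv.mem n))

theorem finrank_range_lift_le {lam : Weight} {v : V} (hv : IsMaximal L lam v) {d : ℕ}
    (w : Fin d → V) (h : ∀ n, words L v n ∈ Submodule.span ℂ (Set.range w)) :
    Module.Finite ℂ (LinearMap.range hv.lift) ∧
      Module.finrank ℂ (LinearMap.range hv.lift) ≤ d := by
  let S : Submodule ℂ V := (LinearMap.range hv.lift).restrictScalars ℂ
  have hS : S ≤ Submodule.span ℂ (Set.range w) := fun x hx => by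
    refine (Submodule.span_le.2 ?_) (hv.range_lift hx)
    rintro _ ⟨n, rfl⟩
    exact h n
  have : Module.Finite ℂ (Submodule.span ℂ (Set.range w)) :=
    Module.Finite.span_of_finite ℂ (Set.finite_range w)
  have hfin : Module.Finite ℂ S := Submodule.finiteDimensional_of_le hS
  refine ⟨hfin, ?_⟩
  calc Module.finrank ℂ S ≤ _ := Submodule.finrank_mono hS
    _ ≤ d := (finrank_range_le_card (R := ℂ) w).trans_eq (Fintype.card_fin d)

theorem finrank_le_of_generator {lam : Weight} {v : V} (hv : IsMaximal L lam v)
    (hgen : ∀ x : V, ∃ u : QGrp L, u • v = x) {d : ℕ}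
    (w : Fin d → V) (h : ∀ n, words L v n ∈ Submodule.span ℂ (Set.range w)) :
    Module.Finite ℂ V ∧ Module.finrank ℂ V ≤ d := by
  have htop : LinearMap.range hv.lift = ⊤ := by
    rw [eq_top_iff]
    intro x _
    obtain ⟨u, rfl⟩ := hgen x
    exact ⟨_, hv.lift_smul_vermaGen u⟩
  obtain ⟨h1, h2⟩ := finrank_range_lift_le hv w h
  rw [htop] at h1 h2
  let e : (⊤ : Submodule (QGrp L) V) ≃ₗ[ℂ] V := Submodule.topEquiv.restrictScalars ℂ
  exact ⟨Module.Finite.equiv e, e.finrank_eq ▸ h2⟩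

/-- The element `∏ (D - d + k)`, `k = 1, …, 4`, with `D = H₁ + H₂`. -/
theorem exists_projector (lam : Weight) : ∃ u : QGrp L, ∀ v ∈ wtSpace L V lam,
    u • words L v 0 = (24 : ℂ) • v ∧ ∀ n, n ≠ 0 → u • words L v n = 0 := by
  let D (k : ℂ) : QGrp L := qH L 0 + qH L 1 - algebraMap ℂ _ (lam 0 + lam 1 - k)
  have hD (v : V) (hv : v ∈ wtSpace L V lam) (k : ℂ) (n : Fin 8) : D k • words L v n =
      (k - (wordDepth n).1 - (wordDepth n).2) • words L v n := by
    have h := (words_mem_wtSpace hv n).1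
    have h0 := simpleRoot_ne (i := 0) (j := 1) (by decide)
    have h1 := simpleRoot_ne (i := 1) (j := 0) (by decide)
    simp only [D, sub_smul, add_smul, h, algebraMap_smul, lower, Pi.sub_apply, Pi.add_apply,
      Pi.smul_apply, smul_eq_mul, simpleRoot_self, h0, h1]
    module
  have hc (k z : ℂ) (x : V) : D k • z • x = z • D k • x := smul_comm _ _ _
  -- `D k` multiplies a word of length l by k - l. The words other than v have length 1 to 4, so one
  -- factor kills each of them, and v is multiplied by 4! = 24.
  refine ⟨D 1 * D 2 * D 3 * D 4, fun v hv => ⟨?_, fun n hn => ?_⟩⟩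
  · simp only [mul_smul, hD v hv, hc]
    rw [show words L v 0 = v from rfl]
    simp only [wordDepth, Matrix.cons_val_zero]
    module
  · simp only [mul_smul, hD v hv, hc]
    simp only [smul_smul]
    fin_cases n <;> simp [wordDepth] at hn ⊢ <;> norm_num

/-- A proper submodule of a highest weight module has no component of the highest weight. -/
theorem mem_otherWeights_of_proper {lam : Weight} {v : V} (hv : IsMaximal L lam v)
    (hgen : ∀ x : V, ∃ u : QGrp L, u • v = x) {N : Submodule (QGrp L) V} (hN : N ≠ ⊤) {x : V}
    (hx : x ∈ N) : x ∈ otherWeights L V lam := by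
  obtain ⟨u, rfl⟩ := hgen x
  obtain ⟨c, hc⟩ := (Submodule.mem_span_range_iff_exists_fun ℂ).1 (hv.smul_mem_span u)
  obtain ⟨p, hp⟩ := exists_projector (L := L) (V := V) lam
  obtain ⟨hp0, hpn⟩ := hp v hv.mem
  rw [← hc] at hx ⊢
  have h1 : p • ∑ n, c n • words L v n = (c 0 * 24) • v := by
    rw [Finset.smul_sum, Finset.sum_eq_single 0]
    · rw [smul_comm, hp0, smul_smul]
    · intro n _ hn
      rw [smul_comm, hpn n hn, smul_zero]
    · simp
  -- Otherwise the projector would put a nonzero multiple of v, hence the whole module, into N.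
  have hc0 : c 0 = 0 := by
    by_contra hc0
    refine hN (eq_top_iff.2 fun y _ => ?_)
    obtain ⟨w, rfl⟩ := hgen y
    refine N.smul_mem w ?_
    have h2 : (c 0 * 24) • v ∈ N := h1 ▸ N.smul_mem p hx
    have h3 := N.smul_of_tower_mem ((c 0 * 24)⁻¹) h2
    rwa [smul_smul, inv_mul_cancel₀ (by simpa using hc0), one_smul] at h3
  refine Submodule.sum_mem _ fun n _ => ?_
  by_cases hn : n = 0
  · rw [hn, hc0, zero_smul]
    exact Submodule.zero_mem _
  · refine Submodule.smul_mem _ _ (weightSpace_le_otherWeights ?_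
      (wtSpace_le_weightSpace _ (words_mem_wtSpace hv.mem n)))
    intro h
    rw [← lower_zero lam, lower_lower, zero_add] at h
    have := lower_injective lam h
    fin_cases n <;> simp [wordDepth] at hn this

variable (L) in
/-- The largest proper submodule of a Verma module. -/
abbrev vermaRad (lam : Weight) : Submodule (QGrp L) (Verma L lam) :=
  sSup {N : Submodule (QGrp L) (Verma L lam) | N ≠ ⊤}

theorem le_vermaRad {lam : Weight} {N : Submodule (QGrp L) (Verma L lam)}
    (h : vermaGen L lam ∉ N) : N ≤ vermaRad L lam :=
  le_sSup fun h' => h (h' ▸ Submodule.mem_top)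

/-- Every proper submodule lies in the sum of the weight spaces of weight different from λ, hence so
does the sum of all of them, and the nonzero generator has weight λ. So the largest proper submodule
is indeed proper. -/
theorem vermaGen_notMem_vermaRad (lam : Weight) : vermaGen L lam ∉ vermaRad L lam := by
  intro h
  refine vermaGen_ne_zero (L := L) lam (eq_zero_of_mem_otherWeights (lam := lam)
    (wtSpace_le_weightSpace _ (isMaximal_vermaGen lam).mem) ?_)
  generalize vermaGen L lam = x at h
  rw [vermaRad, sSup_eq_iSup'] at h
  induction h using Submodule.iSup_induction' with
  | mem N x hx =>
    exact mem_otherWeights_of_proper (isMaximal_vermaGen lam) exists_smul_vermaGen N.2 hx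
  | zero => exact Submodule.zero_mem _
  | add x y _ _ hx hy => exact Submodule.add_mem _ hx hy

variable (L) in
/-- The canonical generator of the irreducible module. -/
def irrGen (lam : Weight) : Irr L lam := Submodule.Quotient.mk (vermaGen L lam)

theorem isMaximal_irrGen (lam : Weight) : IsMaximal L lam (irrGen L lam) :=
  (isMaximal_vermaGen lam).map (vermaRad L lam).mkQ

theorem irrGen_ne_zero (lam : Weight) : irrGen L lam ≠ 0 := fun h =>
  vermaGen_notMem_vermaRad lam ((Submodule.Quotient.mk_eq_zero _).1 h)

theorem exists_smul_irrGen {lam : Weight} (x : Irr L lam) : ∃ u : QGrp L,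
    u • irrGen L lam = x := by
  obtain ⟨y, rfl⟩ := Submodule.Quotient.mk_surjective _ x
  obtain ⟨u, rfl⟩ := exists_smul_vermaGen y
  exact ⟨u, rfl⟩

/-- The submodule generated by the maximal vector `v` is irreducible, or zero. -/
def IsMaximal.Simple {lam : Weight} {v : V} (hv : IsMaximal L lam v) : Prop :=
  vermaRad L lam ≤ LinearMap.ker hv.lift

theorem IsMaximal.notMem_range_lift {lam mu : Weight} {v w : V} (hv : IsMaximal L lam v)
    (hw : IsMaximal L mu w) (hv0 : v ≠ 0) (h : NotBelow lam mu) :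
    v ∉ LinearMap.range hw.lift := fun hvw =>
  hv0 (eq_zero_of_mem_otherWeights (wtSpace_le_weightSpace _ hv.mem) (hw.mem_otherWeights h hvw))

/-- The preimage of N in the Verma module misses the generator, so it lies in the radical, on which
the map to V vanishes. -/
theorem IsMaximal.Simple.disjoint {lam : Weight} {v : V} {hv : IsMaximal L lam v}
    (hs : hv.Simple) {N : Submodule (QGrp L) V} (h : v ∉ N) {x : V}
    (hx : x ∈ LinearMap.range hv.lift) (hx' : x ∈ N) : x = 0 := by
  obtain ⟨y, rfl⟩ := hx
  refine hs (le_vermaRad (N := N.comap hv.lift) ?_ hx')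
  rwa [Submodule.mem_comap, hv.lift_vermaGen]

/-- A simple highest weight module has no maximal vectors of lower weight. -/
theorem IsMaximal.Simple.eq_zero {lam mu : Weight} {v w : V} {hv : IsMaximal L lam v}
    (hs : hv.Simple) (hw : IsMaximal L mu w) (h : NotBelow lam mu)
    (hx : w ∈ LinearMap.range hv.lift) : w = 0 := by
  by_cases hv0 : v = 0
  · obtain ⟨y, rfl⟩ := hx
    obtain ⟨u, rfl⟩ := exists_smul_vermaGen y
    rw [hv.lift_smul_vermaGen, hv0, smul_zero]
  · exact hs.disjoint (hv.notMem_range_lift hw hv0 h) hx hw.mem_range_lift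

theorem simple_irrGen (lam : Weight) : (isMaximal_irrGen (L := L) lam).Simple := by
  intro x hx
  obtain ⟨u, rfl⟩ := exists_smul_vermaGen x
  rw [LinearMap.mem_ker, IsMaximal.lift_smul_vermaGen]
  exact (Submodule.Quotient.mk_eq_zero _).2 hx

/-- The source of all relations between words in an irreducible module: a candidate combination is
checked to be killed by X_1 and X_2. -/
theorem Irr.eq_zero_of_isMaximal {lam mu : Weight} {x : Irr L lam} (hx : IsMaximal L mu x)
    (h : NotBelow lam mu) : x = 0 := by
  refine (simple_irrGen lam).eq_zero hx h ?_
  obtain ⟨u, rfl⟩ := exists_smul_irrGen x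
  exact ⟨_, IsMaximal.lift_smul_vermaGen _ u⟩

end Universal

/-! ### Dimension counting -/

section Counting

variable {L : IntermediateLattice}
  {M : Type} [AddCommGroup M] [Module ℂ M] [Module (QGrp L) M] [IsScalarTower ℂ (QGrp L) M]
  {T : Type} [AddCommGroup T] [Module ℂ T] [Module (QGrp L) T] [IsScalarTower ℂ (QGrp L) T]
  {I : Type} [AddCommGroup I] [Module ℂ I] [Module (QGrp L) I] [IsScalarTower ℂ (QGrp L) I]

/-- Rank–nullity: a range no larger than I makes ker Φ at least as large as ker π, so the given
inclusion is an equality. -/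
theorem ker_le_ker_of_finrank_le [Module.Finite ℂ M] (Φ : M →ₗ[QGrp L] T) (π : M →ₗ[QGrp L] I)
    (hπ : Function.Surjective π) (h : LinearMap.ker Φ ≤ LinearMap.ker π)
    (hd : Module.finrank ℂ (LinearMap.range Φ) ≤ Module.finrank ℂ I) :
    LinearMap.ker π ≤ LinearMap.ker Φ := by
  have h1 := (Φ.restrictScalars ℂ).finrank_range_add_finrank_ker
  have h2 := (π.restrictScalars ℂ).finrank_range_add_finrank_ker
  have h3 : Module.finrank ℂ (LinearMap.range (π.restrictScalars ℂ)) = Module.finrank ℂ I := by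
    have : LinearMap.range (π.restrictScalars ℂ) = ⊤ := LinearMap.range_eq_top.2 hπ
    rw [this, finrank_top]
  have h4 : Module.finrank ℂ (LinearMap.range (Φ.restrictScalars ℂ)) =
      Module.finrank ℂ (LinearMap.range Φ) := rfl
  have h5 : LinearMap.ker (Φ.restrictScalars ℂ) ≤ LinearMap.ker (π.restrictScalars ℂ) := h
  have h6 := Submodule.eq_of_le_of_finrank_le h5 (by omega)
  exact fun x hx => h6.ge hx

/-- The inclusion of kernels gives dim range Φ ≥ dim I ≥ dim T. Hence Φ is onto, the kernels
coincide, and T and I are the same quotient of M. -/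
theorem nonempty_equiv_of_finrank_le [Module.Finite ℂ M] [Module.Finite ℂ T]
    (Φ : M →ₗ[QGrp L] T) (π : M →ₗ[QGrp L] I)
    (hπ : Function.Surjective π) (h : LinearMap.ker Φ ≤ LinearMap.ker π)
    (hd : Module.finrank ℂ T ≤ Module.finrank ℂ I) : Nonempty (T ≃ₗ[QGrp L] I) := by
  have hr : Module.finrank ℂ (LinearMap.range Φ) ≤ Module.finrank ℂ T :=
    Submodule.finrank_le ((LinearMap.range Φ).restrictScalars ℂ)
  have hk := le_antisymm h (ker_le_ker_of_finrank_le Φ π hπ h (hr.trans hd))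
  have h1 := (Φ.restrictScalars ℂ).finrank_range_add_finrank_ker
  have h2 := (π.restrictScalars ℂ).finrank_range_add_finrank_ker
  have h3 : Module.finrank ℂ (LinearMap.range (π.restrictScalars ℂ)) = Module.finrank ℂ I := by
    have : LinearMap.range (π.restrictScalars ℂ) = ⊤ := LinearMap.range_eq_top.2 hπ
    rw [this, finrank_top]
  have h4 : LinearMap.ker (Φ.restrictScalars ℂ) = LinearMap.ker (π.restrictScalars ℂ) :=
    SetLike.ext fun x => SetLike.ext_iff.1 hk x
  rw [← h4] at h2
  have hsurj : Function.Surjective Φ := by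
    have := Submodule.eq_top_of_finrank_eq
      (le_antisymm (Submodule.finrank_le (LinearMap.range (Φ.restrictScalars ℂ))) (by omega))
    exact fun x => (SetLike.ext_iff.1 this x).2 trivial
  exact ⟨(Φ.quotKerEquivOfSurjective hsurj).symm ≪≫ₗ Submodule.quotEquivOfEq _ _ hk ≪≫ₗ
    π.quotKerEquivOfSurjective hπ⟩

end Counting

/-! ### Dimensions of the irreducible modules -/

section Dimensions

variable {L : IntermediateLattice}
  {V : Type} [AddCommGroup V] [Module ℂ V] [Module (QGrp L) V] [IsScalarTower ℂ (QGrp L) V]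

instance (lam : Weight) : Module.Finite ℂ (Verma L lam) :=
  (finrank_le_of_generator (isMaximal_vermaGen lam) exists_smul_vermaGen (words L _)
    fun n => Submodule.subset_span ⟨n, rfl⟩).1

instance (lam : Weight) : Module.Finite ℂ (Irr L lam) :=
  (finrank_le_of_generator (isMaximal_irrGen lam) exists_smul_irrGen (words L _)
    fun n => Submodule.subset_span ⟨n, rfl⟩).1

/-- A highest weight module that is not larger than the irreducible one is irreducible. -/
theorem IsMaximal.simple_of_finrank_le {lam : Weight} {v : V} (hv : IsMaximal L lam v)
    (hv0 : v ≠ 0)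
    (h : Module.finrank ℂ (LinearMap.range hv.lift) ≤ Module.finrank ℂ (Irr L lam)) :
    hv.Simple := by
  have := ker_le_ker_of_finrank_le hv.lift (vermaRad L lam).mkQ
    (Submodule.mkQ_surjective _) (by
      rw [Submodule.ker_mkQ]
      refine le_vermaRad ?_
      rwa [LinearMap.mem_ker, hv.lift_vermaGen]) h
  rwa [Submodule.ker_mkQ] at this

omit [IsScalarTower ℂ (QGrp L) V] in
theorem words_mem {v : V} {i j : Fin 2} (hij : i ≠ j) {W : Submodule ℂ V} (h0 : v ∈ W)
    (h1 : qF L i • v ∈ W) (h2 : qF L j • v ∈ W) (h3 : qF L i • qF L j • v ∈ W)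
    (h4 : qF L j • qF L i • v ∈ W) (h5 : qF L i • qF L j • qF L i • v ∈ W)
    (h6 : qF L j • qF L i • qF L j • v ∈ W) (h7 : qF L i • qF L j • qF L i • qF L j • v ∈ W)
    (n : Fin 8) : words L v n ∈ W := by
  have h7' := h7
  rw [qF_quartic_smul hij] at h7'
  fin_cases i <;> fin_cases j <;> first
    | exact absurd rfl hij
    | fin_cases n <;> assumption

-- Words ending in X_{-i} vanish on v, and so does the longest word, because the quartic relation
-- lets it end in X_{-i}.
omit [IsScalarTower ℂ (QGrp L) V] in
theorem words_mem_span_of_qF_eq_zero {v : V} {i j : Fin 2} (hij : i ≠ j) (h : qF L i • v = 0)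
    (n : Fin 8) : words L v n ∈ Submodule.span ℂ (Set.range
      ![v, qF L j • v, qF L i • qF L j • v, qF L j • qF L i • qF L j • v]) := by
  have hs (n : Fin 4) := Submodule.subset_span (R := ℂ)
    (Set.mem_range_self (f := ![v, qF L j • v, qF L i • qF L j • v,
      qF L j • qF L i • qF L j • v]) n)
  refine words_mem hij (hs 0) ?_ (hs 1) (hs 2) ?_ ?_ (hs 3) ?_ n
  · simp [h]
  · simp [h]
  · simp [h]
  · simp [qF_quartic_smul hij, h]

theorem finrank_irr_of_linearIndependent {lam : Weight} {d : ℕ} {w : Fin d → Irr L lam}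
    (hw : LinearIndependent ℂ w)
    (h : ∀ n, words L (irrGen L lam) n ∈ Submodule.span ℂ (Set.range w)) :
    Module.finrank ℂ (Irr L lam) = d := by
  refine le_antisymm (finrank_le_of_generator (isMaximal_irrGen lam) exists_smul_irrGen w h).2 ?_
  simpa using hw.fintype_card_le_finrank

/-- X_i X_{-i} v = br(λ(H_i)) v = 0, so X_{-i} v is maximal of lower weight. -/
theorem Irr.qF_smul_eq_zero {lam : Weight} {i : Fin 2} (h : br (lam i) = 0) :
    qF L i • irrGen L lam = 0 := by
  have hm := isMaximal_irrGen (L := L) lam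
  refine Irr.eq_zero_of_isMaximal (mu := lower lam (depth i)) ⟨?_, fun k => ?_⟩ ?_
  · rw [lower_depth]; exact qF_mem_wtSpace hm.mem i
  · by_cases hk : k = i
    · rw [hk, hm.qE_qF, h, zero_smul]
    · exact hm.qE_qF_ne (Ne.symm hk)
  · nth_rewrite 1 [← lower_zero lam]
    refine notBelow_lower ?_
    fin_cases i <;> simp [depth]

theorem mem_wtSpace_lower {lam : Weight} {p : ℕ × ℕ} {v : V} (hv : v ∈ wtSpace L V (lower lam p))
    (i : Fin 2) : qF L i • v ∈ wtSpace L V (lower lam (p + depth i)) := by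
  rw [← lower_lower, lower_depth]
  exact qF_mem_wtSpace hv i

/-- The irreducible module whose highest weight has `⟨lam + ρ, α_i⟩` odd, and no further
odd index. -/
theorem finrank_irr_of_br_eq_zero {lam : Weight} {i j : Fin 2} (hij : i ≠ j)
    (h : br (lam i) = 0) (h' : NonInt (lam j)) : Module.finrank ℂ (Irr L lam) = 4 := by
  have hm := isMaximal_irrGen (L := L) lam
  have hF := Irr.qF_smul_eq_zero (L := L) h
  refine finrank_irr_of_linearIndependent ?_ (words_mem_span_of_qF_eq_zero hij hF)
  have hm0 : irrGen L lam ∈ wtSpace L _ (lower lam 0) := by rw [lower_zero]; exact hm.mem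
  have n0 : irrGen L lam ≠ 0 := irrGen_ne_zero lam
  -- Raising each word to the preceding one multiplies by br(λ(H_j)), br(λ(H_i) + 1) and -br(λ(H_j)
  -- + 1) in turn, all nonzero.
  have n1 : qF L j • irrGen L lam ≠ 0 := fun h0 => by
    have := hm.qE_qF j
    rw [h0, smul_zero] at this
    exact smul_ne_zero h'.1 n0 this.symm
  have n2 : qF L i • qF L j • irrGen L lam ≠ 0 := fun h0 => by
    have := hm.qE_qF_qF hij
    rw [h0, smul_zero] at this
    exact smul_ne_zero (br_add_one_ne h) n1 this.symm
  have n3 : qF L j • qF L i • qF L j • irrGen L lam ≠ 0 := fun h0 => by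
    have := hm.qE_qF_qF_qF hij
    rw [h0, hF, smul_zero, smul_zero, smul_zero, add_zero, br_sub_one] at this
    exact smul_ne_zero (neg_ne_zero.2 h'.2) n2 this.symm
  have w1 := mem_wtSpace_lower hm0 j
  have w2 := mem_wtSpace_lower w1 i
  have w3 := mem_wtSpace_lower w2 j
  refine linearIndependent_of_mem_weightSpace (L := L)
    (lam := fun n => lower lam (![0, 0 + depth j, 0 + depth j + depth i,
      0 + depth j + depth i + depth j] n))
    ((lower_injective lam).comp ?_) (fun n => ?_) (fun n => ?_)
  · fin_cases i <;> fin_cases j <;> first | exact absurd rfl hij | (simp [depth]; decide)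
  · fin_cases n
    exacts [hm0.1, w1.1, w2.1, w3.1]
  · fin_cases n <;> assumption

/-- The irreducible module whose highest weight has `⟨lam + ρ, α_3⟩` odd, and no further
odd index. -/
theorem finrank_irr_of_br_add_eq_zero {lam : Weight} (h : br (lam 0 + lam 1 + 1) = 0)
    (h0 : NonInt (lam 0)) (h1 : NonInt (lam 1)) : Module.finrank ℂ (Irr L lam) = 4 := by
  have h01 : (0 : Fin 2) ≠ 1 := by decide
  have hm := isMaximal_irrGen (L := L) lam
  set v := irrGen L lam with hv
  have hm0 : v ∈ wtSpace L _ (lower lam 0) := by rw [lower_zero]; exact hm.mem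
  have n0 : v ≠ 0 := irrGen_ne_zero lam
  have n1 : qF L 0 • v ≠ 0 := fun e => by
    have := hm.qE_qF 0
    rw [e, smul_zero] at this
    exact smul_ne_zero h0.1 n0 this.symm
  have n2 : qF L 1 • v ≠ 0 := fun e => by
    have := hm.qE_qF 1
    rw [e, smul_zero] at this
    exact smul_ne_zero h1.1 n0 this.symm
  have n3 : qF L 0 • qF L 1 • v ≠ 0 := fun e => by
    have := hm.qE_qF_qF h01
    rw [e, smul_zero] at this
    exact smul_ne_zero h0.2 n2 this.symm
  have w1 := mem_wtSpace_lower hm0 0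
  have w2 := mem_wtSpace_lower hm0 1
  have w3 := mem_wtSpace_lower w2 0
  have w4 := mem_wtSpace_lower w1 1
  -- On the two words of weight λ - α_3 the raising operators have determinant br(λ(H_1) + λ(H_2) +
  -- 1) = 0. This combination spans their common kernel and is therefore zero in the irreducible
  -- module.
  have hrel : br (lam 0) • qF L 0 • qF L 1 • v - br (lam 0 + 1) • qF L 1 • qF L 0 • v = 0 := by
    have c (k : Fin 2) (z : ℂ) (x : Irr L lam) : qE L k • z • x = z • qE L k • x :=
      smul_comm _ _ _
    refine Irr.eq_zero_of_isMaximal (mu := lower lam (1, 1)) ⟨?_, fun k => ?_⟩ ?_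
    · exact Submodule.sub_mem _ (Submodule.smul_mem _ _ (by simpa [depth] using w3))
        (Submodule.smul_mem _ _ (by simpa [depth] using w4))
    · fin_cases k
      · simp only [Fin.zero_eta, smul_sub, c, hm.qE_qF_qF h01, hm.qE_qF_qF_ne h01.symm]
        rw [smul_smul, smul_smul, mul_comm, sub_self]
      · simp only [Fin.mk_one, smul_sub, c, hm.qE_qF_qF h01.symm, hm.qE_qF_qF_ne h01]
        have e := br_det (lam 0) (lam 1)
        rw [h] at e
        rw [smul_smul, smul_smul, ← sub_smul, ← neg_sub, ← e, neg_zero, zero_smul]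
    · nth_rewrite 1 [← lower_zero lam]
      exact notBelow_lower (by simp)
  have hrel' : qF L 1 • qF L 0 • v = ((br (lam 0 + 1))⁻¹ * br (lam 0)) • qF L 0 • qF L 1 • v := by
    rw [mul_smul, sub_eq_zero.1 hrel, inv_smul_smul₀ h0.2]
  have hrel'' : qF L 0 • qF L 1 • v = ((br (lam 0))⁻¹ * br (lam 0 + 1)) • qF L 1 • qF L 0 • v := by
    rw [mul_smul, ← sub_eq_zero.1 hrel, inv_smul_smul₀ h0.1]
  -- The two words of length two are proportional, so a third lowering operator can be made to meet
  -- its own square.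
  have z1 : qF L 1 • qF L 0 • qF L 1 • v = 0 := by
    rw [hrel'', smul_comm, qF_qF_smul, smul_zero]
  have z2 : qF L 0 • qF L 1 • qF L 0 • v = 0 := by
    rw [hrel', smul_comm, qF_qF_smul, smul_zero]
  refine finrank_irr_of_linearIndependent (w := ![v, qF L 0 • v, qF L 1 • v, qF L 0 • qF L 1 • v])
    ?_ (words_mem h01 (Submodule.subset_span ⟨0, rfl⟩) (Submodule.subset_span ⟨1, rfl⟩)
      (Submodule.subset_span ⟨2, rfl⟩) (Submodule.subset_span ⟨3, rfl⟩) ?_ ?_ ?_ ?_)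
  · refine linearIndependent_of_mem_weightSpace (L := L)
      (lam := fun n => lower lam (![0, 0 + depth 0, 0 + depth 1, 0 + depth 1 + depth 0] n))
      ((lower_injective lam).comp ?_) (fun n => ?_) (fun n => ?_)
    · simp [depth]; decide
    · fin_cases n
      exacts [hm0.1, w1.1, w2.1, w3.1]
    · fin_cases n <;> assumption
  · rw [hrel']
    exact Submodule.smul_mem _ _ (Submodule.subset_span ⟨3, rfl⟩)
  · simp [← hv, z2]
  · simp [← hv, z1]
  · simp [← hv, z1]

/-- The irreducible modules of dimension three. -/
theorem finrank_irr_le_three {lam : Weight} {i j : Fin 2} (hij : i ≠ j)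
    (h : br (lam i) = 0) (h' : br (lam j + 1) = 0) : Module.finrank ℂ (Irr L lam) ≤ 3 := by
  have hm := isMaximal_irrGen (L := L) lam
  have hF := Irr.qF_smul_eq_zero (L := L) h
  -- X_j multiplies the first term by br(λ(H_j) - 1) = -br(λ(H_j) + 1) = 0 and the second contains
  -- X_{-i} v = 0, so this word is maximal. The upper bound thus obtained is all that the later
  -- counts require.
  have hz : qF L j • qF L i • qF L j • irrGen L lam = 0 := by
    refine Irr.eq_zero_of_isMaximal (mu := lower lam (0 + depth j + depth i + depth j))
      ⟨?_, fun k => ?_⟩ ?_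
    · exact mem_wtSpace_lower (mem_wtSpace_lower (mem_wtSpace_lower
        (by rw [lower_zero]; exact hm.mem) j) i) j
    · obtain rfl | rfl : k = i ∨ k = j := by omega
      · exact hm.qE_qF_qF_qF_ne hij
      · rw [hm.qE_qF_qF_qF hij, hF, br_sub_one, h']
        simp
    · nth_rewrite 1 [← lower_zero lam]
      refine notBelow_lower ?_
      fin_cases i <;> fin_cases j <;> simp [depth]
  refine (finrank_le_of_generator hm exists_smul_irrGen
    ![irrGen L lam, qF L j • irrGen L lam, qF L i • qF L j • irrGen L lam]
    (words_mem hij (Submodule.subset_span ⟨0, rfl⟩) ?_ (Submodule.subset_span ⟨1, rfl⟩)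
    (Submodule.subset_span ⟨2, rfl⟩) ?_ ?_ ?_ ?_)).2 <;> simp [hF, hz]

theorem finrank_irr_eq_one {lam : Weight} (h0 : br (lam 0) = 0) (h1 : br (lam 1) = 0) :
    Module.finrank ℂ (Irr L lam) = 1 := by
  have hF0 := Irr.qF_smul_eq_zero (L := L) h0
  have hF1 := Irr.qF_smul_eq_zero (L := L) h1
  refine finrank_irr_of_linearIndependent (w := ![irrGen L lam]) ?_
    (words_mem (i := 0) (j := 1) (by decide) (Submodule.subset_span ⟨0, rfl⟩) ?_ ?_ ?_ ?_ ?_ ?_ ?_)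
  · rw [linearIndependent_unique_iff]
    exact irrGen_ne_zero lam
  all_goals simp [hF0, hF1]

/-- The condition for a weight to be typical, in terms of quantum integers. -/
structure Typ (lam : Weight) : Prop where
  zero : br (lam 0) ≠ 0
  one : br (lam 1) ≠ 0
  add : br (lam 0 + lam 1 + 1) ≠ 0

/-- The longest word is nonzero on v, since it can be raised back to a nonzero multiple of v. In a
linear relation, complementary words lift each word in turn to the longest one. -/
theorem Typ.linearIndependent_words {lam : Weight} (h : Typ lam) {v : V}
    (hv : IsMaximal L lam v) (hv0 : v ≠ 0) : LinearIndependent ℂ (words L v) := by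
  have h01 : (0 : Fin 2) ≠ 1 := by decide
  have htop : qF L 0 • qF L 1 • qF L 0 • qF L 1 • v ≠ 0 := fun e => by
    have := hv.qE_top_qF_top h01
    rw [e] at this
    simp only [smul_zero] at this
    exact smul_ne_zero (neg_ne_zero.2 (mul_ne_zero (mul_ne_zero h.zero h.one) h.add)) hv0 this.symm
  rw [Fintype.linearIndependent_iff]
  intro c hc
  have k (j : Fin 2) (z : ℂ) (x : V) : qF L j • z • x = z • qF L j • x := smul_comm _ _ _
  have q (x : V) := qF_quartic_smul (L := L) h01.symm x
  have hz (z : ℂ) (e : z • qF L 0 • qF L 1 • qF L 0 • qF L 1 • v = 0) : z = 0 :=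
    (smul_eq_zero.1 e).resolve_right htop
  simp only [Fin.sum_univ_eight, words, Matrix.cons_val] at hc
  -- Coefficients are eliminated in order of increasing word length; the lowering word applied each
  -- time kills every other word whose coefficient is not yet known to vanish.
  have c0 : c 0 = 0 := hz _ (by
    simpa only [smul_add, k, q, qF_qF_smul, smul_zero, add_zero, zero_add] using
      congrArg (fun x => qF L 0 • qF L 1 • qF L 0 • qF L 1 • x) hc)
  have c1 : c 1 = 0 := hz _ (by
    simpa only [smul_add, k, q, qF_qF_smul, smul_zero, add_zero, zero_add, c0, zero_smul] using
      congrArg (fun x => qF L 1 • qF L 0 • qF L 1 • x) hc)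
  have c2 : c 2 = 0 := hz _ (by
    simpa only [smul_add, k, q, qF_qF_smul, smul_zero, add_zero, zero_add, c0, c1, zero_smul] using
      congrArg (fun x => qF L 0 • qF L 1 • qF L 0 • x) hc)
  have c3 : c 3 = 0 := hz _ (by
    simpa only [smul_add, k, q, qF_qF_smul, smul_zero, add_zero, zero_add, c0, c1, c2,
      zero_smul] using congrArg (fun x => qF L 0 • qF L 1 • x) hc)
  have c4 : c 4 = 0 := hz _ (by
    simpa only [smul_add, k, q, qF_qF_smul, smul_zero, add_zero, zero_add, c0, c1, c2, c3,
      zero_smul] using congrArg (fun x => qF L 1 • qF L 0 • x) hc)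
  have c5 : c 5 = 0 := hz _ (by
    simpa only [smul_add, k, q, qF_qF_smul, smul_zero, add_zero, zero_add, c0, c1, c2, c3, c4,
      zero_smul] using congrArg (fun x => qF L 1 • x) hc)
  have c6 : c 6 = 0 := hz _ (by
    simpa only [smul_add, k, q, qF_qF_smul, smul_zero, add_zero, zero_add, c0, c1, c2, c3, c4, c5,
      zero_smul] using congrArg (fun x => qF L 0 • x) hc)
  have c7 : c 7 = 0 := hz _ (by
    simpa only [zero_add, c0, c1, c2, c3, c4, c5, c6, zero_smul] using hc)
  intro n
  fin_cases n <;> assumption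

theorem Typ.finrank_irr {lam : Weight} (h : Typ lam) : Module.finrank ℂ (Irr L lam) = 8 :=
  finrank_irr_of_linearIndependent
    (h.linearIndependent_words (isMaximal_irrGen lam) (irrGen_ne_zero lam))
    fun n => Submodule.subset_span ⟨n, rfl⟩

theorem Typ.simple {lam : Weight} (h : Typ lam) {v : V} (hv : IsMaximal L lam v) (hv0 : v ≠ 0) :
    hv.Simple := by
  refine hv.simple_of_finrank_le hv0 ?_
  rw [h.finrank_irr]
  exact (finrank_range_lift_le hv (words L v) fun n => Submodule.subset_span ⟨n, rfl⟩).2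

/-- The radical of the Verma module itself is zero, so no condition on v is needed. This matters for
projectivity, where the lifted vector may be zero. -/
theorem Typ.simple' {lam : Weight} (h : Typ lam) {v : V} (hv : IsMaximal L lam v) :
    hv.Simple := by
  intro x hx
  have := h.simple (isMaximal_vermaGen (L := L) lam) (vermaGen_ne_zero lam) hx
  obtain ⟨u, rfl⟩ := exists_smul_vermaGen x
  rw [LinearMap.mem_ker, IsMaximal.lift_smul_vermaGen] at this
  rw [this]
  exact Submodule.zero_mem _

end Dimensions

/-! ### Projectivity of typical irreducible modules -/

section Projective

variable {L : IntermediateLattice}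
  {V : Type} [AddCommGroup V] [Module ℂ V] [Module (QGrp L) V] [IsScalarTower ℂ (QGrp L) V]

/-- The map from the irreducible module given by a maximal vector. -/
def IsMaximal.Simple.lift {lam : Weight} {v : V} {hv : IsMaximal L lam v} (hs : hv.Simple) :
    Irr L lam →ₗ[QGrp L] V :=
  (vermaRad L lam).liftQ hv.lift hs

theorem IsMaximal.Simple.lift_smul {lam : Weight} {v : V} {hv : IsMaximal L lam v}
    (hs : hv.Simple) (u : QGrp L) : hs.lift (u • irrGen L lam) = u • v :=
  hv.lift_smul_vermaGen u

variable (L) in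
/-- The irreducible module as an object of the category. -/
def irrModule (lam : Weight) : WeightModule L where
  carrier := Irr L lam
  finite := inferInstance
  iSup_weightSpace := by
    rw [eq_top_iff]
    intro x _
    obtain ⟨u, rfl⟩ := exists_smul_irrGen x
    have hm := isMaximal_irrGen (L := L) lam
    refine Submodule.span_le.2 ?_ (hm.smul_mem_span u)
    rintro _ ⟨n, rfl⟩
    exact Submodule.mem_iSup_of_mem _ (words_mem_wtSpace hm.mem n).1
  qK_smul := by
    intro γ mu v hv
    have hm := isMaximal_irrGen (L := L) lam
    obtain ⟨u, hu⟩ := exists_smul_irrGen v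
    -- Words carry the right action of K_γ, and v is a combination of words; the part of weight
    -- other than μ vanishes by independence.
    have key : v ∈ wtSpace L (Irr L lam) mu ⊔ otherWeights L (Irr L lam) mu := by
      refine Submodule.span_le.2 ?_ (hu ▸ hm.smul_mem_span u)
      rintro _ ⟨n, rfl⟩
      have hn := words_mem_wtSpace hm.mem n
      by_cases h : lower lam (wordDepth n) = mu
      · exact Submodule.mem_sup_left (h ▸ hn)
      · exact Submodule.mem_sup_right (weightSpace_le_otherWeights h hn.1)
    obtain ⟨a, ha, b, hb, rfl⟩ := Submodule.mem_sup.1 key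
    have hb0 : b = 0 := by
      refine eq_zero_of_mem_otherWeights (L := L) ?_ hb
      simpa using Submodule.sub_mem _ hv (wtSpace_le_weightSpace _ ha)
    rw [hb0, add_zero]
    exact ha.2 γ

theorem WeightModule.mem_wtSpace (V : WeightModule L) {lam : Weight} {v : V}
    (hv : v ∈ weightSpace L V lam) : v ∈ wtSpace L V lam :=
  ⟨hv, fun γ => V.qK_smul γ lam v hv⟩

/-- Take the component of weight λ of any preimage; the remaining components map to other weights
and must cancel. -/
theorem exists_weight_preimage {V W : WeightModule L} (f : V →ₗ[QGrp L] W)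
    (hf : Function.Surjective f) {lam : Weight} {w : W} (hw : w ∈ weightSpace L W lam) :
    ∃ v ∈ weightSpace L V lam, f v = w := by
  obtain ⟨x, rfl⟩ := hf w
  have key : x ∈ weightSpace L V lam ⊔ otherWeights L V lam := by
    have hx : x ∈ ⨆ mu, weightSpace L V mu := V.iSup_weightSpace ▸ Submodule.mem_top
    suffices h : ⨆ mu, weightSpace L V mu ≤ weightSpace L V lam ⊔ otherWeights L V lam from h hx
    refine iSup_le fun mu => ?_
    by_cases h : mu = lam
    · exact h ▸ le_sup_left
    · exact (weightSpace_le_otherWeights h).trans le_sup_right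
  obtain ⟨a, ha, b, hb, rfl⟩ := Submodule.mem_sup.1 key
  have hb' : f b ∈ otherWeights L W lam := by
    have : otherWeights L V lam ≤ (otherWeights L W lam).comap (f.restrictScalars ℂ) :=
      iSup₂_le fun mu hmu v hv =>
        weightSpace_le_otherWeights hmu (map_mem_weightSpace hv f)
    exact this hb
  refine ⟨a, ha, ?_⟩
  rw [map_add] at hw ⊢
  have := eq_zero_of_mem_otherWeights (L := L)
    (by simpa using Submodule.sub_mem _ hw (map_mem_weightSpace ha f)) hb'
  rw [this, add_zero]

/-- The product of the longest raising and longest lowering words turns any weight vector into a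
maximal one, and acts on maximal vectors of weight λ by the nonzero scalar `c`. -/
theorem Typ.isProjectiveIn {lam : Weight} (h : Typ lam) :
    IsProjectiveIn L (irrModule L lam) := by
  intro V W f g hf
  change Irr L lam →ₗ[QGrp L] W at g
  change ∃ h : Irr L lam →ₗ[QGrp L] V, f ∘ₗ h = g
  have h01 : (0 : Fin 2) ≠ 1 := by decide
  have hw : IsMaximal L lam (g (irrGen L lam)) := (isMaximal_irrGen lam).map g
  obtain ⟨x, hx, hfx⟩ := exists_weight_preimage f hf hw.mem.1
  have hx := V.mem_wtSpace hx
  set c : ℂ := -(br (lam 0) * br (lam 1) * br (lam 0 + lam 1 + 1)) with hc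
  have hc0 : c ≠ 0 := neg_ne_zero.2 (mul_ne_zero (mul_ne_zero h.zero h.one) h.add)
  have htop := hw.qE_top_qF_top h01
  have hy : IsMaximal L lam (c⁻¹ • qE L 1 • qE L 0 • qE L 1 • qE L 0 •
      qF L 0 • qF L 1 • qF L 0 • qF L 1 • x) := by
    refine IsMaximal.smul ⟨?_, fun k => ?_⟩ _
    · have := qE_mem_wtSpace (qE_mem_wtSpace (qE_mem_wtSpace (qE_mem_wtSpace
        (qF_mem_wtSpace (qF_mem_wtSpace (qF_mem_wtSpace (qF_mem_wtSpace hx 1) 0) 1) 0)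
        0) 1) 0) 1
      convert this using 2
      abel
    -- The quartic relation lets the longest raising word begin with either X_1 or X_2, so both
    -- annihilate it.
    · fin_cases k
      · exact (congrArg _ (qE_quartic_smul h01.symm _)).trans (qE_qE_smul _ _)
      · exact qE_qE_smul _ _
  refine ⟨(h.simple' hy).lift, LinearMap.ext fun z => ?_⟩
  obtain ⟨u, rfl⟩ := exists_smul_irrGen z
  rw [LinearMap.comp_apply]
  refine (congrArg f ((h.simple' hy).lift_smul u)).trans ?_
  rw [map_smul]
  refine Eq.trans ?_ (map_smul g u _).symm
  rw [LinearMap.map_smul_of_tower]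
  simp only [map_smul, hfx]
  rw [htop, smul_smul, inv_mul_cancel₀ hc0, one_smul]

theorem Typ.isProjectiveCover {lam : Weight} (h : Typ lam) :
    IsProjectiveCover L lam (irrModule L lam) := by
  refine ⟨h.isProjectiveIn, (LinearMap.id : Irr L lam →ₗ[QGrp L] Irr L lam),
    fun x => ⟨x, rfl⟩, fun N hN => ?_⟩
  change Submodule (QGrp L) (Irr L lam) at N
  change N ⊔ LinearMap.ker (LinearMap.id : Irr L lam →ₗ[QGrp L] Irr L lam) = ⊤ at hN
  rwa [LinearMap.ker_id, sup_bot_eq] at hN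

end Projective

/-! ### Decomposition by maximal vectors -/

section Decomposition

variable {L : IntermediateLattice}
  {V : Type} [AddCommGroup V] [Module ℂ V] [Module (QGrp L) V] [IsScalarTower ℂ (QGrp L) V]

theorem IsMaximal.mem_vermaRad {lam : Weight} {v : V} (hv : IsMaximal L lam v)
    {N : Submodule (QGrp L) V} (h : v ∉ N) {x : Verma L lam} (hx : hv.lift x ∈ N) :
    x ∈ vermaRad L lam := by
  refine le_vermaRad (N := N.comap hv.lift) ?_ hx
  rwa [Submodule.mem_comap, hv.lift_vermaGen]

theorem IsMaximal.eq_zero_of_notBelow {lam mu : Weight} {v w : V} (hv : IsMaximal L lam v)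
    (hw : IsMaximal L mu w) (h : NotBelow mu lam) (hx : w ∈ LinearMap.range hv.lift) : w = 0 :=
  eq_zero_of_mem_otherWeights (wtSpace_le_weightSpace _ hw.mem) (hv.mem_otherWeights h hx)

/-- Maximal vectors decompose along a direct sum of submodules. -/
theorem IsMaximal.exists_add {lam : Weight} {t : V} (ht : IsMaximal L lam t)
    {N N' : Submodule (QGrp L) V} (hN : ∀ x, x ∈ N → x ∈ N' → x = 0) (h : t ∈ N ⊔ N') :
    ∃ x ∈ N, ∃ y ∈ N', x + y = t ∧ IsMaximal L lam x ∧ IsMaximal L lam y := by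
  obtain ⟨x, hx, y, hy, rfl⟩ := Submodule.mem_sup.1 h
  have key (u : QGrp L) (c : ℂ) (hu : u • (x + y) = c • (x + y)) :
      u • x = c • x ∧ u • y = c • y := by
    have hsum : (u • x - c • x) + (u • y - c • y) = 0 := by
      rw [smul_add, smul_add] at hu
      rw [sub_add_sub_comm, hu, sub_self]
    have hx' : u • x - c • x ∈ N := N.sub_mem (N.smul_mem u hx) (N.smul_of_tower_mem c hx)
    have hy' : u • y - c • y ∈ N' := N'.sub_mem (N'.smul_mem u hy) (N'.smul_of_tower_mem c hy)
    have h0 : u • x - c • x = 0 :=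
      hN _ hx' (eq_neg_of_add_eq_zero_left hsum ▸ N'.neg_mem hy')
    rw [h0, zero_add] at hsum
    exact ⟨sub_eq_zero.1 h0, sub_eq_zero.1 hsum⟩
  have hE (j : Fin 2) := key (qE L j) 0 (by rw [ht.qE_smul, zero_smul])
  have hH (j : Fin 2) := key _ _ (ht.mem.1 j)
  have hK (γ : L.lattice) := key _ _ (ht.mem.2 γ)
  simp only [zero_smul] at hE
  exact ⟨x, hx, y, hy, rfl, ⟨⟨fun j => (hH j).1, fun γ => (hK γ).1⟩, fun j => (hE j).1⟩,
    ⟨⟨fun j => (hH j).2, fun γ => (hK γ).2⟩, fun j => (hE j).2⟩⟩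

/-- Neither vector lies in the submodule generated by the other: s₁ for reasons of weight, s₂
because the simple module generated by s₁ has no other maximal vectors. Hence both components of an
element of the kernel lie in the radicals. -/
theorem nonempty_equiv_prod [Module.Finite ℂ V] {κ₁ κ₂ : Weight} {s₁ s₂ : V}
    (h₁ : IsMaximal L κ₁ s₁) (h₂ : IsMaximal L κ₂ s₂) (n₁ : s₁ ≠ 0) (n₂ : s₂ ≠ 0)
    (hs : h₁.Simple) (hκ : NotBelow κ₁ κ₂)
    (hd : Module.finrank ℂ V ≤ Module.finrank ℂ (Irr L κ₁) + Module.finrank ℂ (Irr L κ₂)) :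
    Nonempty (V ≃ₗ[QGrp L] Irr L κ₁ × Irr L κ₂) := by
  have m₁ : s₁ ∉ LinearMap.range h₂.lift := h₁.notMem_range_lift h₂ n₁ hκ
  have m₂ : s₂ ∉ LinearMap.range h₁.lift := fun h => n₂ (hs.eq_zero h₂ hκ h)
  refine nonempty_equiv_of_finrank_le (h₁.lift.coprod h₂.lift)
    ((vermaRad L κ₁).mkQ.prodMap (vermaRad L κ₂).mkQ)
    ((Submodule.mkQ_surjective _).prodMap (Submodule.mkQ_surjective _)) ?_
    (by rwa [Module.finrank_prod])
  rintro ⟨x, y⟩ hxy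
  rw [LinearMap.mem_ker, LinearMap.coprod_apply] at hxy
  refine Prod.ext ?_ ?_
  · refine (Submodule.Quotient.mk_eq_zero _).2 (h₁.mem_vermaRad m₁ ?_)
    change h₁.lift x ∈ _
    rw [eq_neg_of_add_eq_zero_left (hxy : h₁.lift x + h₂.lift y = 0)]
    exact Submodule.neg_mem _ ⟨y, rfl⟩
  · refine (Submodule.Quotient.mk_eq_zero _).2 (h₂.mem_vermaRad m₂ ?_)
    change h₂.lift y ∈ _
    rw [eq_neg_of_add_eq_zero_right (hxy : h₁.lift x + h₂.lift y = 0)]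
    exact Submodule.neg_mem _ ⟨x, rfl⟩

/-- The submodule of s₁ is simple and meets each of the others trivially, so a maximal vector in
such a sum splits into maximal components. These vanish by simplicity or by comparison of weights.
For s₃ against s₂ either reason may serve, whence the disjunction. -/
theorem nonempty_equiv_prod_prod [Module.Finite ℂ V] {κ₁ κ₂ κ₃ : Weight} {s₁ s₂ s₃ : V}
    (h₁ : IsMaximal L κ₁ s₁) (h₂ : IsMaximal L κ₂ s₂) (h₃ : IsMaximal L κ₃ s₃)
    (n₁ : s₁ ≠ 0) (n₂ : s₂ ≠ 0) (n₃ : s₃ ≠ 0) (hs : h₁.Simple)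
    (hκ₁₂ : NotBelow κ₁ κ₂) (hκ₁₃ : NotBelow κ₁ κ₃) (hκ₂₃ : NotBelow κ₂ κ₃)
    (hκ₃₂ : NotBelow κ₃ κ₂ ∨ h₂.Simple)
    (hd : Module.finrank ℂ V ≤ Module.finrank ℂ (Irr L κ₁) + (Module.finrank ℂ (Irr L κ₂) +
      Module.finrank ℂ (Irr L κ₃))) :
    Nonempty (V ≃ₗ[QGrp L] Irr L κ₁ × Irr L κ₂ × Irr L κ₃) := by
  have m₁ : s₁ ∉ LinearMap.range h₂.lift ⊔ LinearMap.range h₃.lift := by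
    intro h
    obtain ⟨x, hx, y, hy, hxy⟩ := Submodule.mem_sup.1 h
    refine n₁ (eq_zero_of_mem_otherWeights (wtSpace_le_weightSpace _ h₁.mem) ?_)
    rw [← hxy]
    exact Submodule.add_mem _ (h₂.mem_otherWeights hκ₁₂ hx) (h₃.mem_otherWeights hκ₁₃ hy)
  have m₂ : s₂ ∉ LinearMap.range h₁.lift ⊔ LinearMap.range h₃.lift := by
    intro h
    obtain ⟨x, hx, y, hy, rfl, mx, my⟩ := h₂.exists_add
      (fun z hz hz' => hs.disjoint (h₁.notMem_range_lift h₃ n₁ hκ₁₃) hz hz') h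
    rw [hs.eq_zero mx hκ₁₂ hx, h₃.eq_zero_of_notBelow my hκ₂₃ hy, add_zero] at n₂
    exact n₂ rfl
  have m₃ : s₃ ∉ LinearMap.range h₁.lift ⊔ LinearMap.range h₂.lift := by
    intro h
    obtain ⟨x, hx, y, hy, rfl, mx, my⟩ := h₃.exists_add
      (fun z hz hz' => hs.disjoint (h₁.notMem_range_lift h₂ n₁ hκ₁₂) hz hz') h
    have hy0 : y = 0 := hκ₃₂.elim (fun h => h₂.eq_zero_of_notBelow my h hy)
      fun h => h.eq_zero my hκ₂₃ hy
    rw [hs.eq_zero mx hκ₁₃ hx, hy0, add_zero] at n₃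
    exact n₃ rfl
  refine nonempty_equiv_of_finrank_le (h₁.lift.coprod (h₂.lift.coprod h₃.lift))
    ((vermaRad L κ₁).mkQ.prodMap ((vermaRad L κ₂).mkQ.prodMap (vermaRad L κ₃).mkQ))
    ((Submodule.mkQ_surjective _).prodMap
      ((Submodule.mkQ_surjective _).prodMap (Submodule.mkQ_surjective _))) ?_
    (by rwa [Module.finrank_prod, Module.finrank_prod])
  rintro ⟨x, y, z⟩ h
  rw [LinearMap.mem_ker, LinearMap.coprod_apply, LinearMap.coprod_apply] at h
  change h₁.lift x + (h₂.lift y + h₃.lift z) = 0 at h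
  refine Prod.ext ?_ (Prod.ext ?_ ?_)
  · refine (Submodule.Quotient.mk_eq_zero _).2 (h₁.mem_vermaRad m₁ ?_)
    change h₁.lift x ∈ _
    rw [eq_neg_of_add_eq_zero_left h]
    exact Submodule.neg_mem _ (Submodule.add_mem_sup ⟨y, rfl⟩ ⟨z, rfl⟩)
  · refine (Submodule.Quotient.mk_eq_zero _).2 (h₂.mem_vermaRad m₂ ?_)
    change h₂.lift y ∈ _
    rw [add_left_comm] at h
    rw [eq_neg_of_add_eq_zero_left h]
    exact Submodule.neg_mem _ (Submodule.add_mem_sup ⟨x, rfl⟩ ⟨z, rfl⟩)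
  · refine (Submodule.Quotient.mk_eq_zero _).2 (h₃.mem_vermaRad m₃ ?_)
    change h₃.lift z ∈ _
    rw [← add_assoc] at h
    rw [eq_neg_of_add_eq_zero_right h]
    exact Submodule.neg_mem _ (Submodule.add_mem_sup ⟨x, rfl⟩ ⟨y, rfl⟩)

end Decomposition

/-! ### Maximal vectors in tensor products -/

section PureTensors

variable {L : IntermediateLattice} {V : Type} [AddCommGroup V] [Module ℂ V]
  {W : Type} [AddCommGroup W] [Module ℂ W]

variable (L) in
/-- A pure tensor. -/
def pureTensor (x : V) (y : W) : TensorMod L V W := x ⊗ₜ[ℂ] y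

theorem pureTensor_smul_left (c : ℂ) (x : V) (y : W) :
    pureTensor L (c • x) y = c • pureTensor L x y := rfl

theorem pureTensor_smul_right (c : ℂ) (x : V) (y : W) :
    pureTensor L x (c • y) = c • pureTensor L x y :=
  TensorProduct.tmul_smul c x y

theorem pureTensor_zero_left (y : W) : pureTensor L (0 : V) y = 0 := TensorProduct.zero_tmul V y

theorem pureTensor_zero_right (x : V) : pureTensor L x (0 : W) = 0 := TensorProduct.tmul_zero W x

theorem pureTensor_ne_zero {v : V} {w : W} (hv : v ≠ 0) (hw : w ≠ 0) : pureTensor L v w ≠ 0 :=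
  tmul_ne_zero hv hw

/-- A linear form that separates a weight vector from the other weight spaces. -/
theorem exists_contraction [Module (QGrp L) V] [IsScalarTower ℂ (QGrp L) V]
    {lam : Weight} {p : ℕ × ℕ} {x : V} (hx : x ∈ wtSpace L V (lower lam p))
    (hx0 : x ≠ 0) : ∃ f : TensorMod L V W →ₗ[ℂ] W,
      (∃ c : ℂ, c ≠ 0 ∧ ∀ y, f (pureTensor L x y) = c • y) ∧
      ∀ q ≠ p, ∀ x' ∈ wtSpace L V (lower lam q), ∀ y, f (pureTensor L x' y) = 0 := by
  obtain ⟨φ, hφ, hφ'⟩ := Submodule.exists_le_ker_of_notMem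
    (p := otherWeights L V (lower lam p)) (v := x)
    fun h => hx0 (eq_zero_of_mem_otherWeights hx.1 h)
  refine ⟨contractLeft φ, ⟨φ x, hφ, fun y => contractLeft_tmul φ x y⟩, fun q hq x' hx' y => ?_⟩
  have h0 : φ x' = 0 := hφ' (weightSpace_le_otherWeights
    (fun h => hq (lower_injective lam h)) hx'.1)
  exact (contractLeft_tmul φ x' y).trans (by rw [h0, zero_smul])

end PureTensors

/-! ### Explicit maximal vectors in a tensor product -/

section TensorProducts

variable {L : IntermediateLattice}
  {V : Type} [AddCommGroup V] [Module ℂ V] [Module (QGrp L) V] [IsScalarTower ℂ (QGrp L) V]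
  {W : Type} [AddCommGroup W] [Module ℂ W] [Module (QGrp L) W] [IsScalarTower ℂ (QGrp L) W]

theorem qE_smul_pureTensor {mu : Weight} (j : Fin 2) (x : V) {y : W} (hy : y ∈ wtSpace L W mu) :
    qE L j • pureTensor L x y =
      iPow (mu j) • pureTensor L (qE L j • x) y + pureTensor L x (qE L j • y) := by
  refine (tensorAction_qE L V W j x y).trans ?_
  rw [qK_simpleRoot_smul hy, TensorProduct.tmul_smul]
  rfl

theorem pureTensor_mem_wtSpace {lam mu : Weight} {x : V} {y : W} (hx : x ∈ wtSpace L V lam)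
    (hy : y ∈ wtSpace L W mu) : pureTensor L x y ∈ wtSpace L (TensorMod L V W) (lam + mu) := by
  refine ⟨fun j => ?_, fun γ => ?_⟩
  · change tensorAction L V W (qH L j) (x ⊗ₜ y) = (lam j + mu j) • (x ⊗ₜ[ℂ] y)
    simp only [tensorAction, AlgHom.comp_apply, comul_gen, comulGen, map_add,
      Algebra.TensorProduct.map_tmul, Module.endTensorEndAlgHom_apply, map_one,
      LinearMap.add_apply, TensorProduct.AlgebraTensorModule.map_tmul, Algebra.lsmul_coe,
      Module.End.one_apply, hx.1 j, hy.1 j, TensorProduct.tmul_smul]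
    rw [← TensorProduct.smul_tmul', add_smul, add_comm]
  · change tensorAction L V W (qK L γ) (x ⊗ₜ y) = iPow (form γ (lam + mu)) • (x ⊗ₜ[ℂ] y)
    simp only [tensorAction, AlgHom.comp_apply, comul_gen, comulGen,
      Algebra.TensorProduct.map_tmul, Module.endTensorEndAlgHom_apply,
      TensorProduct.AlgebraTensorModule.map_tmul, Algebra.lsmul_coe, hx.2 γ, hy.2 γ,
      TensorProduct.tmul_smul]
    rw [← TensorProduct.smul_tmul', smul_smul, form_add_right, iPow_add, mul_comm]

theorem lower_add_lower (lam mu : Weight) (p q : ℕ × ℕ) :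
    lower lam p + lower mu q = lower (lam + mu) (p + q) := by
  simp only [lower, Prod.fst_add, Prod.snd_add, Nat.cast_add]
  module

variable {lam mu : Weight} {v : V} {w : W}

theorem IsMaximal.pureTensor (hv : IsMaximal L lam v) (hw : IsMaximal L mu w) :
    IsMaximal L (lam + mu) (pureTensor L v w) := by
  refine ⟨pureTensor_mem_wtSpace hv.mem hw.mem, fun j => ?_⟩
  rw [qE_smul_pureTensor j v hw.mem, hv.qE_smul, hw.qE_smul, pureTensor_zero_left,
    pureTensor_zero_right, smul_zero, add_zero]

theorem IsMaximal.qF_ne_zero (hv : IsMaximal L lam v) (hv0 : v ≠ 0) {k : Fin 2}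
    (h : br (lam k) ≠ 0) : qF L k • v ≠ 0 := fun h0 => by
  have := hv.qE_qF k
  rw [h0, smul_zero] at this
  exact smul_ne_zero h hv0 this.symm

theorem IsMaximal.qF_qF_ne_zero (hv : IsMaximal L lam v) (hv0 : v ≠ 0) {i j : Fin 2} (hij : i ≠ j)
    (h : br (lam j) ≠ 0) (h' : br (lam i + 1) ≠ 0) : qF L i • qF L j • v ≠ 0 := fun h0 => by
  have := hv.qE_qF_qF hij
  rw [h0, smul_zero] at this
  exact smul_ne_zero h' (hv.qF_ne_zero hv0 h) this.symm

variable (hv : IsMaximal L lam v) (hw : IsMaximal L mu w) (hv0 : v ≠ 0) (hw0 : w ≠ 0)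

include hv hw hv0 hw0

/-- The maximal vector of weight `lam + mu - α_k`. -/
theorem exists_maximal_simpleRoot {k : Fin 2} (hk : br (lam k) ≠ 0) (hk' : br (mu k) ≠ 0) :
    ∃ s : TensorMod L V W, s ≠ 0 ∧ IsMaximal L (lower (lam + mu) (depth k)) s := by
  have hvm : v ∈ wtSpace L V (lower lam 0) := by rw [lower_zero]; exact hv.mem
  have hwm : w ∈ wtSpace L W (lower mu 0) := by rw [lower_zero]; exact hw.mem
  have hFv := mem_wtSpace_lower hvm k
  have hFw := mem_wtSpace_lower hwm k
  have c (j : Fin 2) (z : ℂ) (x : TensorMod L V W) : qE L j • z • x = z • qE L j • x :=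
    smul_comm _ _ _
  -- X_k sends v ⊗ X_{-k} w to br(μ(H_k)) v ⊗ w, and X_{-k} v ⊗ w to i^{μ(H_k)} br(λ(H_k)) v ⊗ w;
  -- the coefficients cancel these.
  refine ⟨(br (lam k) * iPow (mu k)) • pureTensor L v (qF L k • w) -
    br (mu k) • pureTensor L (qF L k • v) w, fun h0 => ?_, ⟨?_, fun j => ?_⟩⟩
  · obtain ⟨f, ⟨c, hc, hf⟩, hf'⟩ := exists_contraction (W := W) hvm hv0
    have := congrArg f h0
    rw [map_sub, map_smul, map_smul, hf, hf' _ (by fin_cases k <;> simp [depth]) _ hFv, map_zero,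
      smul_zero, sub_zero] at this
    exact smul_ne_zero (mul_ne_zero hk (iPow_ne_zero _)) (smul_ne_zero hc (hw.qF_ne_zero hw0 hk'))
      this
  · have h1 := pureTensor_mem_wtSpace hvm hFw
    have h2 := pureTensor_mem_wtSpace hFv hwm
    rw [lower_add_lower] at h1 h2
    simp only [zero_add, add_zero] at h1 h2
    exact Submodule.sub_mem _ (Submodule.smul_mem _ _ h1) (Submodule.smul_mem _ _ h2)
  · rw [smul_sub, c, c, qE_smul_pureTensor j _ hFw, qE_smul_pureTensor j _ hw.mem, hv.qE_smul,
      hw.qE_smul]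
    by_cases hj : j = k
    · rw [hj, hv.qE_qF, hw.qE_qF]
      simp only [pureTensor_zero_left, pureTensor_zero_right, smul_zero, pureTensor_smul_left,
        pureTensor_smul_right]
      module
    · rw [hv.qE_qF_ne (Ne.symm hj), hw.qE_qF_ne (Ne.symm hj)]
      simp only [pureTensor_zero_left, pureTensor_zero_right, smul_zero, add_zero, sub_zero]

/-- The maximal vector of weight `lam + mu - α_1 - α_2`. -/
theorem exists_maximal_highestRoot {i j : Fin 2} (hij : i ≠ j) (hi : qF L i • v = 0)
    (hi' : br (lam i) = 0) (hj : qF L j • w = 0) (hj' : br (mu j) = 0)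
    (h : br (lam j) ≠ 0) (h' : br (mu i) ≠ 0) :
    ∃ s : TensorMod L V W, s ≠ 0 ∧ IsMaximal L (lower (lam + mu) (1, 1)) s := by
  have hvm : v ∈ wtSpace L V (lower lam 0) := by rw [lower_zero]; exact hv.mem
  have hwm : w ∈ wtSpace L W (lower mu 0) := by rw [lower_zero]; exact hw.mem
  have hFv := mem_wtSpace_lower hvm j
  have hFw := mem_wtSpace_lower hwm i
  have hFFv := mem_wtSpace_lower hFv i
  have hFFw := mem_wtSpace_lower hFw j
  have c (j : Fin 2) (z : ℂ) (x : TensorMod L V W) : qE L j • z • x = z • qE L j • x :=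
    smul_comm _ _ _
  have hl : br (lam i + 1) ≠ 0 := br_add_one_ne hi'
  have hm : br (mu j + 1) ≠ 0 := br_add_one_ne hj'
  have hFwj : lower mu (0 + depth i) j = mu j + 1 := by
    rw [zero_add, lower_depth, Pi.sub_apply, simpleRoot_ne hij, sub_neg_eq_add]
  -- X_j maps the first two tensors to multiples of v ⊗ X_{-i} w and kills the third; X_i maps the
  -- first and third to multiples of X_{-j} v ⊗ w and kills the second. Each coefficient solves one
  -- of these equations. The weight of the left factor separates the first tensor, which is nonzero.
  refine ⟨pureTensor L (qF L j • v) (qF L i • w) -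
    (br (lam j) * iPow (mu j + 1) * (br (mu j + 1))⁻¹) •
      pureTensor L v (qF L j • qF L i • w) -
    (br (mu i) * (br (lam i + 1))⁻¹ * (iPow (mu i))⁻¹) •
      pureTensor L (qF L i • qF L j • v) w, fun h0 => ?_, ⟨?_, fun k => ?_⟩⟩
  · obtain ⟨f, ⟨c, hc, hf⟩, hf'⟩ := exists_contraction (W := W) hFv (hv.qF_ne_zero hv0 h)
    have := congrArg f h0
    rw [map_sub, map_sub, map_smul, map_smul, hf,
      hf' 0 (by fin_cases j <;> simp [depth, Prod.ext_iff]) _ hvm,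
      hf' _ (by fin_cases i <;> simp [depth]) _ hFFv, map_zero, smul_zero, smul_zero,
      sub_zero, sub_zero] at this
    exact smul_ne_zero hc (hw.qF_ne_zero hw0 h') this
  · have h1 := pureTensor_mem_wtSpace hFv hFw
    have h2 := pureTensor_mem_wtSpace hvm hFFw
    have h3 := pureTensor_mem_wtSpace hFFv hwm
    rw [lower_add_lower] at h1 h2 h3
    have e1 : 0 + depth j + (0 + depth i) = (1, 1) := by
      fin_cases i <;> fin_cases j <;> simp [depth] at hij ⊢
    have e2 : 0 + (0 + depth i + depth j) = (1, 1) := by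
      fin_cases i <;> fin_cases j <;> simp [depth] at hij ⊢
    have e3 : 0 + depth j + depth i + 0 = (1, 1) := by
      fin_cases i <;> fin_cases j <;> simp [depth] at hij ⊢
    rw [e1] at h1
    rw [e2] at h2
    rw [e3] at h3
    exact Submodule.sub_mem _ (Submodule.sub_mem _ h1 (Submodule.smul_mem _ _ h2))
      (Submodule.smul_mem _ _ h3)
  · rw [smul_sub, smul_sub, c, c, qE_smul_pureTensor k _ hFw, qE_smul_pureTensor k _ hFFw,
      qE_smul_pureTensor k _ hw.mem, hv.qE_smul, hw.qE_smul]
    obtain rfl | rfl : k = i ∨ k = j := by omega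
    · rw [hv.qE_qF_ne hij.symm, hw.qE_qF, hw.qE_qF_qF_ne hij.symm, hj, hv.qE_qF_qF hij]
      simp only [pureTensor_zero_left, pureTensor_zero_right, smul_zero, pureTensor_smul_left,
        pureTensor_smul_right, add_zero, zero_add, sub_zero, smul_smul]
      rw [← sub_smul]
      convert zero_smul ℂ _
      field_simp [iPow_ne_zero]
      ring
    · rw [hv.qE_qF, hw.qE_qF_ne hij, hw.qE_qF_qF hij.symm, hv.qE_qF_qF_ne hij, hi, hFwj]
      simp only [pureTensor_zero_left, pureTensor_zero_right, smul_zero, pureTensor_smul_left,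
        pureTensor_smul_right, add_zero, zero_add, sub_zero, smul_smul]
      rw [← sub_smul]
      convert zero_smul ℂ _
      field_simp
      ring

/-- The maximal vector of weight `lam + mu - α_j - α_3`. -/
theorem exists_maximal_simpleRoot_highestRoot {i j : Fin 2} (hij : i ≠ j) (hi : qF L i • v = 0)
    (hi' : br (lam i) = 0) (hj : qF L i • w = 0) (hj' : br (mu i) = 0)
    (h : NonInt (lam j)) (h' : NonInt (mu j)) :
    ∃ s : TensorMod L V W, s ≠ 0 ∧ IsMaximal L (lower (lam + mu) (depth j + (1, 1))) s := by
  have hvm : v ∈ wtSpace L V (lower lam 0) := by rw [lower_zero]; exact hv.mem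
  have hwm : w ∈ wtSpace L W (lower mu 0) := by rw [lower_zero]; exact hw.mem
  have hFv := mem_wtSpace_lower hvm j
  have hFw := mem_wtSpace_lower hwm j
  have hFFv := mem_wtSpace_lower hFv i
  have hFFw := mem_wtSpace_lower hFw i
  have hFFFv := mem_wtSpace_lower hFFv j
  have hFFFw := mem_wtSpace_lower hFFw j
  have c (j : Fin 2) (z : ℂ) (x : TensorMod L V W) : qE L j • z • x = z • qE L j • x :=
    smul_comm _ _ _
  have hl : br (lam i + 1) ≠ 0 := br_add_one_ne hi'
  have hm : br (mu i + 1) ≠ 0 := br_add_one_ne hj'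
  have hl' : br (lam j - 1) ≠ 0 := by rw [br_sub_one]; exact neg_ne_zero.2 h.2
  have hm' : br (mu j - 1) ≠ 0 := by rw [br_sub_one]; exact neg_ne_zero.2 h'.2
  have hFwi : lower mu (0 + depth j) i = mu i + 1 := by
    rw [zero_add, lower_depth, Pi.sub_apply, simpleRoot_ne hij.symm, sub_neg_eq_add]
  have hFFwj : lower mu (0 + depth j + depth i) j = mu j - 1 := by
    rw [zero_add, ← lower_lower, lower_depth, lower_depth, Pi.sub_apply, Pi.sub_apply,
      simpleRoot_self, simpleRoot_ne hij]
    ring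
  -- `A` balances the two terms in X_{-j} v ⊗ X_{-j} w produced by X_i. The coefficients of the two
  -- outer tensors are then forced by X_j, whose images lie along v ⊗ X_{-i} X_{-j} w and X_{-i}
  -- X_{-j} v ⊗ w.
  set A : ℂ := br (mu i + 1) * (br (lam i + 1))⁻¹ * (iPow (mu i + 1))⁻¹ with hA
  refine ⟨pureTensor L (qF L j • v) (qF L i • qF L j • w) -
    A • pureTensor L (qF L i • qF L j • v) (qF L j • w) -
    (br (lam j) * iPow (mu j - 1) * (br (mu j - 1))⁻¹) •
      pureTensor L v (qF L j • qF L i • qF L j • w) +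
    (A * br (mu j) * (br (lam j - 1))⁻¹ * (iPow (mu j))⁻¹) •
      pureTensor L (qF L j • qF L i • qF L j • v) w, fun h0 => ?_, ⟨?_, fun k => ?_⟩⟩
  · obtain ⟨f, ⟨c, hc, hf⟩, hf'⟩ := exists_contraction (W := W) hFv (hv.qF_ne_zero hv0 h.1)
    have := congrArg f h0
    rw [map_add, map_sub, map_sub, map_smul, map_smul, map_smul, hf,
      hf' 0 (by fin_cases j <;> simp [depth, Prod.ext_iff]) _ hvm,
      hf' _ (by fin_cases i <;> simp [depth]) _ hFFv,
      hf' _ (by fin_cases i <;> fin_cases j <;> simp [depth] at hij ⊢) _ hFFFv, map_zero,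
      smul_zero, smul_zero, smul_zero, sub_zero, sub_zero, add_zero] at this
    exact smul_ne_zero hc (hw.qF_qF_ne_zero hw0 hij h'.1 hm) this
  · have h1 := pureTensor_mem_wtSpace hFv hFFw
    have h2 := pureTensor_mem_wtSpace hFFv hFw
    have h3 := pureTensor_mem_wtSpace hvm hFFFw
    have h4 := pureTensor_mem_wtSpace hFFFv hwm
    rw [lower_add_lower] at h1 h2 h3 h4
    have e1 : 0 + depth j + (0 + depth j + depth i) = depth j + (1, 1) := by
      fin_cases i <;> fin_cases j <;> simp [depth] at hij ⊢
    have e2 : 0 + depth j + depth i + (0 + depth j) = depth j + (1, 1) := by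
      fin_cases i <;> fin_cases j <;> simp [depth] at hij ⊢
    have e3 : 0 + (0 + depth j + depth i + depth j) = depth j + (1, 1) := by
      fin_cases i <;> fin_cases j <;> simp [depth] at hij ⊢
    have e4 : 0 + depth j + depth i + depth j + 0 = depth j + (1, 1) := by
      fin_cases i <;> fin_cases j <;> simp [depth] at hij ⊢
    rw [e1] at h1
    rw [e2] at h2
    rw [e3] at h3
    rw [e4] at h4
    exact Submodule.add_mem _ (Submodule.sub_mem _ (Submodule.sub_mem _ h1
      (Submodule.smul_mem _ _ h2)) (Submodule.smul_mem _ _ h3)) (Submodule.smul_mem _ _ h4)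
  · rw [smul_add, smul_sub, smul_sub, c, c, c, qE_smul_pureTensor k _ hFw,
      qE_smul_pureTensor k _ hFFw,
      qE_smul_pureTensor k _ hFFFw, qE_smul_pureTensor k _ hw.mem, hv.qE_smul, hw.qE_smul]
    obtain rfl | rfl : k = i ∨ k = j := by omega
    · rw [hv.qE_qF_ne hij.symm, hw.qE_qF_qF hij, hv.qE_qF_qF hij, hw.qE_qF_ne hij.symm,
        hw.qE_qF_qF_qF_ne hij, hv.qE_qF_qF_qF_ne hij, hFwi]
      simp only [pureTensor_zero_left, pureTensor_zero_right, smul_zero, pureTensor_smul_left,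
        pureTensor_smul_right, add_zero, zero_add, sub_zero, smul_smul]
      rw [← sub_smul]
      convert zero_smul ℂ _
      rw [hA]
      have := iPow_ne_zero (mu k + 1)
      field_simp
      ring
    · rw [hv.qE_qF, hw.qE_qF_qF_ne hij, hv.qE_qF_qF_ne hij, hw.qE_qF, hw.qE_qF_qF_qF hij,
        hv.qE_qF_qF_qF hij, hi, hj, hFFwj]
      simp only [pureTensor_zero_left, pureTensor_zero_right, smul_zero, pureTensor_smul_left,
        pureTensor_smul_right, add_zero, zero_add, smul_smul]
      have e1 : br (lam k) * iPow (mu k - 1) * (br (mu k - 1))⁻¹ * br (mu k - 1) =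
          iPow (mu k - 1) * br (lam k) := by field_simp
      have e2 : A * br (mu k) * (br (lam k - 1))⁻¹ * (iPow (mu k))⁻¹ *
          (iPow (mu k) * br (lam k - 1)) = A * br (mu k) := by
        have := iPow_ne_zero (mu k)
        field_simp
      rw [e1, e2]
      module

end TensorProducts

/-! ### Tensor products of irreducible modules -/

section Products

variable {L : IntermediateLattice}

instance (lam mu : Weight) : Module.Finite ℂ (TensorMod L (Irr L lam) (Irr L mu)) :=
  inferInstanceAs (Module.Finite ℂ (Irr L lam ⊗[ℂ] Irr L mu))

theorem finrank_tensorMod (lam mu : Weight) :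
    Module.finrank ℂ (TensorMod L (Irr L lam) (Irr L mu)) =
      Module.finrank ℂ (Irr L lam) * Module.finrank ℂ (Irr L mu) :=
  Module.finrank_tensorProduct (R := ℂ) (S := ℂ) (M := Irr L lam) (M' := Irr L mu)

theorem qF_smul_pureTensor_eq_zero {V : Type} [AddCommGroup V] [Module ℂ V] [Module (QGrp L) V]
    [IsScalarTower ℂ (QGrp L) V] {W : Type} [AddCommGroup W] [Module ℂ W] [Module (QGrp L) W]
    [IsScalarTower ℂ (QGrp L) W] {i : Fin 2} {v : V} {w : W} (hv : qF L i • v = 0)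
    (hw : qF L i • w = 0) : qF L i • pureTensor L v w = 0 := by
  change tensorAction L V W (qF L i) (v ⊗ₜ w) = 0
  simp only [tensorAction, AlgHom.comp_apply, comul_gen, comulGen, map_add,
    Algebra.TensorProduct.map_tmul, Module.endTensorEndAlgHom_apply, map_one,
    LinearMap.add_apply, TensorProduct.AlgebraTensorModule.map_tmul, Algebra.lsmul_coe, hv, hw,
    TensorProduct.zero_tmul, TensorProduct.tmul_zero, add_zero]

variable {lam mu : Weight}

theorem isMaximal_pureTensor_irrGen (lam mu : Weight) :
    IsMaximal L (lam + mu) (pureTensor L (irrGen L lam) (irrGen L mu)) :=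
  (isMaximal_irrGen lam).pureTensor (isMaximal_irrGen mu)

theorem pureTensor_irrGen_ne_zero (lam mu : Weight) :
    pureTensor L (irrGen L lam) (irrGen L mu) ≠ 0 :=
  pureTensor_ne_zero (irrGen_ne_zero lam) (irrGen_ne_zero mu)

/-- X_{-i} kills both generators, hence their product, which therefore generates at most four
dimensions: no more than the irreducible module of weight λ + μ has. -/
theorem simple_pureTensor_irrGen {i j : Fin 2} (hij : i ≠ j) (h : br (lam i) = 0)
    (h' : br (mu i) = 0) (hd : Module.finrank ℂ (Irr L (lam + mu)) = 4) :
    (isMaximal_pureTensor_irrGen (L := L) lam mu).Simple := by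
  refine IsMaximal.simple_of_finrank_le _ (pureTensor_irrGen_ne_zero lam mu) ?_
  rw [hd]
  exact (finrank_range_lift_le _ _ (words_mem_span_of_qF_eq_zero hij
    (qF_smul_pureTensor_eq_zero (Irr.qF_smul_eq_zero h) (Irr.qF_smul_eq_zero h')))).2

theorem notBelow_add_lower {p : ℕ × ℕ} (hp : p ≠ 0) : NotBelow (lam + mu) (lower (lam + mu) p) := by
  nth_rewrite 1 [← lower_zero (lam + mu)]
  exact notBelow_lower fun h => hp (le_antisymm h bot_le)

theorem depth_ne_zero (j : Fin 2) : depth j ≠ 0 := by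
  fin_cases j <;> simp [depth, Prod.ext_iff]

theorem lower_one_one (lam : Weight) : lower lam (1, 1) = lam - root 2 := by
  simp [lower, root]

theorem lower_depth_add (lam : Weight) (j : Fin 2) :
    lower lam (depth j + (1, 1)) = lam - simpleRoot j - root 2 := by
  rw [← lower_lower, lower_depth, lower_one_one]

theorem tensor_equiv_simpleRoot {k : Fin 2}
    (hs : (isMaximal_pureTensor_irrGen (L := L) lam mu).Simple)
    (hl : br (lam k) ≠ 0) (hm : br (mu k) ≠ 0)
    (hd : Module.finrank ℂ (Irr L lam) * Module.finrank ℂ (Irr L mu) ≤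
      Module.finrank ℂ (Irr L (lam + mu)) + Module.finrank ℂ (Irr L (lam + mu - simpleRoot k))) :
    Nonempty (TensorMod L (Irr L lam) (Irr L mu) ≃ₗ[QGrp L]
      Irr L (lam + mu) × Irr L (lam + mu - simpleRoot k)) := by
  obtain ⟨s, hs0, hsm⟩ := exists_maximal_simpleRoot (isMaximal_irrGen (L := L) lam)
    (isMaximal_irrGen mu) (irrGen_ne_zero lam) (irrGen_ne_zero mu) hl hm
  have hb := notBelow_add_lower (lam := lam) (mu := mu) (depth_ne_zero k)
  rw [lower_depth] at hsm hb
  exact nonempty_equiv_prod (isMaximal_pureTensor_irrGen lam mu) hsm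
    (pureTensor_irrGen_ne_zero lam mu) hs0 hs hb (by rwa [finrank_tensorMod])

theorem tensor_equiv_highestRoot {i j : Fin 2} (hij : i ≠ j) (ht : Typ (lam + mu))
    (hi : br (lam i) = 0) (hj : br (mu j) = 0) (hl : br (lam j) ≠ 0) (hm : br (mu i) ≠ 0)
    (hd : Module.finrank ℂ (Irr L lam) * Module.finrank ℂ (Irr L mu) ≤
      Module.finrank ℂ (Irr L (lam + mu)) + Module.finrank ℂ (Irr L (lam + mu - root 2))) :
    Nonempty (TensorMod L (Irr L lam) (Irr L mu) ≃ₗ[QGrp L]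
      Irr L (lam + mu) × Irr L (lam + mu - root 2)) := by
  obtain ⟨s, hs0, hsm⟩ := exists_maximal_highestRoot (isMaximal_irrGen (L := L) lam)
    (isMaximal_irrGen mu) (irrGen_ne_zero lam) (irrGen_ne_zero mu) hij (Irr.qF_smul_eq_zero hi) hi
    (Irr.qF_smul_eq_zero hj) hj hl hm
  have hb := notBelow_add_lower (lam := lam) (mu := mu) (p := (1, 1)) (by simp [Prod.ext_iff])
  rw [lower_one_one] at hsm hb
  exact nonempty_equiv_prod (isMaximal_pureTensor_irrGen lam mu) hsm
    (pureTensor_irrGen_ne_zero lam mu) hs0 (ht.simple' _) hb (by rwa [finrank_tensorMod])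

/-- The third weight lies below the second, so the third vector is kept out of the second submodule
by the typicality, hence simplicity, of the latter. -/
theorem tensor_equiv_three {i j : Fin 2} (hij : i ≠ j)
    (hs : (isMaximal_pureTensor_irrGen (L := L) lam mu).Simple)
    (ht : Typ (lam + mu - simpleRoot j))
    (hi : br (lam i) = 0) (hi' : br (mu i) = 0) (hl : NonInt (lam j)) (hm : NonInt (mu j))
    (hd : Module.finrank ℂ (Irr L lam) * Module.finrank ℂ (Irr L mu) ≤
      Module.finrank ℂ (Irr L (lam + mu)) + (Module.finrank ℂ (Irr L (lam + mu - simpleRoot j)) +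
        Module.finrank ℂ (Irr L (lam + mu - simpleRoot j - root 2)))) :
    Nonempty (TensorMod L (Irr L lam) (Irr L mu) ≃ₗ[QGrp L]
      Irr L (lam + mu) × Irr L (lam + mu - simpleRoot j) ×
        Irr L (lam + mu - simpleRoot j - root 2)) := by
  obtain ⟨s, hs0, hsm⟩ := exists_maximal_simpleRoot (isMaximal_irrGen (L := L) lam)
    (isMaximal_irrGen mu) (irrGen_ne_zero lam) (irrGen_ne_zero mu) hl.1 hm.1
  obtain ⟨t, ht0, htm⟩ := exists_maximal_simpleRoot_highestRoot (isMaximal_irrGen (L := L) lam)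
    (isMaximal_irrGen mu) (irrGen_ne_zero lam) (irrGen_ne_zero mu) hij (Irr.qF_smul_eq_zero hi) hi
    (Irr.qF_smul_eq_zero hi') hi' hl hm
  have hb := notBelow_add_lower (lam := lam) (mu := mu) (depth_ne_zero j)
  have hb' := notBelow_add_lower (lam := lam) (mu := mu) (p := depth j + (1, 1))
    (by simp [Prod.ext_iff])
  have hb'' : NotBelow (lower (lam + mu) (depth j)) (lower (lam + mu) (depth j + (1, 1))) :=
    notBelow_lower (by fin_cases j <;> simp [depth])
  rw [lower_depth_add] at htm hb' hb''
  rw [lower_depth] at hsm hb hb''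
  exact nonempty_equiv_prod_prod (isMaximal_pureTensor_irrGen lam mu) hsm htm
    (pureTensor_irrGen_ne_zero lam mu) hs0 ht0 hs hb hb' hb'' (Or.inr (ht.simple' _))
    (by rwa [finrank_tensorMod])

/-- Here the weights λ + μ - α_1 and λ + μ - α_2 are incomparable, which separates the last two
vectors although their submodules need not be known to be simple. -/
theorem tensor_equiv_simpleRoots (ht : Typ (lam + mu))
    (hl : NonInt (lam 0)) (hm : NonInt (mu 0)) (hl' : NonInt (lam 1)) (hm' : NonInt (mu 1))
    (hd : Module.finrank ℂ (Irr L lam) * Module.finrank ℂ (Irr L mu) ≤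
      Module.finrank ℂ (Irr L (lam + mu)) + (Module.finrank ℂ (Irr L (lam + mu - simpleRoot 0)) +
        Module.finrank ℂ (Irr L (lam + mu - simpleRoot 1)))) :
    Nonempty (TensorMod L (Irr L lam) (Irr L mu) ≃ₗ[QGrp L]
      Irr L (lam + mu) × Irr L (lam + mu - simpleRoot 0) × Irr L (lam + mu - simpleRoot 1)) := by
  obtain ⟨s, hs0, hsm⟩ := exists_maximal_simpleRoot (isMaximal_irrGen (L := L) lam)
    (isMaximal_irrGen mu) (irrGen_ne_zero lam) (irrGen_ne_zero mu) hl.1 hm.1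
  obtain ⟨t, ht0, htm⟩ := exists_maximal_simpleRoot (isMaximal_irrGen (L := L) lam)
    (isMaximal_irrGen mu) (irrGen_ne_zero lam) (irrGen_ne_zero mu) hl'.1 hm'.1
  have hb := notBelow_add_lower (lam := lam) (mu := mu) (depth_ne_zero 0)
  have hb' := notBelow_add_lower (lam := lam) (mu := mu) (depth_ne_zero 1)
  have h01 : NotBelow (lower (lam + mu) (depth 0)) (lower (lam + mu) (depth 1)) :=
    notBelow_lower (by simp [depth])
  have h10 : NotBelow (lower (lam + mu) (depth 1)) (lower (lam + mu) (depth 0)) :=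
    notBelow_lower (by simp [depth])
  rw [lower_depth] at hsm hb htm hb'
  rw [lower_depth, lower_depth] at h01 h10
  exact nonempty_equiv_prod_prod (isMaximal_pureTensor_irrGen lam mu) hsm htm
    (pureTensor_irrGen_ne_zero lam mu) hs0 ht0 (ht.simple' _) hb hb' h01 (Or.inl h10)
    (by rwa [finrank_tensorMod])

end Products

/-! ### Indices of weights -/

section Indices

theorem br_add_eq_zero {z w : ℂ} (hz : br z = 0) (hw : br w = 0) : br (z + w) = 0 := by
  obtain ⟨m, rfl⟩ := (br_eq_zero_iff z).1 hz
  obtain ⟨n, rfl⟩ := (br_eq_zero_iff w).1 hw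
  exact (br_eq_zero_iff _).2 ⟨m + n, by push_cast; ring⟩

variable {lam mu : Weight} {i j : Fin 2}

theorem add_eq_of_ne (hij : i ≠ j) (lam : Weight) : lam 0 + lam 1 = lam i + lam j := by
  fin_cases i <;> fin_cases j <;> simp [add_comm] at hij ⊢

theorem Typ.of_ne (hij : i ≠ j) (hi : br (lam i) ≠ 0) (hj : br (lam j) ≠ 0)
    (h : br (lam i + lam j + 1) ≠ 0) : Typ lam := by
  have h' := add_eq_of_ne hij lam ▸ h
  fin_cases i <;> fin_cases j <;> first
    | exact absurd rfl hij
    | exact ⟨hi, hj, h'⟩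
    | exact ⟨hj, hi, h'⟩

theorem isOddInt_index_zero (lam : Weight) : IsOddInt (index lam 0) ↔ br (lam 0) = 0 := by
  rw [← isOddInt_add_one_iff]
  refine iff_of_eq (congrArg _ ?_)
  rw [index, show root 0 = simpleRoot 0 from rfl, form_simpleRoot]
  rfl

theorem isOddInt_index_one (lam : Weight) : IsOddInt (index lam 1) ↔ br (lam 1) = 0 := by
  rw [← isOddInt_add_one_iff]
  refine iff_of_eq (congrArg _ ?_)
  rw [index, show root 1 = simpleRoot 1 from rfl, form_simpleRoot]
  rfl

theorem isOddInt_index_two (lam : Weight) :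
    IsOddInt (index lam 2) ↔ br (lam 0 + lam 1 + 1) = 0 := by
  rw [← isOddInt_add_one_iff]
  refine iff_of_eq (congrArg _ ?_)
  rw [index, show root 2 = simpleRoot 0 + simpleRoot 1 from rfl, form_add_right, form_simpleRoot,
    form_simpleRoot]
  simp only [Pi.add_apply, rho]
  ring

theorem IsTypical.typ (h : IsTypical lam) : Typ lam :=
  ⟨fun h' => h 0 ((isOddInt_index_zero lam).2 h'), fun h' => h 1 ((isOddInt_index_one lam).2 h'),
    fun h' => h 2 ((isOddInt_index_two lam).2 h')⟩

theorem IsAtypicalOfDegree.eq_of_isOddInt (h : IsAtypicalOfDegree 1 lam) {p q : Fin 3}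
    (hp : IsOddInt (index lam p)) (hq : IsOddInt (index lam q)) : p = q := by
  obtain ⟨r, hr⟩ := Set.ncard_eq_one.1 h
  have hp' : p = r := by simpa [hr] using (show p ∈ {j | IsOddInt (index lam j)} from hp)
  have hq' : q = r := by simpa [hr] using (show q ∈ {j | IsOddInt (index lam j)} from hq)
  rw [hp', hq']

/-- With br(λ(H_i)) = 0, `br_det` factors the third quantum integer as br(λ(H_i) + 1) br(λ(H_j) +
1), so either parity of an integral λ(H_j) would produce a second odd index. -/
theorem IsAtypicalOfDegree.nonInt (h : IsAtypicalOfDegree 1 lam) (hij : i ≠ j)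
    (hi : br (lam i) = 0) : NonInt (lam j) := by
  have hd := br_det (lam i) (lam j)
  rw [← add_eq_of_ne hij, hi, zero_mul, sub_zero] at hd
  have h2 (h0 : br (lam j + 1) = 0) : IsOddInt (index lam 2) := by
    rw [isOddInt_index_two, hd, h0, mul_zero]
  fin_cases i <;> fin_cases j <;> first
    | exact absurd rfl hij
    | (have h0 := (isOddInt_index_zero lam).2 hi
       exact ⟨fun e => absurd (h.eq_of_isOddInt h0 ((isOddInt_index_one lam).2 e)) (by decide),
         fun e => absurd (h.eq_of_isOddInt h0 (h2 e)) (by decide)⟩)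
    | (have h0 := (isOddInt_index_one lam).2 hi
       exact ⟨fun e => absurd (h.eq_of_isOddInt h0 ((isOddInt_index_zero lam).2 e)) (by decide),
         fun e => absurd (h.eq_of_isOddInt h0 (h2 e)) (by decide)⟩)

/-- If the third quantum integer vanishes, `br_det` equates br(λ(H_1) + 1) br(λ(H_2) + 1) with
br(λ(H_1)) br(λ(H_2)), which is nonzero because the first two indices are not odd. -/
theorem IsAtypicalOfDegree.nonInt_of_add (h : IsAtypicalOfDegree 1 lam)
    (h2 : br (lam 0 + lam 1 + 1) = 0) : NonInt (lam 0) ∧ NonInt (lam 1) := by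
  have ho := (isOddInt_index_two lam).2 h2
  have n0 : br (lam 0) ≠ 0 := fun e =>
    absurd (h.eq_of_isOddInt ho ((isOddInt_index_zero lam).2 e)) (by decide)
  have n1 : br (lam 1) ≠ 0 := fun e =>
    absurd (h.eq_of_isOddInt ho ((isOddInt_index_one lam).2 e)) (by decide)
  have hd := br_det (lam 0) (lam 1)
  rw [h2, eq_comm, sub_eq_zero] at hd
  have := mul_ne_zero n0 n1
  rw [← hd] at this
  exact ⟨⟨n0, left_ne_zero_of_mul this⟩, ⟨n1, right_ne_zero_of_mul this⟩⟩

theorem br_add_one_eq_zero (hij : i ≠ j) (hi : br (lam i) = 0)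
    (h2 : br (lam 0 + lam 1 + 1) = 0) : br (lam j + 1) = 0 := by
  have hd := br_det (lam i) (lam j)
  rw [← add_eq_of_ne hij, hi, zero_mul, sub_zero, h2, eq_comm] at hd
  exact (mul_eq_zero.1 hd).resolve_left (br_add_one_ne hi)

theorem root_two_apply (k : Fin 2) : root 2 k = 1 := by
  fin_cases k <;> simp [root, simpleRoot, cartan] <;> norm_num

end Indices

/-! ### The decompositions -/

section Main

variable {L : IntermediateLattice} {lam mu : Weight} {i j : Fin 2}

theorem isInt_one : IsInt 1 := ⟨1, by simp⟩

theorem isInt_of_br_add_one {z : ℂ} (h : br (z + 1) = 0) : IsInt z := by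
  simpa using (isInt_of_br_eq_zero h).sub isInt_one

theorem NonInt.add_right {z w : ℂ} (hz : NonInt z) (hw : IsInt w) : NonInt (z + w) :=
  hz.of_sub (by simpa using hw)

theorem NonInt.add_left {z w : ℂ} (hz : NonInt z) (hw : IsInt w) : NonInt (w + z) :=
  hz.of_sub (by simpa using hw)

theorem NonInt.sub_right {z w : ℂ} (hz : NonInt z) (hw : IsInt w) : NonInt (z - w) :=
  hz.of_sub (by simpa using (isInt_intCast 0).sub hw)

theorem simpleRoot_isInt (i j : Fin 2) : IsInt (simpleRoot i j) := ⟨cartan j i, rfl⟩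

/-- Subtracting the other simple root from a weight with one odd simple index gives a typical
weight. -/
theorem typ_sub_simpleRoot (hij : i ≠ j) {nu : Weight} (hi : br (nu i) = 0)
    (hj : NonInt (nu j)) : Typ (nu - simpleRoot j) := by
  refine Typ.of_ne hij ?_ ?_ ?_
  · rw [Pi.sub_apply, simpleRoot_ne hij.symm, sub_neg_eq_add]
    exact br_add_one_ne hi
  · exact (hj.sub_right (simpleRoot_isInt j j)).1
  · rw [Pi.sub_apply, Pi.sub_apply, simpleRoot_ne hij.symm, simpleRoot_self]
    exact (hj.of_sub (by
      convert isInt_of_br_eq_zero hi using 1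
      ring)).1

/-- Subtracting α_3 shifts the third index by 2, which only changes the sign of its quantum integer;
the two simple coordinates stay non-integral. The count is 4·4 = 8 + 8. -/
theorem tensor_simple_ne (hij : i ≠ j) (hi : br (lam i) = 0) (hl : NonInt (lam j))
    (hj : br (mu j) = 0) (hm : NonInt (mu i)) (ht : Typ (lam + mu)) :
    Typ (lam + mu - root 2) ∧ Nonempty (TensorMod L (Irr L lam) (Irr L mu) ≃ₗ[QGrp L]
      Irr L (lam + mu) × Irr L (lam + mu - root 2)) := by
  have ht' : Typ (lam + mu - root 2) := by
    refine Typ.of_ne hij ?_ ?_ ?_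
    · rw [Pi.sub_apply, root_two_apply, Pi.add_apply]
      exact ((hm.add_left (isInt_of_br_eq_zero hi)).sub_right isInt_one).1
    · rw [Pi.sub_apply, root_two_apply, Pi.add_apply]
      exact ((hl.add_right (isInt_of_br_eq_zero hj)).sub_right isInt_one).1
    · have := ht.add
      rw [add_eq_of_ne hij] at this
      rw [Pi.sub_apply, Pi.sub_apply, root_two_apply, root_two_apply, show
        (lam + mu) i - 1 + ((lam + mu) j - 1) + 1 = (lam + mu) i + (lam + mu) j + 1 - 2 by ring,
        br_sub_two]
      exact neg_ne_zero.2 this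
  refine ⟨ht', tensor_equiv_highestRoot hij ht hi hj hl.1 hm.1 ?_⟩
  rw [finrank_irr_of_br_eq_zero hij hi hl, finrank_irr_of_br_eq_zero hij.symm hj hm,
    ht.finrank_irr, ht'.finrank_irr]

theorem typ_sub_simpleRoot_of_add (hij : i ≠ j) (hi : br (lam i) = 0) (hl : NonInt (lam j))
    (hm : br (mu 0 + mu 1 + 1) = 0) (hmi : NonInt (mu i)) (ht : Typ (lam + mu)) :
    Typ (lam + mu - simpleRoot j) := by
  have htj : br ((lam + mu) j) ≠ 0 := by
    have h0 := ht.zero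
    have h1 := ht.one
    fin_cases j <;> assumption
  refine Typ.of_ne hij ?_ ?_ ?_
  · rw [Pi.sub_apply, Pi.add_apply]
    exact ((hmi.add_left (isInt_of_br_eq_zero hi)).sub_right (simpleRoot_isInt j i)).1
  · rw [Pi.sub_apply, simpleRoot_self, br_sub_two]
    exact neg_ne_zero.2 htj
  · rw [Pi.sub_apply, Pi.sub_apply, simpleRoot_ne hij.symm, simpleRoot_self, Pi.add_apply,
      Pi.add_apply]
    rw [add_eq_of_ne hij] at hm
    -- Since λ(H_i) and μ(H_1) + μ(H_2) + 1 are integers, the third coordinate differs from λ(H_j)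
    -- by an integer.
    refine (hl.of_sub ?_).1
    convert ((isInt_of_br_eq_zero hi).add (isInt_of_br_eq_zero hm)).sub isInt_one using 1
    ring

theorem tensor_simple_highest (hij : i ≠ j) (hi : br (lam i) = 0) (hl : NonInt (lam j))
    (hm : br (mu 0 + mu 1 + 1) = 0) (hm0 : NonInt (mu 0)) (hm1 : NonInt (mu 1))
    (ht : Typ (lam + mu)) :
    Typ (lam + mu - simpleRoot j) ∧ Nonempty (TensorMod L (Irr L lam) (Irr L mu) ≃ₗ[QGrp L]
      Irr L (lam + mu) × Irr L (lam + mu - simpleRoot j)) := by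
  have hmk (k : Fin 2) : NonInt (mu k) := by fin_cases k <;> assumption
  have ht' := typ_sub_simpleRoot_of_add hij hi hl hm (hmk i) ht
  refine ⟨ht', tensor_equiv_simpleRoot (ht.simple' _) hl.1 (hmk j).1 ?_⟩
  rw [finrank_irr_of_br_eq_zero hij hi hl, finrank_irr_of_br_add_eq_zero hm hm0 hm1,
    ht.finrank_irr, ht'.finrank_irr]

theorem tensor_highest_simple (hij : i ≠ j) (hi : br (mu i) = 0) (hm : NonInt (mu j))
    (hl : br (lam 0 + lam 1 + 1) = 0) (hl0 : NonInt (lam 0)) (hl1 : NonInt (lam 1))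
    (ht : Typ (lam + mu)) :
    Typ (lam + mu - simpleRoot j) ∧ Nonempty (TensorMod L (Irr L lam) (Irr L mu) ≃ₗ[QGrp L]
      Irr L (lam + mu) × Irr L (lam + mu - simpleRoot j)) := by
  have hlk (k : Fin 2) : NonInt (lam k) := by fin_cases k <;> assumption
  have ht' : Typ (lam + mu - simpleRoot j) := by
    rw [add_comm] at ht ⊢
    exact typ_sub_simpleRoot_of_add hij hi hm hl (hlk i) ht
  refine ⟨ht', tensor_equiv_simpleRoot (ht.simple' _) (hlk j).1 hm.1 ?_⟩
  rw [finrank_irr_of_br_eq_zero hij hi hm, finrank_irr_of_br_add_eq_zero hl hl0 hl1,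
    ht.finrank_irr, ht'.finrank_irr]

theorem tensor_simple_same (hij : i ≠ j) (hi : br (lam i) = 0) (hl : NonInt (lam j))
    (hi' : br (mu i) = 0) (hm : NonInt (mu j)) (hn : NonInt ((lam + mu) j)) :
    Module.finrank ℂ (Irr L (lam + mu)) = 4 ∧
    Module.finrank ℂ (Irr L (lam + mu - simpleRoot j - root 2)) = 4 ∧
    Typ (lam + mu - simpleRoot j) ∧ Nonempty (TensorMod L (Irr L lam) (Irr L mu) ≃ₗ[QGrp L]
      Irr L (lam + mu) × Irr L (lam + mu - simpleRoot j) ×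
        Irr L (lam + mu - simpleRoot j - root 2)) := by
  have hn0 : br ((lam + mu) i) = 0 := br_add_eq_zero hi hi'
  have h4 : Module.finrank ℂ (Irr L (lam + mu)) = 4 := finrank_irr_of_br_eq_zero hij hn0 hn
  have h4' : Module.finrank ℂ (Irr L (lam + mu - simpleRoot j - root 2)) = 4 := by
    refine finrank_irr_of_br_eq_zero hij ?_ ?_
    · rw [Pi.sub_apply, Pi.sub_apply, simpleRoot_ne hij.symm, root_two_apply, sub_neg_eq_add,
        add_sub_cancel_right]
      exact hn0
    · rw [Pi.sub_apply, Pi.sub_apply, root_two_apply]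
      exact (hn.sub_right (simpleRoot_isInt j j)).sub_right isInt_one
  have ht := typ_sub_simpleRoot hij hn0 hn
  refine ⟨h4, h4', ht, tensor_equiv_three hij (simple_pureTensor_irrGen hij hi hi' h4) ht hi hi'
    hl hm ?_⟩
  rw [h4, h4', ht.finrank_irr, finrank_irr_of_br_eq_zero hij hi hl,
    finrank_irr_of_br_eq_zero hij hi' hm]

/-- The highest index of `nu - α_k` is that of `nu` minus one. -/
theorem add_sub_simpleRoot (nu : Weight) (k : Fin 2) :
    (nu - simpleRoot k) 0 + (nu - simpleRoot k) 1 + 1 = nu 0 + nu 1 + 1 - 1 := by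
  fin_cases k <;> simp [simpleRoot, cartan] <;> ring

theorem br_index_two_add (hl : br (lam 0 + lam 1 + 1) = 0) (hm : br (mu 0 + mu 1 + 1) = 0) :
    br ((lam + mu) 0 + (lam + mu) 1 + 1) ≠ 0 := by
  have := br_add_one_ne (br_add_eq_zero hl hm)
  rw [← neg_ne_zero, ← br_sub_one] at this
  convert this using 2
  simp only [Pi.add_apply]
  ring

theorem br_index_two_sub_simpleRoot (hl : br (lam 0 + lam 1 + 1) = 0)
    (hm : br (mu 0 + mu 1 + 1) = 0) (k : Fin 2) :
    br ((lam + mu - simpleRoot k) 0 + (lam + mu - simpleRoot k) 1 + 1) = 0 := by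
  have := br_sub_two (lam 0 + lam 1 + 1 + (mu 0 + mu 1 + 1))
  rw [br_add_eq_zero hl hm, neg_zero] at this
  rw [add_sub_simpleRoot, ← this]
  congr 1
  simp only [Pi.add_apply]
  ring

/-- When λ_3 and μ_3 are odd, the third index of λ + μ is even, and subtracting either simple root
makes it odd; hence one typical summand and two of dimension 4. -/
theorem tensor_highest (hl : br (lam 0 + lam 1 + 1) = 0) (hl0 : NonInt (lam 0))
    (hl1 : NonInt (lam 1)) (hm : br (mu 0 + mu 1 + 1) = 0) (hm0 : NonInt (mu 0))
    (hm1 : NonInt (mu 1)) (hn0 : NonInt ((lam + mu) 0)) (hn1 : NonInt ((lam + mu) 1)) :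
    (∀ k, Module.finrank ℂ (Irr L (lam + mu - simpleRoot k)) = 4) ∧
    Typ (lam + mu) ∧ Nonempty (TensorMod L (Irr L lam) (Irr L mu) ≃ₗ[QGrp L]
      Irr L (lam + mu) × Irr L (lam + mu - simpleRoot 0) × Irr L (lam + mu - simpleRoot 1)) := by
  have ht : Typ (lam + mu) := ⟨hn0.1, hn1.1, br_index_two_add hl hm⟩
  have h4 (k : Fin 2) : Module.finrank ℂ (Irr L (lam + mu - simpleRoot k)) = 4 :=
    finrank_irr_of_br_add_eq_zero (br_index_two_sub_simpleRoot hl hm k)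
      (hn0.sub_right (simpleRoot_isInt k 0)) (hn1.sub_right (simpleRoot_isInt k 1))
  refine ⟨h4, ht, tensor_equiv_simpleRoots ht hl0 hm0 hl1 hm1 ?_⟩
  rw [h4, h4, ht.finrank_irr, finrank_irr_of_br_add_eq_zero hl hl0 hl1,
    finrank_irr_of_br_add_eq_zero hm hm0 hm1]

theorem tensor_three_simple_ne (hij : i ≠ j) (hi : br (lam i) = 0) (hl : br (lam j + 1) = 0)
    (hj : br (mu j) = 0) (hm : NonInt (mu i)) :
    Module.finrank ℂ (Irr L (lam + mu - root 2)) = 4 ∧ Typ (lam + mu) ∧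
    Nonempty (TensorMod L (Irr L lam) (Irr L mu) ≃ₗ[QGrp L]
      Irr L (lam + mu) × Irr L (lam + mu - root 2)) := by
  have hni : NonInt ((lam + mu) i) := hm.add_left (isInt_of_br_eq_zero hi)
  have hnj : br ((lam + mu) j + 1) = 0 := by
    rw [Pi.add_apply, add_right_comm]
    exact br_add_eq_zero hl hj
  have ht : Typ (lam + mu) := by
    refine Typ.of_ne hij hni.1 (br_ne_of_add_one hnj) ?_
    rw [add_assoc]
    exact (hni.add_right (isInt_of_br_eq_zero hnj)).1
  have h4 : Module.finrank ℂ (Irr L (lam + mu - root 2)) = 4 := by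
    refine finrank_irr_of_br_eq_zero hij.symm ?_ ?_
    · rw [Pi.sub_apply, root_two_apply, br_sub_one, hnj, neg_zero]
    · rw [Pi.sub_apply, root_two_apply]
      exact hni.sub_right isInt_one
  refine ⟨h4, ht, tensor_equiv_highestRoot hij ht hi hj (br_ne_of_add_one hl) hm.1 ?_⟩
  have := finrank_irr_le_three (L := L) hij hi hl
  rw [h4, ht.finrank_irr, finrank_irr_of_br_eq_zero hij.symm hj hm]
  omega

theorem tensor_three_highest (hij : i ≠ j) (hi : br (lam i) = 0)
    (hl : br (lam 0 + lam 1 + 1) = 0) (hm : br (mu 0 + mu 1 + 1) = 0) (hm0 : NonInt (mu 0))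
    (hm1 : NonInt (mu 1)) :
    Module.finrank ℂ (Irr L (lam + mu - simpleRoot j)) = 4 ∧ Typ (lam + mu) ∧
    Nonempty (TensorMod L (Irr L lam) (Irr L mu) ≃ₗ[QGrp L]
      Irr L (lam + mu) × Irr L (lam + mu - simpleRoot j)) := by
  have hlj := br_add_one_eq_zero hij hi hl
  have hint (k : Fin 2) : IsInt (lam k) := by
    obtain rfl | rfl : k = i ∨ k = j := by omega
    exacts [isInt_of_br_eq_zero hi, isInt_of_br_add_one hlj]
  have hmk (k : Fin 2) : NonInt (mu k) := by fin_cases k <;> assumption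
  have hn (k : Fin 2) : NonInt ((lam + mu) k) := (hmk k).add_left (hint k)
  have ht : Typ (lam + mu) := ⟨(hn 0).1, (hn 1).1, br_index_two_add hl hm⟩
  have h4 : Module.finrank ℂ (Irr L (lam + mu - simpleRoot j)) = 4 :=
    finrank_irr_of_br_add_eq_zero (br_index_two_sub_simpleRoot hl hm j)
      ((hn 0).sub_right (simpleRoot_isInt j 0)) ((hn 1).sub_right (simpleRoot_isInt j 1))
  refine ⟨h4, ht, tensor_equiv_simpleRoot (ht.simple' _) (br_ne_of_add_one hlj) (hmk j).1 ?_⟩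
  have := finrank_irr_le_three (L := L) hij hi hlj
  rw [h4, ht.finrank_irr, finrank_irr_of_br_add_eq_zero hm hm0 hm1]
  omega

theorem tensor_three_simple_same (hij : i ≠ j) (hi : br (lam i) = 0) (hl : br (lam j + 1) = 0)
    (hi' : br (mu i) = 0) (hm : NonInt (mu j)) :
    Module.finrank ℂ (Irr L (lam + mu)) = 4 ∧ Typ (lam + mu - simpleRoot j) ∧
    Nonempty (TensorMod L (Irr L lam) (Irr L mu) ≃ₗ[QGrp L]
      Irr L (lam + mu) × Irr L (lam + mu - simpleRoot j)) := by
  have hn0 : br ((lam + mu) i) = 0 := br_add_eq_zero hi hi'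
  have hn : NonInt ((lam + mu) j) := hm.add_left (isInt_of_br_add_one hl)
  have h4 : Module.finrank ℂ (Irr L (lam + mu)) = 4 := finrank_irr_of_br_eq_zero hij hn0 hn
  have ht := typ_sub_simpleRoot hij hn0 hn
  refine ⟨h4, ht, tensor_equiv_simpleRoot (simple_pureTensor_irrGen hij hi hi' h4)
    (br_ne_of_add_one hl) hm.1 ?_⟩
  have := finrank_irr_le_three (L := L) hij hi hl
  rw [h4, ht.finrank_irr, finrank_irr_of_br_eq_zero hij hi' hm]
  omega

theorem tensor_three_three (hij : i ≠ j) (hi : br (lam i) = 0) (hl : br (lam j + 1) = 0)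
    (hj : br (mu j) = 0) (hm : br (mu i + 1) = 0) :
    Module.finrank ℂ (Irr L (lam + mu - root 2)) = 1 ∧ Typ (lam + mu) ∧
    Nonempty (TensorMod L (Irr L lam) (Irr L mu) ≃ₗ[QGrp L]
      Irr L (lam + mu) × Irr L (lam + mu - root 2)) := by
  have hni : br ((lam + mu) i + 1) = 0 := by
    rw [Pi.add_apply, add_assoc]
    exact br_add_eq_zero hi hm
  have hnj : br ((lam + mu) j + 1) = 0 := by
    rw [Pi.add_apply, add_right_comm]
    exact br_add_eq_zero hl hj
  have ht : Typ (lam + mu) := by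
    refine Typ.of_ne hij (br_ne_of_add_one hni) (br_ne_of_add_one hnj) (br_ne_of_add_one ?_)
    rw [add_right_comm ((lam + mu) i), add_assoc]
    exact br_add_eq_zero hni hnj
  have h0 (k : Fin 2) : br ((lam + mu - root 2) k) = 0 := by
    rw [Pi.sub_apply, root_two_apply, br_sub_one, neg_eq_zero]
    obtain rfl | rfl : k = i ∨ k = j := by omega
    exacts [hni, hnj]
  have h1 : Module.finrank ℂ (Irr L (lam + mu - root 2)) = 1 := finrank_irr_eq_one (h0 0) (h0 1)
  refine ⟨h1, ht, tensor_equiv_highestRoot hij ht hi hj (br_ne_of_add_one hl)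
    (br_ne_of_add_one hm) ?_⟩
  have h3 := finrank_irr_le_three (L := L) hij hi hl
  have h3' := finrank_irr_le_three (L := L) hij.symm hj hm
  rw [h1, ht.finrank_irr]
  -- Two factors of dimension at most 3 give at most 9 = 8 + 1.
  nlinarith

theorem Typ.finrank_irrModule (h : Typ lam) : Module.finrank ℂ (irrModule L lam) = 8 :=
  h.finrank_irr

theorem perm_cases {i j k : Fin 3} (h : ({i, j, k} : Set (Fin 3)) = {0, 1, 2}) :
    (i = 0 ∧ j = 1 ∧ k = 2) ∨ (i = 1 ∧ j = 0 ∧ k = 2) ∨ (i = 0 ∧ j = 2 ∧ k = 1) ∨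
      (i = 1 ∧ j = 2 ∧ k = 0) ∨ (i = 2 ∧ j = 0 ∧ k = 1) ∨ (i = 2 ∧ j = 1 ∧ k = 0) := by
  have h0 : (0 : Fin 3) ∈ ({i, j, k} : Set (Fin 3)) := by simp [h]
  have h1 : (1 : Fin 3) ∈ ({i, j, k} : Set (Fin 3)) := by simp [h]
  have h2 : (2 : Fin 3) ∈ ({i, j, k} : Set (Fin 3)) := by simp [h]
  simp only [Set.mem_insert_iff, Set.mem_singleton_iff] at h0 h1 h2
  omega

theorem pair_cases {i j : Fin 3} (h : ({i, j} : Set (Fin 3)) = {0, 1}) :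
    (i = 0 ∧ j = 1) ∨ (i = 1 ∧ j = 0) := by
  have h0 : (0 : Fin 3) ∈ ({i, j} : Set (Fin 3)) := by simp [h]
  have h1 : (1 : Fin 3) ∈ ({i, j} : Set (Fin 3)) := by simp [h]
  simp only [Set.mem_insert_iff, Set.mem_singleton_iff] at h0 h1
  omega

end Main

end UnrolledSL3

end

open UnrolledSL3 in
theorem mainTheorem8 (L : IntermediateLattice) (lam mu : Weight) :
    -- products `L⁽⁴⁾ ⊗ L⁽⁴⁾`
    (IsAtypicalOfDegree 1 lam → IsAtypicalOfDegree 1 mu →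
      (∀ i j k : Fin 3, ({i, j, k} : Set (Fin 3)) = {0, 1, 2} →
        IsOddInt (index lam i) → IsOddInt (index mu j) → IsTypical (lam + mu) →
        ∃ P P' : WeightModule L,
          IsProjectiveCover L (lam + mu) P ∧ Module.finrank ℂ P = 8 ∧
          IsProjectiveCover L (lam + mu - root k) P' ∧ Module.finrank ℂ P' = 8 ∧
          Nonempty (TensorMod L (Irr L lam) (Irr L mu) ≃ₗ[QGrp L] P × P')) ∧
      (∀ i j : Fin 3, ({i, j} : Set (Fin 3)) = {0, 1} →
        IsOddInt (index lam i) → IsOddInt (index mu i) → IsAtypicalOfDegree 1 (lam + mu) →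
        Module.finrank ℂ (Irr L (lam + mu)) = 4 ∧
        Module.finrank ℂ (Irr L (lam + mu - root j - root 2)) = 4 ∧
        ∃ P : WeightModule L,
          IsProjectiveCover L (lam + mu - root j) P ∧ Module.finrank ℂ P = 8 ∧
          Nonempty (TensorMod L (Irr L lam) (Irr L mu) ≃ₗ[QGrp L]
            Irr L (lam + mu) × P × Irr L (lam + mu - root j - root 2))) ∧
      (IsOddInt (index lam 2) → IsOddInt (index mu 2) →
        IsAtypicalOfDegree 1 (lam + mu - root 0) → IsAtypicalOfDegree 1 (lam + mu - root 1) →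
        Module.finrank ℂ (Irr L (lam + mu - root 0)) = 4 ∧
        Module.finrank ℂ (Irr L (lam + mu - root 1)) = 4 ∧
        ∃ P : WeightModule L,
          IsProjectiveCover L (lam + mu) P ∧ Module.finrank ℂ P = 8 ∧
          Nonempty (TensorMod L (Irr L lam) (Irr L mu) ≃ₗ[QGrp L]
            P × Irr L (lam + mu - root 0) × Irr L (lam + mu - root 1)))) ∧
    -- products `L⁽³⁾ ⊗ L⁽⁴⁾`
    (IsAtypicalOfDegree 2 lam → IsOddInt (index lam 2) → IsAtypicalOfDegree 1 mu →
      (∀ i j k : Fin 3, i ∈ ({0, 1} : Set (Fin 3)) → ({i, j, k} : Set (Fin 3)) = {0, 1, 2} →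
        IsOddInt (index lam i) → IsOddInt (index mu j) →
        Module.finrank ℂ (Irr L (lam + mu - root k)) = 4 ∧
        ∃ P : WeightModule L,
          IsProjectiveCover L (lam + mu) P ∧ Module.finrank ℂ P = 8 ∧
          Nonempty (TensorMod L (Irr L lam) (Irr L mu) ≃ₗ[QGrp L]
            P × Irr L (lam + mu - root k))) ∧
      (∀ i j : Fin 3, ({i, j} : Set (Fin 3)) = {0, 1} →
        IsOddInt (index lam i) → IsOddInt (index mu i) →
        Module.finrank ℂ (Irr L (lam + mu)) = 4 ∧
        ∃ P : WeightModule L,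
          IsProjectiveCover L (lam + mu - root j) P ∧ Module.finrank ℂ P = 8 ∧
          Nonempty (TensorMod L (Irr L lam) (Irr L mu) ≃ₗ[QGrp L] Irr L (lam + mu) × P))) ∧
    -- products `L⁽³⁾ ⊗ L⁽³⁾`
    (IsAtypicalOfDegree 2 lam → IsAtypicalOfDegree 2 mu →
      ∀ i j : Fin 3, ({i, j} : Set (Fin 3)) = {0, 1} →
        IsOddInt (index lam i) → IsOddInt (index lam 2) →
        IsOddInt (index mu j) → IsOddInt (index mu 2) →
        Module.finrank ℂ (Irr L (lam + mu - root 2)) = 1 ∧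
        ∃ P : WeightModule L,
          IsProjectiveCover L (lam + mu) P ∧ Module.finrank ℂ P = 8 ∧
          Nonempty (TensorMod L (Irr L lam) (Irr L mu) ≃ₗ[QGrp L]
            P × Irr L (lam + mu - root 2))) := by
  have h01 : (0 : Fin 2) ≠ 1 := by decide
  have r0 : root 0 = simpleRoot 0 := rfl
  have r1 : root 1 = simpleRoot 1 := rfl
  refine ⟨fun hl hm => ⟨?_, ?_, ?_⟩, fun _ hl3 hm => ⟨?_, ?_⟩, ?_⟩
  · intro i j k hijk hi hj ht
    have ht := ht.typ
    have wrap {κ : Weight} (h : Typ κ ∧ Nonempty (TensorMod L (Irr L lam) (Irr L mu) ≃ₗ[QGrp L]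
        Irr L (lam + mu) × Irr L κ)) : ∃ P P' : WeightModule L,
          IsProjectiveCover L (lam + mu) P ∧ Module.finrank ℂ P = 8 ∧
          IsProjectiveCover L κ P' ∧ Module.finrank ℂ P' = 8 ∧
          Nonempty (TensorMod L (Irr L lam) (Irr L mu) ≃ₗ[QGrp L] P × P') :=
      ⟨irrModule L _, irrModule L _, ht.isProjectiveCover, ht.finrank_irrModule,
        h.1.isProjectiveCover, h.1.finrank_irrModule, h.2⟩
    refine wrap ?_
    rcases perm_cases hijk with ⟨rfl, rfl, rfl⟩ | ⟨rfl, rfl, rfl⟩ | ⟨rfl, rfl, rfl⟩ |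
      ⟨rfl, rfl, rfl⟩ | ⟨rfl, rfl, rfl⟩ | ⟨rfl, rfl, rfl⟩ <;>
      simp only [isOddInt_index_zero, isOddInt_index_one, isOddInt_index_two] at hi hj
    · exact tensor_simple_ne h01 hi (hl.nonInt h01 hi) hj (hm.nonInt h01.symm hj) ht
    · exact tensor_simple_ne h01.symm hi (hl.nonInt h01.symm hi) hj (hm.nonInt h01 hj) ht
    · exact tensor_simple_highest h01 hi (hl.nonInt h01 hi) hj (hm.nonInt_of_add hj).1
        (hm.nonInt_of_add hj).2 ht
    · exact tensor_simple_highest h01.symm hi (hl.nonInt h01.symm hi) hj (hm.nonInt_of_add hj).1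
        (hm.nonInt_of_add hj).2 ht
    · exact tensor_highest_simple h01 hj (hm.nonInt h01 hj) hi (hl.nonInt_of_add hi).1
        (hl.nonInt_of_add hi).2 ht
    · exact tensor_highest_simple h01.symm hj (hm.nonInt h01.symm hj) hi (hl.nonInt_of_add hi).1
        (hl.nonInt_of_add hi).2 ht
  · intro i j hij hi hj hn
    rcases pair_cases hij with ⟨rfl, rfl⟩ | ⟨rfl, rfl⟩ <;>
      simp only [isOddInt_index_zero, isOddInt_index_one] at hi hj
    · obtain ⟨h4, h4', ht, he⟩ := tensor_simple_same (L := L) h01 hi (hl.nonInt h01 hi) hj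
        (hm.nonInt h01 hj) (hn.nonInt h01 (br_add_eq_zero hi hj))
      exact ⟨h4, h4', irrModule L _, ht.isProjectiveCover, ht.finrank_irrModule, he⟩
    · obtain ⟨h4, h4', ht, he⟩ := tensor_simple_same (L := L) h01.symm hi
        (hl.nonInt h01.symm hi) hj (hm.nonInt h01.symm hj)
        (hn.nonInt h01.symm (br_add_eq_zero hi hj))
      exact ⟨h4, h4', irrModule L _, ht.isProjectiveCover, ht.finrank_irrModule, he⟩
  · intro hi hj hn _
    rw [isOddInt_index_two] at hi hj
    rw [r0] at hn
    obtain ⟨hn0, hn1⟩ := hn.nonInt_of_add (br_index_two_sub_simpleRoot hi hj 0)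
    -- Non-integrality is unaffected by adding back α_1, so it passes to the coordinates of λ + μ.
    have hn' (k : Fin 2) (h : NonInt ((lam + mu - simpleRoot 0) k)) : NonInt ((lam + mu) k) := by
      simpa using h.add_right (simpleRoot_isInt 0 k)
    obtain ⟨h4, ht, he⟩ := tensor_highest (L := L) hi (hl.nonInt_of_add hi).1
      (hl.nonInt_of_add hi).2 hj (hm.nonInt_of_add hj).1 (hm.nonInt_of_add hj).2 (hn' 0 hn0)
      (hn' 1 hn1)
    exact ⟨h4 0, h4 1, irrModule L _, ht.isProjectiveCover, ht.finrank_irrModule, he⟩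
  · intro i j k hi01 hijk hi hj
    have wrap {κ : Weight} (h : Module.finrank ℂ (Irr L κ) = 4 ∧ Typ (lam + mu) ∧
        Nonempty (TensorMod L (Irr L lam) (Irr L mu) ≃ₗ[QGrp L] Irr L (lam + mu) × Irr L κ)) :
        Module.finrank ℂ (Irr L κ) = 4 ∧ ∃ P : WeightModule L,
          IsProjectiveCover L (lam + mu) P ∧ Module.finrank ℂ P = 8 ∧
          Nonempty (TensorMod L (Irr L lam) (Irr L mu) ≃ₗ[QGrp L] P × Irr L κ) :=
      ⟨h.1, irrModule L _, h.2.1.isProjectiveCover, h.2.1.finrank_irrModule, h.2.2⟩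
    refine wrap ?_
    rw [isOddInt_index_two] at hl3
    rcases perm_cases hijk with ⟨rfl, rfl, rfl⟩ | ⟨rfl, rfl, rfl⟩ | ⟨rfl, rfl, rfl⟩ |
      ⟨rfl, rfl, rfl⟩ | ⟨rfl, rfl, rfl⟩ | ⟨rfl, rfl, rfl⟩ <;>
      simp only [isOddInt_index_zero, isOddInt_index_one, isOddInt_index_two] at hi hj
    · exact tensor_three_simple_ne h01 hi (br_add_one_eq_zero h01 hi hl3) hj
        (hm.nonInt h01.symm hj)
    · exact tensor_three_simple_ne h01.symm hi (br_add_one_eq_zero h01.symm hi hl3) hj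
        (hm.nonInt h01 hj)
    · exact tensor_three_highest h01 hi hl3 hj (hm.nonInt_of_add hj).1 (hm.nonInt_of_add hj).2
    · exact tensor_three_highest h01.symm hi hl3 hj (hm.nonInt_of_add hj).1
        (hm.nonInt_of_add hj).2
    · simp at hi01
    · simp at hi01
  · intro i j hij hi hj
    rw [isOddInt_index_two] at hl3
    rcases pair_cases hij with ⟨rfl, rfl⟩ | ⟨rfl, rfl⟩ <;>
      simp only [isOddInt_index_zero, isOddInt_index_one] at hi hj
    · obtain ⟨h4, ht, he⟩ := tensor_three_simple_same (L := L) h01 hi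
        (br_add_one_eq_zero h01 hi hl3) hj (hm.nonInt h01 hj)
      exact ⟨h4, irrModule L _, ht.isProjectiveCover, ht.finrank_irrModule, he⟩
    · obtain ⟨h4, ht, he⟩ := tensor_three_simple_same (L := L) h01.symm hi
        (br_add_one_eq_zero h01.symm hi hl3) hj (hm.nonInt h01.symm hj)
      exact ⟨h4, irrModule L _, ht.isProjectiveCover, ht.finrank_irrModule, he⟩
  · intro _ _ i j hij hi hi3 hj hj3
    rw [isOddInt_index_two] at hi3 hj3
    rcases pair_cases hij with ⟨rfl, rfl⟩ | ⟨rfl, rfl⟩ <;>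
      simp only [isOddInt_index_zero, isOddInt_index_one] at hi hj
    · obtain ⟨h1, ht, he⟩ := tensor_three_three (L := L) h01 hi (br_add_one_eq_zero h01 hi hi3) hj
        (br_add_one_eq_zero h01.symm hj hj3)
      exact ⟨h1, irrModule L _, ht.isProjectiveCover, ht.finrank_irrModule, he⟩
    · obtain ⟨h1, ht, he⟩ := tensor_three_three (L := L) h01.symm hi
        (br_add_one_eq_zero h01.symm hi hi3) hj (br_add_one_eq_zero h01 hj hj3)
      exact ⟨h1, irrModule L _, ht.isProjectiveCover, ht.finrank_irrModule, he⟩
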